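/- Let $p$ be a prime and $d\ge 1$ an integer. Let $L_0=\operatorname{Frac}W(\overline{\mathbb F}_p)$ with Frobenius $\sigma$, and let $(N,\Phi)$ be a $2d$-dimensional isocrystal over $\overline{\mathbb F}_p$ (a $2d$-dimensional $L_0$-vector space with a bijective $\sigma$-linear map $\Phi$) which is isoclinic of slope $1/2$, i.e. $N$ contains a $W(\overline{\mathbb F}_p)$-lattice $M$ with $\Phi^2M=pM$. Let $\psi\colon N\times N\to L_0$ be a perfect alternating pairing with $\psi(\Phi x,\Phi y)=p\,\sigma(\psi(x,y))$. Let $\mathbf J$ be the algebraic group over $\mathbb Q_p$ such that, for a commutative $\mathbb Q_p$-algebra $R$, $\mathbf J(R)$ is the group of all $g\in\operatorname{Aut}_{R\otimes_{\mathbb Q_p}L_0}(R\otimes_{\mathbb Q_p}N)$ that commute with $\mathrm{id}_R\otimes\Phi$ and satisfy $\psi(gx,gy)=c(g)\psi(x,y)$ for some $c(g)\in(R\otimes_{\mathbb Q_p}L_0)^\times$; put $J=\mathbf J(\mathbb Q_p)$. An element $h\in J$ is called regular if its centralizer in $\mathbf J$ is a maximal torus of $\mathbf J$, and elliptic if it lies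 in a maximal torus of $\mathbf J$ which is anisotropic modulo the center of $\mathbf J$. Let $\mathcal F$ be the Lagrangian Grassmannian over $L_0$ parametrizing $d$-dimensional subspaces $\mathrm{Fil}\subset N$ with $\mathrm{Fil}^\perp=\mathrm{Fil}$, on which $J$ acts. For a finite extension $L$ of $L_0$, a point $\mathrm{Fil}\in\mathcal F(L)$ is weakly admissible if $\dim_L\bigl((L\otimes_{L_0}N')\cap\mathrm{Fil}\bigr)\le\tfrac12\dim_{L_0}N'$ for every $\Phi$-stable subspace $N'\subset N$; the period domain $\Omega\subset\mathcal F$ is characterized by the condition that $\Omega(L)$ is the set of weakly admissible points of $\mathcal F(L)$ for every such $L$. Let $h\in J$ be regular. Then all fixed points of $h$ on $\mathcal F$ are discrete with multiplicity one, i.e. the fixed point scheme $\mathcal F^h$ is finite étale over $L_0$. If moreover $h$ is elliptic, then every fixed point of $h$ on $\mathcal F$ lies in $\Omega$: for every finite extension $L$ of $L_0$, every point of $\mathcal F(L)$ fixed by $h$ is weakly admissible. -/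

import Mathlib

open CategoryTheory TensorProduct Module WittVector
open scoped Isocrystal Grassmannian

noncomputable section

/-! ### Group functors, tori, regular and elliptic elements -/

namespace GroupFunctor

universe u

variable {F : Type} [Field F] (G : CommAlgCat.{0} F ⥤ GrpCat.{u})

/-- A subgroup functor of a group functor on commutative `F`-algebras. -/
structure SubgroupFunctor where
  obj : ∀ R : CommAlgCat.{0} F, Subgroup (G.obj R)
  map_mem : ∀ {R S : CommAlgCat.{0} F} (f : R ⟶ S) (g : G.obj R), g ∈ obj R → G.map f g ∈ obj S

namespace SubgroupFunctor

variable {G}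

/-- A subgroup functor, as a group functor in its own right. -/
def toFunctor (T : SubgroupFunctor G) : CommAlgCat.{0} F ⥤ GrpCat.{u} where
  obj R := GrpCat.of (T.obj R)
  map {R S} f := GrpCat.ofHom
    { toFun := fun g ↦ ⟨G.map f g.1, T.map_mem f g.1 g.2⟩
      map_one' := Subtype.ext (map_one (G.map f).hom)
      map_mul' := fun a b ↦ Subtype.ext (map_mul (G.map f).hom a.1 b.1) }
  map_id R := by
    ext x
    change G.map (𝟙 R) x.1 = x.1
    simp
  map_comp f g := by
    ext x
    change G.map (f ≫ g) x.1 = G.map g (G.map f x.1)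
    simp

/-- `T ≤ T'` if `T(R) ⊆ T'(R)` for all `R`. -/
instance : LE (SubgroupFunctor G) := ⟨fun T T' ↦ ∀ R, T.obj R ≤ T'.obj R⟩

end SubgroupFunctor

/-- The centralizer of a rational point `h ∈ G(F)`: its `R`-points are the elements of `G(R)`
that commute with the image of `h` in `G(R)`. -/
def centralizer (h : G.obj (CommAlgCat.of F F)) : SubgroupFunctor G where
  obj R := Subgroup.centralizer {G.map (CommAlgCat.ofHom (Algebra.ofId F R)) h}
  map_mem {R S} f g hg := by
    rw [Subgroup.mem_centralizer_singleton_iff] at hg ⊢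
    have e : G.map (CommAlgCat.ofHom (Algebra.ofId F S)) h =
        G.map f (G.map (CommAlgCat.ofHom (Algebra.ofId F R)) h) := by
      rw [← ConcreteCategory.comp_apply, ← G.map_comp]
      congr 3
      ext
    rw [e]
    have := congrArg (G.map f) hg
    simpa only [map_mul] using this

/-- The center of `G`: its `R`-points are the elements of `G(R)` whose image in `G(S)` is central
for every `R`-algebra `S`. -/
def center : SubgroupFunctor G where
  obj R :=
    { carrier := {z | ∀ (S : CommAlgCat.{0} F) (f : R ⟶ S) (x : G.obj S),
        G.map f z * x = x * G.map f z}
      one_mem' := by intro S f x; simp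
      mul_mem' := by
        intro a b ha hb S f x
        rw [map_mul, mul_assoc, hb, ← mul_assoc, ha, mul_assoc]
      inv_mem' := by
        intro a ha S f x
        rw [map_inv, inv_mul_eq_iff_eq_mul, ← mul_assoc, ha, mul_inv_cancel_right] }
  map_mem {R S} f g hg := by
    intro S' f' x
    have := hg S' (f ≫ f') x
    simpa using this

/-- The split torus `𝔾ₘⁿ`, as the group functor `R ↦ (Rˣ)ⁿ` on commutative `K`-algebras. -/
def splitTorus (K : Type) [Field K] (n : ℕ) : CommAlgCat.{0} K ⥤ GrpCat.{0} where
  obj R := GrpCat.of (Fin n → (R : Type)ˣ)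
  map f := GrpCat.ofHom (MonoidHom.compLeft (Units.map (f.hom : _ →* _)) (Fin n))

/-- A `K`-algebra regarded as an `F`-algebra. -/
def restrictAlg (F K : Type) [Field F] [Field K] [Algebra F K] :
    CommAlgCat.{0} K ⥤ CommAlgCat.{0} F where
  obj R :=
    letI : Algebra F R := Algebra.compHom R (algebraMap F K)
    CommAlgCat.of F R
  map {R S} f :=
    letI : Algebra F R := Algebra.compHom R (algebraMap F K)
    letI : Algebra F S := Algebra.compHom S (algebraMap F K)
    CommAlgCat.ofHom
      { (f.hom : (R : Type) →+* (S : Type)) with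
        commutes' := fun a ↦ f.hom.commutes (algebraMap F K a) }

/-- A group functor over `F` is an affine algebraic group if it is represented by a finitely
generated commutative `F`-algebra. -/
def IsAffineAlgebraic (T : CommAlgCat.{0} F ⥤ GrpCat.{0}) : Prop :=
  ∃ A : CommAlgCat.{0} F, Algebra.FiniteType F A ∧
    Nonempty ((T ⋙ forget GrpCat.{0}).CorepresentableBy A)

/-- A torus over `F`: an affine algebraic group over `F` which becomes isomorphic to some `𝔾ₘⁿ`
over an algebraic closure of `F`. -/
def IsTorus (T : CommAlgCat.{0} F ⥤ GrpCat.{0}) : Prop :=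
  IsAffineAlgebraic T ∧
    ∃ n : ℕ, Nonempty (restrictAlg F (AlgebraicClosure F) ⋙ T ≅ splitTorus (AlgebraicClosure F) n)

variable {G : CommAlgCat.{0} F ⥤ GrpCat.{0}}

/-- A maximal torus of `G`: a subtorus (over `F`) not contained in any strictly larger subtorus. -/
def IsMaximalTorus (T : SubgroupFunctor G) : Prop :=
  IsTorus T.toFunctor ∧ ∀ T' : SubgroupFunctor G, IsTorus T'.toFunctor → T ≤ T' → T' ≤ T

/-- A subtorus `T` of `G` is anisotropic modulo the center of `G` if the split part of `T` is
central, that is, if every homomorphism `𝔾ₘ → T` defined over `F` has image in the center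
of `G`. -/
def IsAnisotropicModCenter (T : SubgroupFunctor G) : Prop :=
  ∀ (c : splitTorus F 1 ⟶ T.toFunctor) (R : CommAlgCat.{0} F) (t : (splitTorus F 1).obj R),
    (show T.obj R from c.app R t).1 ∈ (center G).obj R

/-- `h ∈ G(F)` is regular if its centralizer is a maximal torus. -/
def IsRegularElement (h : G.obj (CommAlgCat.of F F)) : Prop :=
  IsMaximalTorus (centralizer G h)

/-- `h ∈ G(F)` is elliptic if it lies in an elliptic maximal torus, that is, in a maximal torus
which is anisotropic modulo the center of `G`. -/
def IsEllipticElement (h : G.obj (CommAlgCat.of F F)) : Prop :=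
  ∃ T : SubgroupFunctor G, IsMaximalTorus T ∧ IsAnisotropicModCenter T ∧ h ∈ T.obj (CommAlgCat.of F F)

end GroupFunctor

/-! ### `ℚ_p` inside the fraction field of the Witt vectors -/

namespace PolarizedIsocrystal

section Coefficients

variable (p : ℕ) [Fact p.Prime] (k : Type) [Field k] [CharP k p]

/-- The ring homomorphism `ℤ_p = W(𝔽_p) → W(k) → K(p, k)`. -/
def padicIntToK : ℤ_[p] →+* K(p, k) :=
  (algebraMap (WittVector p k) K(p, k)).comp
    ((WittVector.map (ZMod.castHom (dvd_refl p) k)).comp (WittVector.equiv p).symm.toRingHom)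

lemma padicIntToK_injective : Function.Injective (padicIntToK p k) := by
  refine (IsFractionRing.injective (WittVector p k) K(p, k)).comp
    (Function.Injective.comp ?_ (WittVector.equiv p).symm.injective)
  exact WittVector.map_injective _ (RingHom.injective _)

/-- The field `K(p, k) = Frac W(k)` as an extension of `ℚ_p = Frac W(𝔽_p)`. -/
instance : Algebra ℚ_[p] K(p, k) :=
  (IsFractionRing.lift (padicIntToK_injective p k) : ℚ_[p] →+* K(p, k)).toAlgebra

lemma algebraMap_padicInt (x : ℤ_[p]) :
    algebraMap ℚ_[p] K(p, k) (algebraMap ℤ_[p] ℚ_[p] x) = padicIntToK p k x :=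
  IsFractionRing.lift_algebraMap (padicIntToK_injective p k) x

variable [PerfectRing k p]

lemma frobenius_padicIntToK (x : ℤ_[p]) : φ(p, k) (padicIntToK p k x) = padicIntToK p k x := by
  have h1 : ∀ y : WittVector p k, φ(p, k) (algebraMap (WittVector p k) K(p, k) y) =
      algebraMap (WittVector p k) K(p, k) (WittVector.frobenius y) := fun y ↦
    IsFractionRing.ringEquivOfRingEquiv_algebraMap (WittVector.frobeniusEquiv p k) y
  change φ(p, k) (algebraMap (WittVector p k) K(p, k) (WittVector.map _ _)) =
    algebraMap (WittVector p k) K(p, k) (WittVector.map _ _)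
  rw [h1]
  congr 1
  ext n
  rw [WittVector.coeff_frobenius_charP, WittVector.map_coeff, ← map_pow, ZMod.pow_card]

lemma frobenius_algebraMap (x : ℚ_[p]) :
    φ(p, k) (algebraMap ℚ_[p] K(p, k) x) = algebraMap ℚ_[p] K(p, k) x := by
  obtain ⟨a, b, _, rfl⟩ := IsFractionRing.div_surjective (A := ℤ_[p]) x
  simp only [map_div₀, algebraMap_padicInt, frobenius_padicIntToK]

end Coefficients

/-! ### Isocrystals of slope `r / s` and polarizations -/

section Isocrystals

variable (p : ℕ) [Fact p.Prime] (k : Type) [Field k] [CharP k p] [PerfectRing k p]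
variable (N : Type) [AddCommGroup N] [Isocrystal p k N]

variable {N} in
/-- The Frobenius `Φ` of the isocrystal `N`, as a function. -/
def Phi (x : N) : N := (Isocrystal.frob (p := p) (k := k) (V := N)).toLinearMap x

/-- The isocrystal `N` is isoclinic of slope `r / s`: there is a `W(k)`-lattice `M` in `N` with
`Φ ^ s M = p ^ r M`. -/
def IsIsoclinic (r s : ℕ) : Prop :=
  letI : Module (WittVector p k) N :=
    Module.compHom N (algebraMap (WittVector p k) K(p, k))
  ∃ M : Submodule (WittVector p k) N, M.FG ∧ Submodule.span K(p, k) (M : Set N) = ⊤ ∧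
    (Phi p k : N → N)^[s] '' (M : Set N) = (fun x : N ↦ (p : K(p, k)) ^ r • x) '' (M : Set N)

variable {N}

/-- A perfect alternating pairing `ψ` on `N` with `ψ(Φ x, Φ y) = p σ(ψ(x, y))`. -/
structure IsPolarization (ψ : LinearMap.BilinForm K(p, k) N) : Prop where
  isAlt : ψ.IsAlt
  nondegenerate : ψ.Nondegenerate
  frobenius : ∀ x y : N, ψ (Phi p k x) (Phi p k y) = (p : K(p, k)) * φ(p, k) (ψ x y)

end Isocrystals

/-! ### The group functor `𝐉` -/

section BaseChange

variable {F : Type} [Field F] {N : Type} [AddCommGroup N] [Module F N]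
variable {R S T : Type} [CommRing R] [Algebra F R] [CommRing S] [Algebra F S]
  [CommRing T] [Algebra F T]

/-- The base change along `f : R → S` of an endomorphism of `R ⊗ N`, as a function. -/
def endBaseChangeFun (f : R →ₐ[F] S) (g : Module.End R (R ⊗[F] N)) : Module.End S (S ⊗[F] N) :=
  LinearMap.liftBaseChange S
    ((TensorProduct.map f.toLinearMap LinearMap.id) ∘ₗ (g.restrictScalars F) ∘ₗ
      (TensorProduct.mk F R N 1))

lemma endBaseChangeFun_map (f : R →ₐ[F] S) (g : Module.End R (R ⊗[F] N)) (x : R ⊗[F] N) :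
    endBaseChangeFun f g (TensorProduct.map f.toLinearMap LinearMap.id x) =
      TensorProduct.map f.toLinearMap LinearMap.id (g x) := by
  have hs : ∀ (r : R) (y : R ⊗[F] N),
      TensorProduct.map f.toLinearMap (LinearMap.id (R := F) (M := N)) (r • y) =
        f r • TensorProduct.map f.toLinearMap (LinearMap.id (R := F) (M := N)) y := by
    intro r y
    induction y with
    | zero => simp
    | tmul a n => simp [TensorProduct.smul_tmul']
    | add a b ha hb => simp only [smul_add, map_add, ha, hb]
  induction x with
  | zero => simp
  | add a b ha hb => simp only [map_add, ha, hb]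
  | tmul r n =>
    have : r ⊗ₜ[F] n = r • ((1 : R) ⊗ₜ[F] n) := by simp [TensorProduct.smul_tmul']
    rw [this, LinearMap.map_smul g, hs, hs, LinearMap.map_smul (endBaseChangeFun f g)]
    simp [endBaseChangeFun]

lemma end_ext {g g' : Module.End S (S ⊗[F] N)}
    (h : ∀ n : N, g ((1 : S) ⊗ₜ n) = g' ((1 : S) ⊗ₜ n)) : g = g' := by
  ext n
  simpa using h n

/-- The base change along `f : R → S` of endomorphisms of `R ⊗ N`. It is characterized by
`endBaseChange f g ∘ (f ⊗ id) = (f ⊗ id) ∘ g`. -/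
def endBaseChange (f : R →ₐ[F] S) : Module.End R (R ⊗[F] N) →* Module.End S (S ⊗[F] N) where
  toFun := endBaseChangeFun f
  map_one' := by
    apply end_ext
    intro n
    simp [endBaseChangeFun]
  map_mul' g g' := by
    apply end_ext
    intro n
    have e : (1 : S) ⊗ₜ[F] n = TensorProduct.map f.toLinearMap LinearMap.id ((1 : R) ⊗ₜ[F] n) := by
      simp
    rw [e, endBaseChangeFun_map, Module.End.mul_apply, Module.End.mul_apply, endBaseChangeFun_map,
      endBaseChangeFun_map]

lemma endBaseChange_map (f : R →ₐ[F] S) (g : Module.End R (R ⊗[F] N)) (x : R ⊗[F] N) :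
    endBaseChange f g (TensorProduct.map f.toLinearMap LinearMap.id x) =
      TensorProduct.map f.toLinearMap LinearMap.id (g x) :=
  endBaseChangeFun_map f g x

lemma endBaseChange_one_tmul (f : R →ₐ[F] S) (g : Module.End R (R ⊗[F] N)) (n : N) :
    endBaseChange f g ((1 : S) ⊗ₜ n) =
      TensorProduct.map f.toLinearMap LinearMap.id (g ((1 : R) ⊗ₜ n)) := by
  rw [← endBaseChange_map]
  simp

lemma endBaseChange_baseChange (f : R →ₐ[F] S) (a : N →ₗ[F] N) :
    endBaseChange f (a.baseChange R) = a.baseChange S := by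
  apply end_ext
  intro n
  rw [endBaseChange_one_tmul]
  simp

lemma endBaseChange_id (g : Module.End R (R ⊗[F] N)) : endBaseChange (AlgHom.id F R) g = g := by
  apply end_ext
  intro n
  rw [endBaseChange_one_tmul]
  change TensorProduct.map LinearMap.id LinearMap.id _ = _
  simp

lemma endBaseChange_comp (f : R →ₐ[F] S) (f' : S →ₐ[F] T) (g : Module.End R (R ⊗[F] N)) :
    endBaseChange (f'.comp f) g = endBaseChange f' (endBaseChange f g) := by
  apply end_ext
  intro n
  rw [endBaseChange_one_tmul, endBaseChange_one_tmul, endBaseChange_one_tmul]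
  rw [← LinearMap.comp_apply, ← TensorProduct.map_comp]
  rfl

end BaseChange

section GroupJ

variable (p : ℕ) [Fact p.Prime] (k : Type) [Field k] [CharP k p] [PerfectRing k p]
variable {N : Type} [AddCommGroup N] [Isocrystal p k N]
variable [Module ℚ_[p] N] [IsScalarTower ℚ_[p] K(p, k) N]

/-- The Frobenius `Φ` of `N` as a `ℚ_p`-linear endomorphism. -/
def frobLin : N →ₗ[ℚ_[p]] N where
  toFun x := Phi p k x
  map_add' x y := map_add (Isocrystal.frob (p := p) (k := k) (V := N)).toLinearMap x y
  map_smul' a x := by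
    unfold Phi
    rw [← algebraMap_smul K(p, k) a x, LinearMap.map_smulₛₗ, frobenius_algebraMap,
      algebraMap_smul]
    rfl

/-- Multiplication by `a ∈ K(p, k)` on `N` as a `ℚ_p`-linear endomorphism. -/
def scalarLin (a : K(p, k)) : N →ₗ[ℚ_[p]] N where
  toFun x := a • x
  map_add' := smul_add a
  map_smul' b x := by
    rw [← algebraMap_smul K(p, k) b x, smul_comm, algebraMap_smul]
    rfl

variable (ψ : LinearMap.BilinForm K(p, k) N)

/-- The pairing `ψ_R : (R ⊗ N) × (R ⊗ N) → R ⊗ K(p, k)` obtained from `ψ` by extension of scalars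
from `ℚ_p` to `R`. -/
def pairing (R : Type) [CommRing R] [Algebra ℚ_[p] R] :
    LinearMap.BilinMap R (R ⊗[ℚ_[p]] N) (R ⊗[ℚ_[p]] K(p, k)) :=
  LinearMap.BilinMap.baseChange R
    (LinearMap.restrictScalars₁₂ ℚ_[p] ℚ_[p] ψ : LinearMap.BilinMap ℚ_[p] N K(p, k))

lemma pairing_tmul (R : Type) [CommRing R] [Algebra ℚ_[p] R] (a b : R) (x y : N) :
    pairing p k ψ R (a ⊗ₜ x) (b ⊗ₜ y) = (a * b) ⊗ₜ ψ x y := rfl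

/-- `g ∈ End_R(R ⊗ N)` is linear over `R ⊗ K(p, k)`, commutes with `id_R ⊗ Φ`, and multiplies
the pairing by a unit of `R ⊗ K(p, k)`. -/
structure IsSimilitude (R : Type) [CommRing R] [Algebra ℚ_[p] R]
    (g : Module.End R (R ⊗[ℚ_[p]] N)) : Prop where
  linear : ∀ a : K(p, k), Commute g ((scalarLin p k a).baseChange R)
  comm_frob : Commute g ((frobLin p k).baseChange R)
  similitude : ∃ c : (R ⊗[ℚ_[p]] K(p, k))ˣ, ∀ x y : R ⊗[ℚ_[p]] N,
    pairing p k ψ R (g x) (g y) = (c : R ⊗[ℚ_[p]] K(p, k)) * pairing p k ψ R x y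

/-- The group `𝐉(R)`. -/
def groupJ (R : Type) [CommRing R] [Algebra ℚ_[p] R] :
    Subgroup (Module.End R (R ⊗[ℚ_[p]] N))ˣ where
  carrier := {g | IsSimilitude p k ψ R g.1}
  one_mem' := ⟨fun _ ↦ Commute.one_left _, Commute.one_left _, 1, fun x y ↦ by simp⟩
  mul_mem' {a b} ha hb := by
    obtain ⟨ha1, ha2, ca, ha3⟩ := ha
    obtain ⟨hb1, hb2, cb, hb3⟩ := hb
    refine ⟨fun r ↦ (ha1 r).mul_left (hb1 r), ha2.mul_left hb2, ca * cb, fun x y ↦ ?_⟩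
    rw [Units.val_mul, Module.End.mul_apply, Module.End.mul_apply, ha3, hb3, Units.val_mul,
      mul_assoc]
  inv_mem' {a} ha := by
    obtain ⟨ha1, ha2, ca, ha3⟩ := ha
    refine ⟨fun r ↦ (ha1 r).units_inv_left, ha2.units_inv_left, ca⁻¹, fun x y ↦ ?_⟩
    rw [← Units.inv_mul_eq_iff_eq_mul, inv_inv, ← ha3, ← Module.End.mul_apply,
      ← Module.End.mul_apply, Units.mul_inv]
    rfl

variable {R S : Type} [CommRing R] [Algebra ℚ_[p] R] [CommRing S] [Algebra ℚ_[p] S]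

lemma pairing_map (f : R →ₐ[ℚ_[p]] S) (x y : R ⊗[ℚ_[p]] N) :
    pairing p k ψ S (TensorProduct.map f.toLinearMap LinearMap.id x)
      (TensorProduct.map f.toLinearMap LinearMap.id y) =
    Algebra.TensorProduct.map f (AlgHom.id ℚ_[p] K(p, k)) (pairing p k ψ R x y) := by
  induction x with
  | zero => simp
  | add a b ha hb => simp only [map_add, LinearMap.add_apply, ha, hb]
  | tmul r n =>
    induction y with
    | zero => simp
    | add a b ha hb => simp only [map_add, ha, hb]
    | tmul s m => simp [pairing_tmul]

lemma IsSimilitude.baseChange (f : R →ₐ[ℚ_[p]] S) {g : Module.End R (R ⊗[ℚ_[p]] N)}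
    (hg : IsSimilitude p k ψ R g) : IsSimilitude p k ψ S (endBaseChange f g) := by
  obtain ⟨h1, h2, c, h3⟩ := hg
  refine ⟨fun a ↦ ?_, ?_,
    Units.map (Algebra.TensorProduct.map f (AlgHom.id ℚ_[p] K(p, k)) : _ →* _) c, fun x y ↦ ?_⟩
  · rw [← endBaseChange_baseChange f]
    exact (h1 a).map _
  · rw [← endBaseChange_baseChange f]
    exact h2.map _
  · have key : ∀ n m : N, pairing p k ψ S (endBaseChange f g ((1 : S) ⊗ₜ n))
        (endBaseChange f g ((1 : S) ⊗ₜ m)) =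
        Algebra.TensorProduct.map f (AlgHom.id ℚ_[p] K(p, k)) c *
          pairing p k ψ S ((1 : S) ⊗ₜ n) ((1 : S) ⊗ₜ m) := by
      intro n m
      rw [endBaseChange_one_tmul, endBaseChange_one_tmul, pairing_map, h3, map_mul]
      congr 1
      simp [pairing_tmul]
    change _ = Algebra.TensorProduct.map f (AlgHom.id ℚ_[p] K(p, k)) c * _
    induction x with
    | zero => simp
    | add a b ha hb => simp only [map_add, LinearMap.add_apply, ha, hb, mul_add]
    | tmul r n =>
      induction y with
      | zero => simp
      | add a b ha hb => simp only [map_add, ha, hb, mul_add]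
      | tmul s m =>
        have er : r ⊗ₜ[ℚ_[p]] n = r • ((1 : S) ⊗ₜ[ℚ_[p]] n) := by simp [TensorProduct.smul_tmul']
        have es : s ⊗ₜ[ℚ_[p]] m = s • ((1 : S) ⊗ₜ[ℚ_[p]] m) := by simp [TensorProduct.smul_tmul']
        rw [er, es]
        simp only [map_smul, LinearMap.smul_apply, key, mul_smul_comm]

/-- The group functor `𝐉` on commutative `ℚ_p`-algebras: `𝐉(R)` is the group of automorphisms of
`R ⊗ N` over `R ⊗ K(p, k)` that commute with `id_R ⊗ Φ` and preserve `ψ` up to a unit. -/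
def J : CommAlgCat.{0} ℚ_[p] ⥤ GrpCat.{0} where
  obj R := GrpCat.of (groupJ p k ψ R)
  map {R S} f := GrpCat.ofHom
    (((Units.map (endBaseChange (N := N) f.hom)).comp (groupJ p k ψ R).subtype).codRestrict
      (groupJ p k ψ S) (fun g ↦ IsSimilitude.baseChange p k ψ f.hom g.2))
  map_id R := by
    apply GrpCat.hom_ext
    apply MonoidHom.ext
    intro g
    apply Subtype.ext
    apply Units.ext
    exact endBaseChange_id _
  map_comp f f' := by
    apply GrpCat.hom_ext
    apply MonoidHom.ext
    intro g
    apply Subtype.ext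
    apply Units.ext
    exact endBaseChange_comp _ _ _

variable {p k ψ}

/-- The `K(p, k)`-linear endomorphism of `N` given by an element of `J = 𝐉(ℚ_p)`, through the
identification `ℚ_p ⊗ N = N`. -/
def toEnd (h : (J p k ψ).obj (CommAlgCat.of ℚ_[p] ℚ_[p])) : N →ₗ[K(p, k)] N where
  toFun x := TensorProduct.lid ℚ_[p] N
    ((show groupJ p k ψ ℚ_[p] from h).1.1 ((1 : ℚ_[p]) ⊗ₜ[ℚ_[p]] x))
  map_add' x y := by rw [TensorProduct.tmul_add, map_add, map_add]
  map_smul' a x := by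
    have e := LinearMap.congr_fun ((show groupJ p k ψ ℚ_[p] from h).2.linear a).eq
      ((1 : ℚ_[p]) ⊗ₜ[ℚ_[p]] x)
    rw [Module.End.mul_apply, Module.End.mul_apply, LinearMap.baseChange_tmul] at e
    change TensorProduct.lid ℚ_[p] N ((show groupJ p k ψ ℚ_[p] from h).1.1
      ((1 : ℚ_[p]) ⊗ₜ[ℚ_[p]] scalarLin p k a x)) = _
    rw [e]
    generalize (show groupJ p k ψ ℚ_[p] from h).1.1 ((1 : ℚ_[p]) ⊗ₜ[ℚ_[p]] x) = z
    induction z with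
    | zero => simp
    | add u v hu hv => simp only [map_add, hu, hv, smul_add]
    | tmul r n =>
      rw [LinearMap.baseChange_tmul, TensorProduct.lid_tmul, TensorProduct.lid_tmul,
        RingHom.id_apply, ← map_smul]
      change scalarLin p k a (r • n) = _
      rfl

end GroupJ

/-! ### The Lagrangian Grassmannian, fixed points and weak admissibility -/

section Grassmannian

variable {K : Type} [Field K] {N : Type} [AddCommGroup N] [Module K N]

/-- The Lagrangian Grassmannian `𝓕`: its points in a `K`-algebra `A` are the `A`-submodules `Fil`
of `A ⊗ N` such that `(A ⊗ N) / Fil` is locally free of rank `d` and `Fil^⊥ = Fil`. (When `N` has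
dimension `2d`, `Fil` is then a locally direct summand of rank `d`.) -/
def lagrangian (d : ℕ) (ψ : LinearMap.BilinForm K N) (A : Type*) [CommRing A] [Algebra K A] :
    Set G(d, (A ⊗[K] N); A) :=
  {Fil | (ψ.baseChange A).orthogonal Fil.toSubmodule = Fil.toSubmodule}

/-- The points of `𝓕` with values in `A` that are fixed by a linear endomorphism `u` of `N`. -/
def fixedPoints (d : ℕ) (ψ : LinearMap.BilinForm K N) (u : N →ₗ[K] N)
    (A : Type*) [CommRing A] [Algebra K A] : Set G(d, (A ⊗[K] N); A) :=
  {Fil | Fil ∈ lagrangian d ψ A ∧ Fil.toSubmodule.map (u.baseChange A) = Fil.toSubmodule}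

/-- The fixed point scheme of `u` on `𝓕` is the spectrum of the `K`-algebra `E`: there is
a bijection between the `K`-algebra homomorphisms `E → A` and the fixed points of `u` in `𝓕(A)`,
natural in `A`. Here `f : A → B` sends `Fil ⊆ A ⊗ N` to the `B`-submodule of `B ⊗ N` generated by
its image. -/
def FixedPointSchemeIsSpec (d : ℕ) (ψ : LinearMap.BilinForm K N) (u : N →ₗ[K] N)
    (E : Type) [CommRing E] [Algebra K E] : Prop :=
  ∃ e : ∀ A : CommAlgCat.{0} K, (E →ₐ[K] A) ≃ fixedPoints d ψ u A,
    ∀ (A B : CommAlgCat.{0} K) (f : A →ₐ[K] B) (x : E →ₐ[K] A),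
      (e B (f.comp x)).1.toSubmodule =
        Submodule.span B (TensorProduct.map f.toLinearMap (LinearMap.id (R := K) (M := N)) ''
          ((e A x).1.toSubmodule : Set (A ⊗[K] N)))

/-- The fixed points of `u` on `𝓕` are discrete with multiplicity one: the fixed point scheme is
finite étale over `K`. -/
def FixedPointsDiscreteMultiplicityOne (d : ℕ) (ψ : LinearMap.BilinForm K N)
    (u : N →ₗ[K] N) : Prop :=
  ∃ (E : Type) (_ : CommRing E) (_ : Algebra K E),
    Module.Finite K E ∧ Algebra.Etale K E ∧ FixedPointSchemeIsSpec d ψ u E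

end Grassmannian

section WeaklyAdmissible

variable (p : ℕ) [Fact p.Prime] (k : Type) [Field k] [CharP k p] [PerfectRing k p]
variable {N : Type} [AddCommGroup N] [Isocrystal p k N]

/-- `Fil ⊆ L ⊗ N` is weakly admissible: `dim_L ((L ⊗ N') ∩ Fil) ≤ dim N' / 2` for every
`Φ`-stable subspace `N'` of `N`. -/
def IsWeaklyAdmissible (L : Type*) [Field L] [Algebra K(p, k) L]
    (Fil : Submodule L (L ⊗[K(p, k)] N)) : Prop :=
  ∀ N' : Submodule K(p, k) N, (∀ x ∈ N', Phi p k x ∈ N') →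
    (finrank L ↥(N'.baseChange L ⊓ Fil) : ℚ) ≤ 1 / 2 * (finrank K(p, k) N' : ℚ)

end WeaklyAdmissible

end PolarizedIsocrystal

end

/-! Write `K` for `Frac W(k)`, `D` for `End(N, Φ)`, `u` for the action of `h` on `N`, and `*` for
the adjoint with respect to `ψ`.

Conjugation by `Φ` makes `End_K(N)` an isocrystal of slope 0. Lang's theorem and `p`-adic
approximation give it a spanning set of fixed vectors, so `K ⊗ D = End_K(N)`
(`isBaseChange_isocrystalEnd`). Symplectic linear algebra on `N` therefore produces points of `𝐉`.

Regularity. Let `x` in `L ⊗ D` be skew, of square zero and commuting with `h`. Then `1 + X x` is a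
point of the centralizer over `L[X]`; the centralizer is a torus and the units of `L[X]` are
constants, so `x = 0` (`eq_zero_of_regular`). Over an algebraically closed `L`, orthogonal
eigenvectors `v, w` of `u` whose eigenvalues multiply to the similitude factor would give such an
`x`, namely `z ↦ ψ(z, v) w + ψ(z, w) v`. Hence `u` is diagonalizable with eigenlines, and its
commutant `C` in `End_K(N)` is commutative and reduced (`commute_and_reduced_of_regular`).

Fixed points. As `K[u]` is étale, a fixed Lagrangian over `A` is the range of a projector commuting
with `u`, that is, of an idempotent `e` of `A ⊗ C`; being Lagrangian means `e + e* = 1`. These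
idempotents are represented by an algebra of finite type. Idempotents of a commutative ring do not
deform, so this algebra is unramified, hence finite étale over the field `K`
(`fixedPointsDiscreteMultiplicityOne`).

Admissibility. If some `Φ`-stable subspace destabilizes a fixed `Fil`, an extremal one `P` is also
`u`-stable (`exists_stable_destabilizing`). It is the range of an idempotent `e` of `D` commuting
with `u`. If `e` were not self-adjoint, `f = e (1 - e*)` would be nonzero and `t ↦ t f + t⁻¹ f* + (1
- f - f*)` a noncentral cocharacter of the centralizer, against ellipticity
(`eq_zero_of_isElliptic`). So `e = e*`, the form is nondegenerate on `P`, and the isotropic space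
`P_L ∩ Fil` has at most half the dimension of `P`, a contradiction. -/

noncomputable section

/-! ### Fixed vectors of Frobenius-linear maps -/

namespace FrobeniusLinear

/-! ### Lang's theorem over an algebraically closed field of characteristic `p` -/

section Lang

variable {p : ℕ} [hp : Fact p.Prime] {k : Type*} [Field k] [CharP k p]

/-- The polynomials whose values are the coordinates of a fixed vector of a `p`-linear map with
cyclic vector `v` and `f^m v = ∑ a_i f^i v`. -/
def fixedPoly (p : ℕ) (a : ℕ → k) : ℕ → Polynomial k
  | 0 => 0
  | i + 1 => fixedPoly p a i ^ p + Polynomial.C (a i) * Polynomial.X ^ p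

omit hp [CharP k p] in
lemma X_pow_dvd_fixedPoly (hp0 : p ≠ 0) (a : ℕ → k) (i : ℕ) :
    Polynomial.X ^ p ∣ fixedPoly p a i := by
  induction i with
  | zero => exact dvd_zero _
  | succ i ih =>
    exact dvd_add (ih.trans (dvd_pow_self _ hp0)) (dvd_mul_left _ _)

-- The power `P_m ^ p` is divisible by `X ^ (p * p)`, so the coefficient of `X ^ p` in `P_(m+1)` is
-- exactly `a m`; peel off one `a i` at a time.
omit [CharP k p] in
lemma eq_zero_of_fixedPoly_eq_zero (a : ℕ → k) (m : ℕ) (h : fixedPoly p a m = 0) :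
    ∀ i < m, a i = 0 := by
  induction m with
  | zero => intro i hi; omega
  | succ m ih =>
    have hp2 := hp.out.two_le
    obtain ⟨Q, hQ⟩ := X_pow_dvd_fixedPoly hp.out.ne_zero a m
    have h' : fixedPoly p a m ^ p + Polynomial.C (a m) * Polynomial.X ^ p = 0 := h
    have hc : (fixedPoly p a m ^ p).coeff p = 0 := by
      rw [hQ, mul_pow, ← pow_mul, Polynomial.coeff_X_pow_mul', if_neg]
      have : p * 1 < p * p := Nat.mul_lt_mul_of_pos_left (by omega) (by omega)
      omega
    have ham : a m = 0 := by
      have := congrArg (fun q ↦ Polynomial.coeff q p) h'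
      simpa [hc] using this
    have hm : fixedPoly p a m = 0 := by
      rw [ham, map_zero, zero_mul, add_zero] at h'
      exact pow_eq_zero_iff hp.out.ne_zero |>.1 h'
    intro i hi
    rcases Nat.lt_succ_iff_lt_or_eq.1 hi with hi | rfl
    · exact ih hm i hi
    · exact ham

omit [CharP k p] in
lemma exists_fixedPoly_eval_eq [IsAlgClosed k] (a : ℕ → k) (m : ℕ) (h : ∃ i < m, a i ≠ 0) :
    ∃ y : k, y ≠ 0 ∧ (fixedPoly p a m).eval y = y := by
  have hne : fixedPoly p a m ≠ 0 := fun h0 ↦ by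
    obtain ⟨i, hi, hai⟩ := h
    exact hai (eq_zero_of_fixedPoly_eq_zero a m h0 i hi)
  obtain ⟨Q, hQ⟩ := X_pow_dvd_fixedPoly (k := k) hp.out.ne_zero a m
  have hp2 := hp.out.two_le
  -- Dividing the equation `y ^ p * Q y = y` by `y` excludes the trivial solution: a root of `R`
  -- cannot be `0`, because `p - 1 > 0`.
  set R : Polynomial k := Polynomial.X ^ (p - 1) * Q - 1 with hR
  have hQ0 : Q ≠ 0 := fun h0 ↦ hne (by rw [hQ, h0, mul_zero])
  have hdeg : R.degree ≠ 0 := by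
    intro hd
    have hd' : (Polynomial.X ^ (p - 1) * Q).degree ≤ 0 := by
      have : Polynomial.X ^ (p - 1) * Q = R + 1 := by rw [hR]; ring
      rw [this]
      exact (Polynomial.degree_add_le _ _).trans (by simp [hd])
    rw [Polynomial.degree_mul, Polynomial.degree_X_pow, Polynomial.degree_eq_natDegree hQ0] at hd'
    have : (p - 1) + Q.natDegree ≤ 0 := by exact_mod_cast hd'
    omega
  obtain ⟨y, hy⟩ := IsAlgClosed.exists_root R hdeg
  have hy' : y ^ (p - 1) * Q.eval y = 1 := by
    have : R.eval y = 0 := hy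
    rw [hR] at this
    simpa [sub_eq_zero] using this
  refine ⟨y, ?_, ?_⟩
  · rintro rfl
    rw [zero_pow (by omega), zero_mul] at hy'
    exact zero_ne_one hy'
  · rw [hQ, Polynomial.eval_mul, Polynomial.eval_pow, Polynomial.eval_X]
    obtain ⟨q, rfl⟩ : ∃ q, p = q + 1 := ⟨p - 1, by omega⟩
    rw [Nat.add_sub_cancel] at hy'
    rw [pow_succ', mul_assoc, hy', mul_one]

variable {V : Type*} [AddCommGroup V] [Module k V]

lemma exists_minimal_relation [FiniteDimensional k V] (s : ℕ → V) :
    ∃ m : ℕ, LinearIndependent k (fun i : Fin m ↦ s i) ∧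
      s m ∈ Submodule.span k (Set.range fun i : Fin m ↦ s i) := by
  have hex : ∃ m : ℕ, ¬ LinearIndependent k (fun i : Fin (m + 1) ↦ s i) := by
    refine ⟨finrank k V, fun h ↦ ?_⟩
    have := h.fintype_card_le_finrank
    simp at this
  classical
  refine ⟨Nat.find hex, ?_, ?_⟩
  · rcases h : Nat.find hex with _ | m
    · exact linearIndependent_empty_type
    · have := Nat.find_min hex (m := m) (by omega)
      exact not_not.1 this
  · by_contra hmem
    apply Nat.find_spec hex
    rw [linearIndependent_finSucc']
    have hli : LinearIndependent k (fun i : Fin (Nat.find hex) ↦ s i) := by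
      rcases h : Nat.find hex with _ | m
      · exact linearIndependent_empty_type
      · have := Nat.find_min hex (m := m) (by omega)
        exact not_not.1 this
    exact ⟨hli, hmem⟩

/-- On the cyclic subspace of `v`, the vector `∑ b_(i+1) f^i v` is fixed as soon as `b_(i+1) = b_i ^
p + a_i y ^ p` with `b_0 = 0` and `b_m = y`: the top term `y ^ p f^m v` is rewritten by the minimal
relation. The recursion solves to `fixedPoly`, and the last condition becomes a polynomial equation
for `y`. -/
lemma exists_fixed_ne_zero [IsAlgClosed k] [FiniteDimensional k V] [Nontrivial V]
    (f : V →ₛₗ[_root_.frobenius k p] V) (hf : Function.Injective f) :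
    ∃ w : V, w ≠ 0 ∧ f w = w := by
  obtain ⟨v, hv⟩ := exists_ne (0 : V)
  obtain ⟨m, hli, hmem⟩ := exists_minimal_relation (k := k) (fun i ↦ f^[i] v)
  obtain ⟨a', ha'⟩ := (Submodule.mem_span_range_iff_exists_fun k).1 hmem
  set a : ℕ → k := fun i ↦ if h : i < m then a' ⟨i, h⟩ else 0 with ha
  have hrel : ∑ i ∈ Finset.range m, a i • f^[i] v = f^[m] v := by
    rw [Finset.sum_range, ← ha']
    exact Finset.sum_congr rfl fun i _ ↦ by simp [ha]
  have hfm : f^[m] v ≠ 0 := fun h0 ↦ hv <| (hf.iterate m) (by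
    rw [h0, Function.iterate_fixed (map_zero f)])
  have hex : ∃ i < m, a i ≠ 0 := by
    by_contra! hcon
    apply hfm
    rw [← hrel]
    exact Finset.sum_eq_zero fun i hi ↦ by rw [hcon i (Finset.mem_range.1 hi), zero_smul]
  obtain ⟨y, hy0, hy⟩ := exists_fixedPoly_eval_eq (p := p) a m hex
  obtain ⟨i₀, hi₀, -⟩ := hex
  set b : ℕ → k := fun i ↦ (fixedPoly p a i).eval y with hb
  have hb0 : b 0 = 0 := by simp [hb, fixedPoly]
  have hbs : ∀ i, b (i + 1) = b i ^ p + a i * y ^ p := fun i ↦ by simp [hb, fixedPoly]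
  refine ⟨∑ i ∈ Finset.range m, b (i + 1) • f^[i] v, fun h0 ↦ ?_, ?_⟩
  -- The last coefficient is `b m = y ≠ 0`, and the vectors `f^i v` with `i < m` are independent.
  · rw [Finset.sum_range] at h0
    have := Fintype.linearIndependent_iff.1 hli (fun i ↦ b (i + 1)) h0 ⟨m - 1, by omega⟩
    rw [show m - 1 + 1 = m by omega] at this
    exact hy0 (hy.symm.trans this)
  · have h1 : f (∑ i ∈ Finset.range m, b (i + 1) • f^[i] v) =
        ∑ i ∈ Finset.range m, b (i + 1) ^ p • f^[i + 1] v := by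
      rw [map_sum]
      refine Finset.sum_congr rfl fun i _ ↦ ?_
      rw [map_smulₛₗ, frobenius_def, Function.iterate_succ_apply']
    have h2 := Finset.sum_range_succ (fun i ↦ b i ^ p • f^[i] v) m
    rw [Finset.sum_range_succ' (fun i ↦ b i ^ p • f^[i] v) m] at h2
    rw [hb0, zero_pow hp.out.ne_zero, zero_smul, add_zero] at h2
    rw [h1, h2]
    have hbm : b m = y := hy
    rw [hbm, ← hrel, Finset.smul_sum, ← Finset.sum_add_distrib]
    refine Finset.sum_congr rfl fun i _ ↦ ?_
    rw [hbs, add_smul, smul_smul, mul_comm (a i)]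

/-- On the line of a fixed vector, `f - 1` is the Artin–Schreier map `c ↦ c ^ p - c`, which is onto
over an algebraically closed field. -/
lemma exists_sub_eq_of_mem_span_fixed [IsAlgClosed k] (f : V →ₛₗ[_root_.frobenius k p] V) {y : V}
    (hy : y ∈ Submodule.span k {x | f x = x}) :
    ∃ x ∈ Submodule.span k {x | f x = x}, f x - x = y := by
  induction hy using Submodule.closure_induction with
  | zero => exact ⟨0, zero_mem _, by simp⟩
  | add u v _ _ hu hv =>
    obtain ⟨a, ha, rfl⟩ := hu
    obtain ⟨b, hb, rfl⟩ := hv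
    exact ⟨a + b, add_mem ha hb, by rw [map_add]; abel⟩
  | smul_mem r x hx =>
    have hp2 := hp.out.one_lt
    obtain ⟨c, hc⟩ := IsAlgClosed.exists_root
      (Polynomial.X ^ p - Polynomial.X - Polynomial.C r : Polynomial k) (by
        rw [show (Polynomial.X ^ p - Polynomial.X - Polynomial.C r : Polynomial k) =
          Polynomial.X ^ p - (Polynomial.X + Polynomial.C r) by ring,
          Polynomial.degree_sub_eq_left_of_degree_lt, Polynomial.degree_X_pow]
        · exact_mod_cast hp.out.ne_zero
        · rw [Polynomial.degree_X_pow, Polynomial.degree_X_add_C]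
          exact_mod_cast hp2)
    refine ⟨c • x, Submodule.smul_mem _ _ (Submodule.subset_span hx), ?_⟩
    have hx' : f x = x := hx
    rw [map_smulₛₗ, hx', frobenius_def, ← sub_smul]
    congr 1
    have : c ^ p - c - r = 0 := by simpa using hc
    exact sub_eq_zero.1 this

lemma exists_eq_of_mem_span_fixed [IsAlgClosed k] (f : V →ₛₗ[_root_.frobenius k p] V) {y : V}
    (hy : y ∈ Submodule.span k {x | f x = x}) :
    ∃ x ∈ Submodule.span k {x | f x = x}, f x = y := by
  induction hy using Submodule.closure_induction with
  | zero => exact ⟨0, zero_mem _, by simp⟩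
  | add u v _ _ hu hv =>
    obtain ⟨a, ha, rfl⟩ := hu
    obtain ⟨b, hb, rfl⟩ := hv
    exact ⟨a + b, add_mem ha hb, map_add _ _ _⟩
  | smul_mem r x hx =>
    obtain ⟨c, hc⟩ := IsAlgClosed.exists_pow_nat_eq r hp.out.pos
    refine ⟨c • x, Submodule.smul_mem _ _ (Submodule.subset_span hx), ?_⟩
    have hx' : f x = x := hx
    rw [map_smulₛₗ, hx', frobenius_def, hc]

/-- An injective Frobenius-linear endomorphism of a finite dimensional vector space over an
algebraically closed field has a basis of fixed vectors. -/
theorem span_fixed_eq_top [IsAlgClosed k] [FiniteDimensional k V]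
    (f : V →ₛₗ[_root_.frobenius k p] V) (hf : Function.Injective f) :
    Submodule.span k {x | f x = x} = ⊤ := by
  by_contra hne
  set V' := Submodule.span k {x | f x = x} with hV'
  have hle : V' ≤ V'.comap f := by
    rw [hV', Submodule.span_le]
    intro x hx
    have hx' : f x = x := hx
    change f x ∈ Submodule.span k {x | f x = x}
    rw [hx']
    exact Submodule.subset_span hx
  have : Nontrivial (V ⧸ V') := Submodule.Quotient.nontrivial_iff.2 hne
  -- Since `f` maps `V'` onto itself, it stays injective on the quotient. A nonzero fixed vector
  -- there lifts to a fixed vector of `V` after an Artin–Schreier correction inside `V'`, so it was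
  -- zero.
  obtain ⟨w, hw0, hw⟩ := exists_fixed_ne_zero (V'.mapQ V' f hle) (by
    rw [injective_iff_map_eq_zero]
    intro x hx
    obtain ⟨x, rfl⟩ := Submodule.Quotient.mk_surjective _ x
    rw [Submodule.mapQ_apply, Submodule.Quotient.mk_eq_zero] at hx
    obtain ⟨x', hx', hxx'⟩ := exists_eq_of_mem_span_fixed f hx
    rw [Submodule.Quotient.mk_eq_zero, ← hf hxx']
    exact hx')
  obtain ⟨w, rfl⟩ := Submodule.Quotient.mk_surjective _ w
  rw [Submodule.mapQ_apply, Submodule.Quotient.eq] at hw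
  obtain ⟨x, hx, hxw⟩ := exists_sub_eq_of_mem_span_fixed f hw
  apply hw0
  rw [Submodule.Quotient.mk_eq_zero]
  have : w - x ∈ V' := Submodule.subset_span (s := {x | f x = x}) (by
    change f (w - x) = w - x
    rw [map_sub, sub_eq_sub_iff_sub_eq_sub, hxw])
  simpa using add_mem this hx

end Lang

/-! ### Lifting fixed vectors from the residue field to Witt vectors -/

section Lift

variable {p : ℕ} [hp : Fact p.Prime] {k : Type*} [Field k] [CharP k p] {n : ℕ}

local notation "𝕎" => WittVector p k

/-- Reduction modulo `p` of vectors of Witt vectors. -/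
def reduce (x : Fin n → 𝕎) : Fin n → k := fun i ↦ WittVector.constantCoeff (x i)

variable (p) in
omit [CharP k p] in
lemma reduce_surjective : Function.Surjective (reduce (p := p) (k := k) (n := n)) := fun v ↦
  ⟨fun i ↦ WittVector.teichmuller p (v i), by
    ext i; simp [reduce, WittVector.constantCoeff_apply]⟩

lemma reduce_eq_zero_iff [PerfectRing k p] (x : Fin n → 𝕎) :
    reduce x = 0 ↔ ∃ y : Fin n → 𝕎, x = (p : 𝕎) • y := by
  constructor
  · intro h
    have : ∀ i, ∃ y : 𝕎, x i = p * y := fun i ↦ by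
      have hi : (x i).coeff 0 = 0 := congrFun h i
      exact Ideal.mem_span_singleton.1 (WittVector.mem_span_p_iff_coeff_zero_eq_zero _ |>.2 hi)
    choose y hy using this
    exact ⟨y, funext hy⟩
  · rintro ⟨y, rfl⟩
    ext i
    have : (p : k) = 0 := CharP.cast_eq_zero k p
    change constantCoeff ((p : 𝕎) * y i) = 0
    rw [map_mul, map_natCast, this, zero_mul]

/-- Frobenius-linear endomorphisms of a free module of Witt vectors which are bijective have
a basis of fixed vectors. -/
theorem exists_fixed_basis_pi [IsAlgClosed k] [PerfectRing k p]
    (f : (Fin n → 𝕎) →ₛₗ[(WittVector.frobenius : 𝕎 →+* 𝕎)] (Fin n → 𝕎))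
    (hf : Function.Bijective f) :
    Submodule.span 𝕎 {x | f x = x} = ⊤ := by
  have radd : ∀ x y : Fin n → 𝕎, reduce (x + y) = reduce x + reduce y := fun x y ↦
    funext fun i ↦ map_add constantCoeff (x i) (y i)
  have rsub : ∀ x y : Fin n → 𝕎, reduce (x - y) = reduce x - reduce y := fun x y ↦
    funext fun i ↦ map_sub constantCoeff (x i) (y i)
  have rsmul : ∀ (a : 𝕎) (x : Fin n → 𝕎), reduce (a • x) = constantCoeff a • reduce x :=
    fun a x ↦ funext fun i ↦ map_mul constantCoeff a (x i)
  have rsum : ∀ (g : Fin n → Fin n → 𝕎), reduce (∑ i, g i) = ∑ i, reduce (g i) := fun g ↦ by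
    ext i; simp [reduce, Finset.sum_apply]
  -- the reduction of `f`
  let g : (Fin n → k) →ₛₗ[_root_.frobenius k p] (Fin n → k) :=
    { toFun := fun v ↦ ∑ j, (v j) ^ p • reduce (f (Pi.single j 1))
      map_add' := fun v w ↦ by
        simp only [Pi.add_apply, add_pow_char, add_smul, Finset.sum_add_distrib]
      map_smul' := fun a v ↦ by
        simp only [Pi.smul_apply, smul_eq_mul, mul_pow, frobenius_def, Finset.smul_sum, smul_smul] }
  have hg : ∀ x, reduce (f x) = g (reduce x) := by
    intro x
    have hx : x = ∑ j, x j • (Pi.single j 1 : Fin n → 𝕎) := by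
      ext i
      simp [Finset.sum_apply, Pi.single_apply]
    conv_lhs => rw [hx]
    rw [map_sum, rsum]
    refine Finset.sum_congr rfl fun j _ ↦ ?_
    rw [map_smulₛₗ, rsmul]
    congr 1
    simp [WittVector.constantCoeff_apply, WittVector.coeff_frobenius_charP, reduce]
  have fp : ∀ x, f ((p : 𝕎) • x) = (p : 𝕎) • f x := fun x ↦ by
    rw [map_smulₛₗ, map_natCast]
  -- If `f x` is divisible by `p`, then `f x = p f z = f (p z)` by surjectivity of `f`, so `x = p
  -- z`.
  have hginj : Function.Injective g := by
    rw [injective_iff_map_eq_zero]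
    intro v hv
    obtain ⟨x, rfl⟩ := reduce_surjective p v
    rw [← hg, reduce_eq_zero_iff] at hv
    obtain ⟨y, hy⟩ := hv
    obtain ⟨z, rfl⟩ := hf.2 y
    rw [← fp] at hy
    rw [hf.1 hy, reduce_eq_zero_iff]
    exact ⟨z, rfl⟩
  have hspan := span_fixed_eq_top g hginj
  -- surjectivity of `f - 1`
  let D : (Fin n → 𝕎) →ₗ[ℤ] (Fin n → 𝕎) := (f.toAddMonoidHom - AddMonoidHom.id _).toIntLinearMap
  have hD : ∀ x, D x = f x - x := fun x ↦ rfl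
  -- `f - 1` is additive but not `𝕎`-linear, so successive approximation is run over `ℤ`. This
  -- identifies the `p`-adic filtration over `ℤ` with the coordinatewise one over `𝕎`, whose
  -- completeness is known.
  have hpow : ∀ (m : ℕ) (x : Fin n → 𝕎),
      x ∈ ((Ideal.span {(p : ℤ)}) ^ m • ⊤ : Submodule ℤ (Fin n → 𝕎)) ↔
        ∀ i, x i ∈ (Ideal.span {(p : 𝕎)} ^ m • ⊤ : Submodule 𝕎 𝕎) := by
    intro m x
    rw [Ideal.span_singleton_pow, Ideal.span_singleton_pow,
      Submodule.ideal_span_singleton_smul, Submodule.mem_smul_pointwise_iff_exists]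
    simp only [smul_eq_mul, Ideal.mul_top, Ideal.mem_span_singleton]
    constructor
    · rintro ⟨y, -, rfl⟩ i
      exact ⟨y i, by simp⟩
    · intro h
      choose y hy using h
      refine ⟨y, trivial, funext fun i ↦ ?_⟩
      rw [hy i]
      simp
  have : IsHausdorff (Ideal.span {(p : ℤ)}) (Fin n → 𝕎) := ⟨fun x hx ↦ by
    ext1 i
    refine IsHausdorff.haus (I := Ideal.span {(p : 𝕎)}) inferInstance _ fun m ↦ ?_
    have := hx m
    rw [SModEq.zero, hpow] at this
    rw [SModEq.zero]
    exact this i⟩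
  have : IsPrecomplete (Ideal.span {(p : ℤ)}) (Fin n → 𝕎) := ⟨fun x hx ↦ by
    have : ∀ i, ∃ L : 𝕎, ∀ m,
        x m i ≡ L [SMOD (Ideal.span {(p : 𝕎)} ^ m • ⊤ : Submodule 𝕎 𝕎)] := fun i ↦ by
      refine IsPrecomplete.prec (I := Ideal.span {(p : 𝕎)}) inferInstance fun {m m'} h ↦ ?_
      have := hx h
      rw [SModEq.sub_mem, hpow] at this
      rw [SModEq.sub_mem]
      exact this i
    choose L hL using this
    refine ⟨L, fun m ↦ ?_⟩
    rw [SModEq.sub_mem, hpow]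
    intro i
    have := hL i m
    rw [SModEq.sub_mem] at this
    exact this⟩
  have hDsurj : Function.Surjective D := by
    apply surjective_of_mkQ_comp_surjective (I := Ideal.span {(p : ℤ)})
    intro y
    obtain ⟨y, rfl⟩ := Submodule.Quotient.mk_surjective _ y
    obtain ⟨v, -, hv⟩ := exists_sub_eq_of_mem_span_fixed g
      (y := reduce y) (by rw [hspan]; trivial)
    obtain ⟨x, rfl⟩ := reduce_surjective p v
    refine ⟨x, ?_⟩
    rw [LinearMap.comp_apply, hD, Submodule.mkQ_apply, Submodule.Quotient.eq]
    rw [← hg, ← rsub, ← sub_eq_zero, ← rsub, reduce_eq_zero_iff] at hv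
    obtain ⟨z, hz⟩ := hv
    rw [hz, ← pow_one (Ideal.span {(p : ℤ)}), hpow]
    intro i
    rw [pow_one, smul_eq_mul, Ideal.mul_top, Ideal.mem_span_singleton]
    exact ⟨z i, rfl⟩
  -- lifting fixed vectors
  have hlift : ∀ v, g v = v → ∃ x, f x = x ∧ reduce x = v := by
    intro v hv
    obtain ⟨x, rfl⟩ := reduce_surjective p v
    rw [← hg, ← sub_eq_zero, ← rsub, reduce_eq_zero_iff] at hv
    obtain ⟨y, hy⟩ := hv
    -- With `f x - x = p y` and `f z - z = y`, the vector `x - p z` is fixed and has the same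
    -- reduction as `x`.
    obtain ⟨z, hz⟩ := hDsurj y
    refine ⟨x - (p : 𝕎) • z, ?_, ?_⟩
    · rw [map_sub, fp, sub_eq_sub_iff_sub_eq_sub, hy, ← hz, hD, smul_sub]
    · rw [rsub, (reduce_eq_zero_iff ((p : 𝕎) • z)).2 ⟨z, rfl⟩, sub_zero]
  -- Nakayama
  have hjac : Ideal.span {(p : 𝕎)} ≤ Ideal.jacobson ⊥ :=
    IsAdicComplete.le_jacobson_bot (Ideal.span {(p : 𝕎)})
  refine top_le_iff.1 (Submodule.le_of_le_smul_of_le_jacobson_bot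
    (I := Ideal.span {(p : 𝕎)}) (Module.Finite.fg_top) hjac ?_)
  intro x _
  have hx : ∃ y ∈ Submodule.span 𝕎 {x | f x = x}, reduce y = reduce x := by
    have : reduce x ∈ Submodule.span k {x | g x = x} := by rw [hspan]; trivial
    generalize reduce x = v at this
    induction this using Submodule.closure_induction with
    | zero => exact ⟨0, zero_mem _, by ext i; simp [reduce]⟩
    | add u v _ _ hu hv =>
      obtain ⟨a, ha, rfl⟩ := hu
      obtain ⟨b, hb, rfl⟩ := hv
      exact ⟨a + b, add_mem ha hb, radd _ _⟩
    | smul_mem r v hv =>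
      obtain ⟨y, hy, rfl⟩ := hlift v hv
      refine ⟨WittVector.teichmuller p r • y,
        Submodule.smul_mem _ _ (Submodule.subset_span hy), ?_⟩
      rw [rsmul]
      simp [WittVector.constantCoeff_apply]
  obtain ⟨y, hy, hyx⟩ := hx
  rw [eq_comm, ← sub_eq_zero, ← rsub, reduce_eq_zero_iff] at hyx
  obtain ⟨z, hz⟩ := hyx
  rw [sub_eq_iff_eq_add] at hz
  rw [hz, add_comm]
  exact Submodule.add_mem_sup hy (Submodule.smul_mem_smul (Ideal.mem_span_singleton_self _) trivial)

end Lift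

/-! ### Semilinear maps preserving a lattice -/

section Lattice

variable {p : ℕ} [hp : Fact p.Prime] {k : Type*} [Field k] [CharP k p] [IsAlgClosed k]
  [PerfectRing k p]

/-- A Frobenius-linear endomorphism of a vector space over `K(p, k)` that maps a lattice onto
itself bijectively has a basis of fixed vectors. -/
theorem span_fixed_eq_top_of_lattice {X : Type*} [AddCommGroup X] [Module K(p, k) X]
    [Module (WittVector p k) X] [IsScalarTower (WittVector p k) K(p, k) X]
    (f : X →ₛₗ[φ(p, k)] X) (hf : Function.Injective f)
    (M : Submodule (WittVector p k) X) (hM : M.FG)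
    (hspan : Submodule.span K(p, k) (M : Set X) = ⊤) (hfM : f '' (M : Set X) = M) :
    Submodule.span K(p, k) {x | f x = x} = ⊤ := by
  have hφ : ∀ y : WittVector p k, φ(p, k) (algebraMap (WittVector p k) K(p, k) y) =
      algebraMap (WittVector p k) K(p, k) (WittVector.frobenius y) := fun y ↦
    IsFractionRing.ringEquivOfRingEquiv_algebraMap (WittVector.frobeniusEquiv p k) y
  have hsm : ∀ (a : WittVector p k) (x : X), f (a • x) = WittVector.frobenius a • f x := by
    intro a x
    rw [← algebraMap_smul K(p, k) a x, map_smulₛₗ, hφ, algebraMap_smul]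
  have hmem : ∀ x ∈ M, f x ∈ M := fun x hx ↦ by
    have : f x ∈ f '' (M : Set X) := ⟨x, hx, rfl⟩
    rw [hfM] at this
    exact this
  let fM : M →ₛₗ[(WittVector.frobenius : WittVector p k →+* WittVector p k)] M :=
    { toFun := fun x ↦ ⟨f x, hmem x x.2⟩
      map_add' := fun x y ↦ Subtype.ext (map_add f _ _)
      map_smul' := fun a x ↦ Subtype.ext (hsm a x) }
  have : Module.Finite (WittVector p k) M := Module.Finite.iff_fg.2 hM
  have : Module.IsTorsionFree (WittVector p k) X := Module.IsTorsionFree.trans_faithfulSMul _ K(p, k) X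
  -- A finitely generated torsion-free module over the principal ideal domain `W(k)` is free, so `f`
  -- restricted to `M` is covered by the coordinate case.
  obtain ⟨n, b⟩ := Module.basisOfFiniteTypeTorsionFree' (R := WittVector p k) (M := M)
  let e := b.equivFun
  let g : (Fin n → WittVector p k) →ₛₗ[(WittVector.frobenius : WittVector p k →+* WittVector p k)]
      (Fin n → WittVector p k) :=
    { toFun := fun x ↦ e (fM (e.symm x))
      map_add' := fun x y ↦ by simp
      map_smul' := fun a x ↦ by simp }
  have hfMb : Function.Bijective fM := by
    constructor
    · intro x y hxy
      exact Subtype.ext (hf (congrArg Subtype.val hxy))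
    · rintro ⟨y, hy⟩
      have : y ∈ f '' (M : Set X) := by rw [hfM]; exact hy
      obtain ⟨x, hx, rfl⟩ := this
      exact ⟨⟨x, hx⟩, rfl⟩
  have hg := exists_fixed_basis_pi g (e.bijective.comp (hfMb.comp e.symm.bijective))
  rw [eq_top_iff, ← hspan, Submodule.span_le]
  intro x hx
  have key : e ⟨x, hx⟩ ∈ Submodule.span (WittVector p k) {x | g x = x} := by rw [hg]; trivial
  let incl : (Fin n → WittVector p k) →ₗ[WittVector p k] X := M.subtype ∘ₗ e.symm.toLinearMap
  have h1 : Submodule.span (WittVector p k) {x | g x = x} ≤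
      ((Submodule.span K(p, k) {x | f x = x}).restrictScalars (WittVector p k)).comap incl := by
    rw [Submodule.span_le]
    intro v hv
    refine Submodule.subset_span ?_
    have hv' : e (fM (e.symm v)) = v := hv
    have : fM (e.symm v) = e.symm v := e.injective (by rw [hv', e.apply_symm_apply])
    exact congrArg Subtype.val this
  have := h1 key
  simpa [incl] using this

end Lattice

end FrobeniusLinear

namespace PolarizedIsocrystal

/-! ### Endomorphisms of isocrystals -/

/-! ### The fixed field of Frobenius on `Frac W(k)` -/

section FixedField

variable (p : ℕ) [Fact p.Prime] (k : Type) [Field k] [CharP k p] [PerfectRing k p]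

lemma frobenius_algebraMap_witt (y : WittVector p k) :
    φ(p, k) (algebraMap (WittVector p k) K(p, k) y) =
      algebraMap (WittVector p k) K(p, k) (WittVector.frobenius y) :=
  IsFractionRing.ringEquivOfRingEquiv_algebraMap (WittVector.frobeniusEquiv p k) y

omit [PerfectRing k p] in
lemma natCast_ne_zero : (p : K(p, k)) ≠ 0 := by
  rw [← map_natCast (algebraMap (WittVector p k) K(p, k)),
    (IsFractionRing.injective (WittVector p k) K(p, k)).ne_iff' (map_zero _)]
  exact WittVector.p_nonzero p k

-- Frobenius raises Witt coordinates to the power `p`, so all coordinates of a fixed `w` satisfy `x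
-- ^ p = x` and lie in the prime field.
omit [PerfectRing k p] in
lemma mem_range_padicInt_of_frobenius_eq (w : WittVector p k) (hw : WittVector.frobenius w = w) :
    ∃ z : ℤ_[p], padicIntToK p k z = algebraMap (WittVector p k) K(p, k) w := by
  have hc : ∀ n, ∃ c : ZMod p, ZMod.castHom (dvd_refl p) k c = w.coeff n := by
    intro n
    have h : w.coeff n ^ p = w.coeff n := by
      rw [← WittVector.coeff_frobenius_charP, hw]
    have h' : w.coeff n ∈ (⊥ : Subfield k) := (Subfield.mem_bot_iff_pow_eq_self k p).2 h
    rw [← ZMod.fieldRange_castHom_eq_bot p] at h'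
    exact h'
  choose c hc using hc
  refine ⟨WittVector.equiv p (WittVector.mk p c), ?_⟩
  simp only [padicIntToK, RingHom.comp_apply]
  congr 1
  ext n
  rw [WittVector.map_coeff]
  simp [hc]

/-- The elements of `K(p, k)` fixed by Frobenius are in `ℚ_p`. -/
theorem exists_algebraMap_eq_of_frobenius_eq (x : K(p, k)) (hx : φ(p, k) x = x) :
    ∃ y : ℚ_[p], algebraMap ℚ_[p] K(p, k) y = x := by
  obtain ⟨a, b, hb, rfl⟩ := IsFractionRing.div_surjective (A := WittVector p k) x
  obtain ⟨m, u, rfl⟩ := WittVector.exists_eq_pow_p_mul' b (nonZeroDivisors.ne_zero hb)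
  have hp := natCast_ne_zero p k
  have hpw : algebraMap (WittVector p k) K(p, k) ((p : WittVector p k) ^ m) = (p : K(p, k)) ^ m := by
    simp
  -- The denominator is a power of `p` times a unit. Absorbing the unit into the numerator leaves
  -- only a power of `p`, which Frobenius fixes, so the numerator must be fixed as well.
  set w : WittVector p k := a * (↑u⁻¹ : WittVector p k) with hw
  have hinj := IsFractionRing.injective (WittVector p k) K(p, k)
  have hx' : algebraMap (WittVector p k) K(p, k) a / algebraMap _ _ ((p : WittVector p k) ^ m * u) =
      ((p : K(p, k)) ^ m)⁻¹ * algebraMap _ _ w := by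
    have hu : algebraMap (WittVector p k) K(p, k) u ≠ 0 :=
      (hinj.ne_iff' (map_zero _)).2 u.ne_zero
    have hu' : algebraMap (WittVector p k) K(p, k) (u : WittVector p k) *
      algebraMap (WittVector p k) K(p, k) (↑u⁻¹ : WittVector p k) = 1 := by
      rw [← map_mul, Units.mul_inv, map_one]
    rw [map_mul, hpw, hw, map_mul, eq_comm, div_eq_mul_inv, mul_inv,
      inv_eq_of_mul_eq_one_right hu']
    ring
  rw [hx'] at hx ⊢
  rw [map_mul, map_inv₀, map_pow, map_natCast, frobenius_algebraMap_witt] at hx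
  obtain ⟨z, hz⟩ := mem_range_padicInt_of_frobenius_eq p k w
    (hinj (mul_left_cancel₀ (inv_ne_zero (pow_ne_zero m hp)) hx))
  refine ⟨((p : ℚ_[p]) ^ m)⁻¹ * algebraMap ℤ_[p] ℚ_[p] z, ?_⟩
  rw [map_mul, map_inv₀, map_pow, map_natCast, algebraMap_padicInt, hz]

end FixedField

section Endomorphisms

variable (p : ℕ) [Fact p.Prime] (k : Type) [Field k] [CharP k p] [PerfectRing k p]
variable (N : Type) [AddCommGroup N] [Isocrystal p k N]

variable {N} in
lemma Phi_smul (a : K(p, k)) (x : N) : Phi p k (a • x) = φ(p, k) a • Phi p k x :=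
  LinearMap.map_smulₛₗ _ a x

variable {N} in
lemma Phi_add (x y : N) : Phi p k (x + y) = Phi p k x + Phi p k y := map_add _ x y

lemma Phi_bijective : Function.Bijective (Phi p k : N → N) :=
  (Isocrystal.frob (p := p) (k := k) (V := N)).bijective

variable {N} in
/-- The inverse of `Φ`. -/
def PhiInv (x : N) : N := (Isocrystal.frob (p := p) (k := k) (V := N)).invFun x

variable {N} in
@[simp] lemma Phi_PhiInv (x : N) : Phi p k (PhiInv p k x) = x :=
  (Isocrystal.frob (p := p) (k := k) (V := N)).right_inv x

variable {N} in
@[simp] lemma PhiInv_Phi (x : N) : PhiInv p k (Phi p k x) = x :=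
  (Isocrystal.frob (p := p) (k := k) (V := N)).left_inv x

/-- The Frobenius `a ↦ Φ a Φ⁻¹` of the isocrystal `End(N)`. -/
def frobConj : Module.End K(p, k) N →ₛₗ[φ(p, k)] Module.End K(p, k) N where
  toFun a :=
    { toFun := fun n ↦ Phi p k (a (PhiInv p k n))
      map_add' := fun x y ↦ by
        have : PhiInv p k (x + y) = PhiInv p k x + PhiInv p k y := by
          apply (Phi_bijective p k N).1
          simp [Phi_add]
        rw [this, map_add, Phi_add]
      map_smul' := fun c x ↦ by
        have hc : φ(p, k) ((FractionRing.frobenius p k).symm c) = c :=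
          (FractionRing.frobenius p k).apply_symm_apply c
        have : PhiInv p k (c • x) = (FractionRing.frobenius p k).symm c • PhiInv p k x := by
          apply (Phi_bijective p k N).1
          rw [Phi_smul, hc, Phi_PhiInv, Phi_PhiInv]
        rw [this, map_smul, Phi_smul, RingHom.id_apply, hc] }
  map_add' a b := by ext n; simp [Phi_add]
  map_smul' c a := by ext n; simp [Phi_smul]

@[simp] lemma frobConj_apply (a : Module.End K(p, k) N) (n : N) :
    frobConj p k N a n = Phi p k (a (PhiInv p k n)) := rfl

lemma frobConj_injective : Function.Injective (frobConj p k N) := by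
  intro a b h
  ext n
  have := LinearMap.congr_fun h (Phi p k n)
  simpa using (Phi_bijective p k N).1 this

lemma frobConj_surjective : Function.Surjective (frobConj p k N) := by
  intro a
  refine ⟨
    { toFun := fun n ↦ PhiInv p k (a (Phi p k n))
      map_add' := fun x y ↦ by
        apply (Phi_bijective p k N).1
        simp [Phi_add]
      map_smul' := fun c x ↦ by
        apply (Phi_bijective p k N).1
        simp [Phi_smul] }, ?_⟩
  ext n
  simp

lemma frobConj_eq_self_iff (a : Module.End K(p, k) N) :
    frobConj p k N a = a ↔ ∀ n, Phi p k (a n) = a (Phi p k n) := by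
  constructor
  · intro h n
    have := LinearMap.congr_fun h (Phi p k n)
    simpa using this
  · intro h
    ext n
    rw [frobConj_apply, h, Phi_PhiInv]

variable [Module ℚ_[p] N] [IsScalarTower ℚ_[p] K(p, k) N]

/-- The `ℚ_p`-algebra of endomorphisms of the isocrystal `N`. -/
def isocrystalEnd : Subalgebra ℚ_[p] (Module.End K(p, k) N) where
  carrier := {a | ∀ n, Phi p k (a n) = a (Phi p k n)}
  mul_mem' {a b} ha hb n := by simp only [Module.End.mul_apply]; rw [ha, hb]
  add_mem' {a b} ha hb n := by simp only [LinearMap.add_apply, Phi_add]; rw [ha, hb]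
  algebraMap_mem' r n := by
    rw [Module.algebraMap_end_apply, Module.algebraMap_end_apply, ← algebraMap_smul K(p, k) r n,
      Phi_smul, frobenius_algebraMap, algebraMap_smul]

lemma mem_isocrystalEnd {a : Module.End K(p, k) N} :
    a ∈ isocrystalEnd p k N ↔ ∀ n, Phi p k (a n) = a (Phi p k n) := Iff.rfl

/-- Endomorphisms of an isocrystal which are independent over `ℚ_p` are independent
over `K(p, k)`. -/
theorem linearIndependent_isocrystalEnd {ι : Type*} (v : ι → isocrystalEnd p k N)
    (hv : LinearIndependent ℚ_[p] v) :
    LinearIndependent K(p, k) (fun i ↦ (v i : Module.End K(p, k) N)) := by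
  classical
  rw [linearIndependent_iff']
  intro s
  induction s using Finset.induction_on with
  | empty => simp
  | insert j s hj ih =>
    intro g hg
    by_cases hgj : g j = 0
    · rw [Finset.sum_insert hj, hgj, zero_smul, zero_add] at hg
      intro i hi
      rcases Finset.mem_insert.1 hi with rfl | hi
      · exact hgj
      · exact ih g hg i hi
    · exfalso
      -- Normalize one coefficient to `1`, apply the Frobenius of `End(N)` and subtract. The
      -- `j`-term cancels, so by induction all coefficients are Frobenius-invariant, hence in `ℚ_p`,
      -- and the relation already holds over `ℚ_p`.
      set g' : ι → K(p, k) := fun i ↦ (g j)⁻¹ * g i with hg'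
      have hgj' : g' j = 1 := inv_mul_cancel₀ hgj
      have hsum : ∑ i ∈ insert j s, g' i • (v i : Module.End K(p, k) N) = 0 := by
        simp only [hg', mul_smul]
        rw [← Finset.smul_sum, hg, smul_zero]
      have hsum2 : ∑ i ∈ insert j s, φ(p, k) (g' i) • (v i : Module.End K(p, k) N) = 0 := by
        have := congrArg (frobConj p k N) hsum
        rw [map_sum, map_zero] at this
        rw [← this]
        refine Finset.sum_congr rfl fun i _ ↦ ?_
        rw [map_smulₛₗ, (frobConj_eq_self_iff p k N _).2 (v i).2]
      have hdiff : ∑ i ∈ s, (φ(p, k) (g' i) - g' i) • (v i : Module.End K(p, k) N) = 0 := by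
        have h3 := sub_eq_zero.2 (hsum2.trans hsum.symm)
        rw [← Finset.sum_sub_distrib, Finset.sum_insert hj, hgj', map_one, sub_self, zero_add] at h3
        rw [← h3]
        exact Finset.sum_congr rfl fun i _ ↦ sub_smul _ _ _
      have hfix : ∀ i ∈ insert j s, φ(p, k) (g' i) = g' i := by
        intro i hi
        rcases Finset.mem_insert.1 hi with rfl | hi
        · rw [hgj', map_one]
        · exact sub_eq_zero.1 (ih _ hdiff i hi)
      choose! y hy using fun i hi ↦ exists_algebraMap_eq_of_frobenius_eq p k _ (hfix i hi)
      have hrel : ∑ i ∈ insert j s, y i • v i = 0 := by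
        apply Subtype.ext
        rw [AddSubmonoidClass.coe_finsetSum, ZeroMemClass.coe_zero, ← hsum]
        refine Finset.sum_congr rfl fun i hi ↦ ?_
        ext n
        rw [← hy i hi]
        simp
      have hyj := linearIndependent_iff'.1 hv _ y hrel j (Finset.mem_insert_self j s)
      have := hy j (Finset.mem_insert_self j s)
      rw [hyj, map_zero, hgj'] at this
      exact zero_ne_one this

end Endomorphisms

/-! ### The isocrystal `End(N)` is spanned by its fixed vectors -/

section Density

variable (p : ℕ) [Fact p.Prime] (k : Type) [Field k] [CharP k p] [PerfectRing k p]
variable (N : Type) [AddCommGroup N] [Isocrystal p k N]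

section Lattice

variable [Module (WittVector p k) N] [IsScalarTower (WittVector p k) K(p, k) N]

variable {p k N} in
/-- The endomorphisms that preserve a lattice. -/
def endLattice (M : Submodule (WittVector p k) N) :
    Submodule (WittVector p k) (Module.End K(p, k) N) where
  carrier := {a | ∀ m ∈ M, a m ∈ M}
  zero_mem' _ _ := M.zero_mem
  add_mem' ha hb m hm := M.add_mem (ha m hm) (hb m hm)
  smul_mem' c _ ha m hm := M.smul_mem c (ha m hm)

/-- Restriction to `M` embeds this module into `End_W(M)`, which is noetherian; injectivity holds
because `M` spans `N`. -/
lemma endLattice_fg (M : Submodule (WittVector p k) N) (hM : M.FG)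
    (hspan : Submodule.span K(p, k) (M : Set N) = ⊤) : (endLattice M).FG := by
  have : Module.Finite (WittVector p k) M := Module.Finite.iff_fg.2 hM
  have : Module.IsTorsionFree (WittVector p k) N :=
    Module.IsTorsionFree.trans_faithfulSMul _ K(p, k) N
  have : Module.Free (WittVector p k) M := Module.free_of_finite_type_torsion_free'
  let r : endLattice M →ₗ[WittVector p k] (M →ₗ[WittVector p k] M) :=
    { toFun := fun a ↦ (a.1.restrictScalars (WittVector p k)).restrict a.2
      map_add' := fun a b ↦ rfl
      map_smul' := fun c a ↦ rfl }
  have hr : Function.Injective r := by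
    intro a b hab
    apply Subtype.ext
    apply LinearMap.ext_on hspan
    intro m hm
    exact congrArg Subtype.val (LinearMap.congr_fun hab ⟨m, hm⟩)
  have : IsNoetherian (WittVector p k) (M →ₗ[WittVector p k] M) := isNoetherian_of_isNoetherianRing_of_finite _ _
  exact Module.Finite.iff_fg.1 (Module.Finite.of_injective r hr)

variable {p k N} in
lemma exists_smul_mem (M : Submodule (WittVector p k) N)
    (hspan : Submodule.span K(p, k) (M : Set N) = ⊤) (n : N) :
    ∃ s : WittVector p k, s ≠ 0 ∧ s • n ∈ M := by
  have hn : n ∈ Submodule.span K(p, k) (M : Set N) := by rw [hspan]; trivial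
  induction hn using Submodule.closure_induction with
  | zero => exact ⟨1, one_ne_zero, by simp⟩
  | add u v _ _ hu hv =>
    obtain ⟨s, hs, hsu⟩ := hu
    obtain ⟨t, ht, htv⟩ := hv
    refine ⟨s * t, mul_ne_zero hs ht, ?_⟩
    rw [smul_add]
    refine M.add_mem ?_ ?_
    · rw [mul_comm, mul_smul]; exact M.smul_mem _ hsu
    · rw [mul_smul]; exact M.smul_mem _ htv
  | smul_mem r x hx =>
    obtain ⟨a, b, hb, rfl⟩ := IsFractionRing.div_surjective (A := WittVector p k) r
    have hb0 := nonZeroDivisors.ne_zero hb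
    refine ⟨b, hb0, ?_⟩
    have hb' : algebraMap (WittVector p k) K(p, k) b ≠ 0 :=
      ((IsFractionRing.injective (WittVector p k) K(p, k)).ne_iff' (map_zero _)).2 hb0
    rw [← algebraMap_smul K(p, k) b, smul_smul, mul_div_cancel₀ _ hb', algebraMap_smul]
    exact M.smul_mem _ hx

/-- The image of `M` under `a` is finitely generated, so a single nonzero Witt vector clears all its
denominators with respect to `M`. -/
lemma span_endLattice (M : Submodule (WittVector p k) N) (hM : M.FG)
    (hspan : Submodule.span K(p, k) (M : Set N) = ⊤) :
    Submodule.span K(p, k) (endLattice M : Set (Module.End K(p, k) N)) = ⊤ := by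
  rw [eq_top_iff]
  intro a _
  have key : ∀ P : Submodule (WittVector p k) N, P.FG →
      ∃ s : WittVector p k, s ≠ 0 ∧ ∀ n ∈ P, s • n ∈ M := by
    intro P hP
    induction P, hP using Submodule.fg_induction with
    | singleton x =>
      obtain ⟨s, hs, hsx⟩ := exists_smul_mem M hspan x
      refine ⟨s, hs, fun n hn ↦ ?_⟩
      obtain ⟨c, rfl⟩ := Submodule.mem_span_singleton.1 hn
      rw [smul_comm]
      exact M.smul_mem _ hsx
    | sup P Q _ _ hP hQ =>
      obtain ⟨s, hs, hsP⟩ := hP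
      obtain ⟨t, ht, htQ⟩ := hQ
      refine ⟨s * t, mul_ne_zero hs ht, fun n hn ↦ ?_⟩
      obtain ⟨x, hx, y, hy, rfl⟩ := Submodule.mem_sup.1 hn
      rw [smul_add]
      refine M.add_mem ?_ ?_
      · rw [mul_comm, mul_smul]; exact M.smul_mem _ (hsP x hx)
      · rw [mul_smul]; exact M.smul_mem _ (htQ y hy)
  obtain ⟨s, hs, hsM⟩ := key (M.map (a.restrictScalars (WittVector p k))) (hM.map _)
  have hs' : algebraMap (WittVector p k) K(p, k) s ≠ 0 :=
      ((IsFractionRing.injective (WittVector p k) K(p, k)).ne_iff' (map_zero _)).2 hs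
  have hmem : s • a ∈ endLattice M := fun m hm ↦ hsM _ ⟨m, hm, rfl⟩
  have : a = (algebraMap (WittVector p k) K(p, k) s)⁻¹ • (s • a) := by
    rw [← algebraMap_smul K(p, k) s a, smul_smul, inv_mul_cancel₀ hs', one_smul]
  rw [this]
  exact Submodule.smul_mem _ _ (Submodule.subset_span hmem)

variable [IsAlgClosed k]

/-- From `Φ² M = p M` it follows that conjugation by `Φ²` maps `Λ = End(M)` onto itself, the factor
`p` cancelling. Conjugation by `Φ` then exchanges `Λ` and its image, so it preserves their sum, a
lattice to which the slope 0 case applies. -/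
theorem span_frobConj_fixed_of_lattice (M : Submodule (WittVector p k) N) (hM : M.FG)
    (hspan : Submodule.span K(p, k) (M : Set N) = ⊤)
    (hΦ : (Phi p k : N → N)^[2] '' (M : Set N) = (fun x : N ↦ (p : K(p, k)) ^ 1 • x) '' (M : Set N)) :
    Submodule.span K(p, k) {a | frobConj p k N a = a} = ⊤ := by
  have hp := natCast_ne_zero p k
  have hφp : φ(p, k) (p : K(p, k)) = p := map_natCast _ _
  have h1 : ∀ m ∈ M, ∃ m' ∈ M, Phi p k (Phi p k m) = (p : K(p, k)) • m' := by
    intro m hm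
    have : (Phi p k : N → N)^[2] m ∈ (fun x : N ↦ (p : K(p, k)) ^ 1 • x) '' (M : Set N) := by
      rw [← hΦ]; exact ⟨m, hm, rfl⟩
    obtain ⟨m', hm', h⟩ := this
    exact ⟨m', hm', by simpa using h.symm⟩
  have h2 : ∀ m' ∈ M, ∃ m ∈ M, Phi p k (Phi p k m) = (p : K(p, k)) • m' := by
    intro m' hm'
    have : (p : K(p, k)) ^ 1 • m' ∈ (Phi p k : N → N)^[2] '' (M : Set N) := by
      rw [hΦ]; exact ⟨m', hm', rfl⟩
    obtain ⟨m, hm, h⟩ := this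
    exact ⟨m, hm, by simpa using h⟩
  have hΦp : ∀ x : N, Phi p k (Phi p k ((p : K(p, k)) • x)) =
      (p : K(p, k)) • Phi p k (Phi p k x) := fun x ↦ by simp only [Phi_smul, hφp]
  have hpinj : ∀ x y : N, (p : K(p, k)) • x = (p : K(p, k)) • y → x = y := fun x y h ↦
    (smul_right_injective N hp) h
  have hinj := (Phi_bijective p k N).1
  -- `𝓕²` maps the lattice onto itself
  have hF1 : ∀ a ∈ endLattice M, frobConj p k N (frobConj p k N a) ∈ endLattice M := by
    intro a ha m hm
    obtain ⟨m1, hm1, e1⟩ := h2 m hm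
    obtain ⟨m2, hm2, e2⟩ := h1 _ (ha m1 hm1)
    have : frobConj p k N (frobConj p k N a) m = m2 := by
      apply hpinj
      rw [← map_smul, ← e1, ← e2]
      simp
    rw [this]
    exact hm2
  have hF2 : ∀ a ∈ endLattice M, ∃ b ∈ endLattice M, frobConj p k N (frobConj p k N b) = a := by
    intro a ha
    obtain ⟨c, rfl⟩ := frobConj_surjective p k N a
    obtain ⟨b, rfl⟩ := frobConj_surjective p k N c
    refine ⟨b, fun m hm ↦ ?_, rfl⟩
    obtain ⟨m1, hm1, e1⟩ := h1 m hm
    obtain ⟨m2, hm2, e2⟩ := h2 _ (ha m1 hm1)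
    have : b m = m2 := by
      apply hinj
      apply hinj
      rw [e2, ← map_smul, ← e1]
      simp
    rw [this]
    exact hm2
  let g : Module.End K(p, k) N →ₛₗ[(WittVector.frobenius : WittVector p k →+* WittVector p k)]
      Module.End K(p, k) N :=
    { toFun := frobConj p k N
      map_add' := map_add _
      map_smul' := fun c a ↦ by
        rw [← algebraMap_smul K(p, k) c a, map_smulₛₗ, frobenius_algebraMap_witt, algebraMap_smul] }
  have : RingHomSurjective (WittVector.frobenius : WittVector p k →+* WittVector p k) :=
    ⟨(WittVector.frobenius_bijective p k).2⟩
  have hfg := endLattice_fg p k N M hM hspan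
  have hgmap : ∀ a, a ∈ (endLattice M).map g ↔ ∃ b ∈ endLattice M, frobConj p k N b = a :=
    fun a ↦ Iff.rfl
  refine FrobeniusLinear.span_fixed_eq_top_of_lattice (frobConj p k N) (frobConj_injective p k N)
    (endLattice M ⊔ (endLattice M).map g) (hfg.sup (hfg.map g)) ?_ ?_
  · rw [eq_top_iff, ← span_endLattice p k N M hM hspan]
    exact Submodule.span_mono fun a ha ↦ Submodule.mem_sup_left ha
  · ext a
    constructor
    · rintro ⟨b, hb, rfl⟩
      obtain ⟨x, hx, y, hy, rfl⟩ := Submodule.mem_sup.1 hb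
      obtain ⟨z, hz, rfl⟩ := (hgmap _).1 hy
      rw [map_add]
      exact add_mem (Submodule.mem_sup_right ⟨x, hx, rfl⟩) (Submodule.mem_sup_left (hF1 z hz))
    · intro ha
      obtain ⟨x, hx, y, hy, rfl⟩ := Submodule.mem_sup.1 ha
      obtain ⟨z, hz, rfl⟩ := (hgmap _).1 hy
      obtain ⟨b, hb, rfl⟩ := hF2 x hx
      refine ⟨frobConj p k N b + z, add_mem (Submodule.mem_sup_right ⟨b, hb, rfl⟩)
        (Submodule.mem_sup_left hz), map_add _ _ _⟩

end Lattice

variable [Module ℚ_[p] N] [IsScalarTower ℚ_[p] K(p, k) N]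

/-- The endomorphisms of an isoclinic isocrystal of slope `1 / 2` over an algebraically closed
field span all linear endomorphisms. -/
theorem span_isocrystalEnd [IsAlgClosed k] (h : IsIsoclinic p k N 1 2) :
    Submodule.span K(p, k) (isocrystalEnd p k N : Set (Module.End K(p, k) N)) = ⊤ := by
  let _ : Module (WittVector p k) N :=
    Module.compHom N (algebraMap (WittVector p k) K(p, k))
  have : IsScalarTower (WittVector p k) K(p, k) N := ⟨fun a b n ↦ by
    rw [Algebra.smul_def, mul_smul]; rfl⟩
  obtain ⟨M, hM, hspan, hΦ⟩ := h
  rw [← span_frobConj_fixed_of_lattice p k N M hM hspan hΦ]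
  congr 1
  ext a
  exact (frobConj_eq_self_iff p k N a).symm

/-- The endomorphism algebra of an isoclinic isocrystal of slope `1 / 2` over an algebraically
closed field is a form of the matrix algebra. -/
theorem isBaseChange_isocrystalEnd [IsAlgClosed k] (h : IsIsoclinic p k N 1 2) :
    IsBaseChange K(p, k) (isocrystalEnd p k N).val.toLinearMap := by
  let b := Basis.ofVectorSpace ℚ_[p] (isocrystalEnd p k N)
  let b' : Basis _ K(p, k) (Module.End K(p, k) N) :=
    Basis.mk (linearIndependent_isocrystalEnd p k N b b.linearIndependent) (by
      rw [← span_isocrystalEnd p k N h, Submodule.span_le]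
      intro a ha
      have := b.mem_span ⟨a, ha⟩
      have h1 : Submodule.span ℚ_[p] (Set.range b) ≤
          ((Submodule.span K(p, k) (Set.range fun i ↦ (b i : Module.End K(p, k) N))).restrictScalars
            ℚ_[p]).comap (isocrystalEnd p k N).val.toLinearMap := by
        rw [Submodule.span_le]
        rintro _ ⟨i, rfl⟩
        exact Submodule.subset_span ⟨i, rfl⟩
      exact h1 this)
  have h1 := IsBaseChange.of_basis (A := ℚ_[p]) b'
  have h2 := IsBaseChange.comp_equiv b.repr _ h1
  have : (Finsupp.linearCombination ℚ_[p] b') ∘ₗ b.repr.toLinearMap =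
      (isocrystalEnd p k N).val.toLinearMap := by
    apply b.ext
    intro i
    simp [b']
  rwa [this] at h2

end Density

end PolarizedIsocrystal

namespace PolarizedIsocrystal

/-! ### Points of `𝐉` from the endomorphism algebra -/

section Rho

variable (p : ℕ) [Fact p.Prime] (k : Type) [Field k] [CharP k p] [PerfectRing k p]
variable (N : Type) [AddCommGroup N] [Isocrystal p k N]
variable [Module ℚ_[p] N] [IsScalarTower ℚ_[p] K(p, k) N]
variable (R : Type) [CommRing R] [Algebra ℚ_[p] R]

/-- The endomorphisms of `N` as `ℚ_p`-linear maps. -/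
def endToLin : isocrystalEnd p k N →ₐ[ℚ_[p]] Module.End ℚ_[p] N where
  toFun a := a.1.restrictScalars ℚ_[p]
  map_one' := rfl
  map_mul' _ _ := rfl
  map_zero' := rfl
  map_add' _ _ := rfl
  commutes' r := by ext n; simp

@[simp] lemma endToLin_apply (a : isocrystalEnd p k N) (n : N) : endToLin p k N a n = a.1 n := rfl

/-- The action of `R ⊗ End(N, Φ)` on `R ⊗ N`. -/
def rho : R ⊗[ℚ_[p]] isocrystalEnd p k N →ₐ[R] Module.End R (R ⊗[ℚ_[p]] N) :=
  Algebra.TensorProduct.lift (Algebra.ofId R _)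
    ((Module.End.baseChangeHom ℚ_[p] R N).comp (endToLin p k N))
    fun r _ ↦ Algebra.commute_algebraMap_left r _

variable {N R}

lemma rho_tmul_eq (r : R) (a : isocrystalEnd p k N) :
    rho p k N R (r ⊗ₜ a) = r • (endToLin p k N a).baseChange R := rfl

@[simp] lemma rho_tmul (r s : R) (a : isocrystalEnd p k N) (n : N) :
    rho p k N R (r ⊗ₜ a) (s ⊗ₜ n) = (r * s) ⊗ₜ a.1 n := by
  simp [rho_tmul_eq, TensorProduct.smul_tmul']

/-- After expanding `R` in a `ℚ_p`-basis, each coordinate is an endomorphism of `N`, which is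
determined by its values. Equations between points of `𝐉(R)` can thus be read in `R ⊗ D`. -/
lemma rho_injective : Function.Injective (rho p k N R) := by
  rw [injective_iff_map_eq_zero]
  intro x hx
  classical
  let b := Basis.ofVectorSpace ℚ_[p] R
  let e := TensorProduct.equivFinsuppOfBasisLeft (N := isocrystalEnd p k N) b
  let e' := TensorProduct.equivFinsuppOfBasisLeft (N := N) b
  have key : ∀ (y : R ⊗[ℚ_[p]] isocrystalEnd p k N) (n : N) (i),
      e' (rho p k N R y (1 ⊗ₜ n)) i = (e y i).1 n := by
    intro y n i
    induction y with
    | zero => simp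
    | add u v hu hv => simp only [map_add, LinearMap.add_apply, Finsupp.add_apply, hu, hv]; rfl
    | tmul r a => simp [e, e']
  apply e.injective
  ext i n
  rw [← key, hx]
  simp

lemma commute_rho (g : Module.End ℚ_[p] N) (hg : ∀ (a : isocrystalEnd p k N) n, a.1 (g n) = g (a.1 n))
    (y : R ⊗[ℚ_[p]] isocrystalEnd p k N) : Commute (rho p k N R y) (g.baseChange R) := by
  induction y with
  | zero => rw [map_zero]; exact Commute.zero_left _
  | add u v hu hv => rw [map_add]; exact hu.add_left hv
  | tmul r e =>
    apply end_ext
    intro n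
    simp [hg]

variable {S : Type} [CommRing S] [Algebra ℚ_[p] S]

lemma endBaseChange_rho (f : R →ₐ[ℚ_[p]] S) (x : R ⊗[ℚ_[p]] isocrystalEnd p k N) :
    endBaseChange f (rho p k N R x) =
      rho p k N S (Algebra.TensorProduct.map f (AlgHom.id ℚ_[p] _) x) := by
  apply end_ext
  intro n
  rw [endBaseChange_one_tmul]
  induction x with
  | zero => simp
  | add u v hu hv => simp only [map_add, LinearMap.add_apply, hu, hv]
  | tmul r a => simp

end Rho

section RhoK

variable (p : ℕ) [Fact p.Prime] (k : Type) [Field k] [CharP k p] [PerfectRing k p]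
variable (N : Type) [AddCommGroup N] [Isocrystal p k N]
variable [Module ℚ_[p] N] [IsScalarTower ℚ_[p] K(p, k) N]
variable (R : Type) [CommRing R] [Algebra ℚ_[p] R] [Algebra K(p, k) R]
  [IsScalarTower ℚ_[p] K(p, k) R]

/-- The action of `R ⊗ End(N, Φ)` on `R ⊗_{K(p, k)} N`, for a `K(p, k)`-algebra `R`. -/
def rhoK : R ⊗[ℚ_[p]] isocrystalEnd p k N →ₐ[R] Module.End R (R ⊗[K(p, k)] N) :=
  Algebra.TensorProduct.lift (Algebra.ofId R _)
    (((Module.End.baseChangeHom K(p, k) R N).restrictScalars ℚ_[p]).comp (isocrystalEnd p k N).val)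
    fun r _ ↦ Algebra.commute_algebraMap_left r _

variable {N R}

lemma rhoK_tmul_eq (r : R) (a : isocrystalEnd p k N) :
    rhoK p k N R (r ⊗ₜ a) = r • a.1.baseChange R := rfl

@[simp] lemma rhoK_tmul (r s : R) (a : isocrystalEnd p k N) (n : N) :
    rhoK p k N R (r ⊗ₜ a) (s ⊗ₜ n) = (r * s) ⊗ₜ a.1 n := by
  simp [rhoK_tmul_eq, TensorProduct.smul_tmul']

lemma rhoK_one_tmul (a : isocrystalEnd p k N) :
    rhoK p k N R (1 ⊗ₜ a) = a.1.baseChange R := by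
  rw [rhoK_tmul_eq, one_smul]

-- Two base changes are composed: `D` to `End_K(N)`, and `End_K(N)` to `End_R(R ⊗ N)`, the latter
-- because `N` is finite dimensional.
variable (N R) in
lemma rhoK_bijective [IsAlgClosed k] [FiniteDimensional K(p, k) N] (h : IsIsoclinic p k N 1 2) :
    Function.Bijective (rhoK p k N R) := by
  have h1 := isBaseChange_isocrystalEnd p k N h
  have : Module.FinitePresentation K(p, k) N := Module.finitePresentation_of_finite _ _
  have h2 := Module.FinitePresentation.isBaseChange_map K(p, k) N N R
  have h3 := h1.comp h2
  have h4 : ∀ x, rhoK p k N R x = h3.equiv x := by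
    intro x
    induction x with
    | zero => simp
    | add u v hu hv => rw [map_add, map_add, hu, hv]
    | tmul r a =>
      rw [IsBaseChange.equiv_tmul, rhoK_tmul_eq]
      rfl
  rw [show (rhoK p k N R : _ → _) = h3.equiv from funext h4]
  exact h3.equiv.bijective

end RhoK

/-! ### The adjoint involution and unitary points -/

section Star

variable {p : ℕ} [Fact p.Prime] {k : Type} [Field k] [CharP k p] [PerfectRing k p]
variable {N : Type} [AddCommGroup N] [Isocrystal p k N] [FiniteDimensional K(p, k) N]
variable [Module ℚ_[p] N] [IsScalarTower ℚ_[p] K(p, k) N]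
variable {ψ : LinearMap.BilinForm K(p, k) N} (hψ : IsPolarization p k ψ)

/-- The adjoint involution of the endomorphism algebra of a polarized isocrystal. -/
def starEnd : isocrystalEnd p k N →ₗ[ℚ_[p]] isocrystalEnd p k N :=
  have key : ∀ (a : Module.End K(p, k) N) (x y : N),
      ψ (ψ.leftAdjointOfNondegenerate hψ.nondegenerate a x) y = ψ x (a y) :=
    fun a x y ↦ LinearMap.BilinForm.isAdjointPairLeftAdjointOfNondegenerate ψ hψ.nondegenerate a x y
  have sep : ∀ x y : N, (∀ z, ψ x z = ψ y z) → x = y := fun x y h ↦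
    sub_eq_zero.1 (hψ.nondegenerate.1 _ fun z ↦ by rw [map_sub, LinearMap.sub_apply, h, sub_self])
  { toFun := fun a ↦ ⟨ψ.leftAdjointOfNondegenerate hψ.nondegenerate a.1, fun n ↦ by
      apply sep
      intro z
      -- Testing only against vectors `Φ z` is enough, and there the compatibility of `ψ` with `Φ`
      -- moves Frobenius to the outside of the pairing on both sides.
      obtain ⟨z, rfl⟩ := (Phi_bijective p k N).2 z
      rw [hψ.frobenius, key, key, ← (mem_isocrystalEnd p k N).1 a.2, hψ.frobenius]⟩
    map_add' := fun a b ↦ by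
      ext n
      apply sep
      intro z
      simp [key]
    map_smul' := fun c a ↦ by
      ext n
      apply sep
      intro z
      have h1 : ∀ (c : ℚ_[p]) (x : N), c • x = algebraMap ℚ_[p] K(p, k) c • x :=
        fun c x ↦ (algebraMap_smul _ _ _).symm
      change ψ (ψ.leftAdjointOfNondegenerate hψ.nondegenerate (c • a.1) n) z =
        ψ (c • ψ.leftAdjointOfNondegenerate hψ.nondegenerate a.1 n) z
      rw [key, LinearMap.smul_apply, h1, h1, map_smul, map_smul, LinearMap.smul_apply, key] }

lemma starEnd_left (a : isocrystalEnd p k N) (x y : N) :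
    ψ ((starEnd hψ a).1 x) y = ψ x (a.1 y) :=
  LinearMap.BilinForm.isAdjointPairLeftAdjointOfNondegenerate ψ hψ.nondegenerate a.1 x y

lemma starEnd_right (a : isocrystalEnd p k N) (x y : N) :
    ψ (a.1 x) y = ψ x ((starEnd hψ a).1 y) := by
  rw [← hψ.isAlt.neg_eq, ← starEnd_left, hψ.isAlt.neg_eq]

lemma starEnd_eq_iff (a b : isocrystalEnd p k N) :
    starEnd hψ a = b ↔ ∀ x y, ψ (a.1 x) y = ψ x (b.1 y) := by
  constructor
  · rintro rfl x y
    exact starEnd_right hψ a x y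
  · intro h
    ext y
    refine sub_eq_zero.1 (hψ.nondegenerate.2 _ fun x ↦ ?_)
    rw [map_sub, ← h, starEnd_right hψ, sub_self]

lemma starEnd_starEnd (a : isocrystalEnd p k N) : starEnd hψ (starEnd hψ a) = a := by
  rw [starEnd_eq_iff]
  exact fun x y ↦ starEnd_left hψ a x y

lemma starEnd_mul (a b : isocrystalEnd p k N) :
    starEnd hψ (a * b) = starEnd hψ b * starEnd hψ a := by
  rw [starEnd_eq_iff]
  intro x y
  change ψ (a.1 (b.1 x)) y = ψ x ((starEnd hψ b).1 ((starEnd hψ a).1 y))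
  rw [starEnd_right hψ a, starEnd_right hψ b]

lemma starEnd_one : starEnd hψ 1 = 1 := by
  rw [starEnd_eq_iff]
  exact fun x y ↦ rfl

lemma pairing_rho {R : Type} [CommRing R] [Algebra ℚ_[p] R] (x : R ⊗[ℚ_[p]] isocrystalEnd p k N)
    (a b : R ⊗[ℚ_[p]] N) :
    pairing p k ψ R (rho p k N R x a) b =
      pairing p k ψ R a (rho p k N R ((starEnd hψ).baseChange R x) b) := by
  induction x with
  | zero => simp
  | add u v hu hv => simp only [map_add, LinearMap.add_apply, hu, hv]
  | tmul r e =>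
    induction a with
    | zero => simp
    | add u v hu hv => simp only [map_add, LinearMap.add_apply, hu, hv]
    | tmul s m =>
      induction b with
      | zero => simp
      | add u v hu hv => simp only [map_add, hu, hv]
      | tmul t n =>
        rw [LinearMap.baseChange_tmul, rho_tmul, rho_tmul, pairing_tmul, pairing_tmul,
          starEnd_right hψ]
        congr 1
        ring

lemma baseChange_rhoK {R : Type} [CommRing R] [Algebra ℚ_[p] R] [Algebra K(p, k) R]
    [IsScalarTower ℚ_[p] K(p, k) R] (x : R ⊗[ℚ_[p]] isocrystalEnd p k N)
    (a b : R ⊗[K(p, k)] N) :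
    ψ.baseChange R (rhoK p k N R x a) b =
      ψ.baseChange R a (rhoK p k N R ((starEnd hψ).baseChange R x) b) := by
  induction x with
  | zero => simp
  | add u v hu hv => simp only [map_add, LinearMap.add_apply, hu, hv]
  | tmul r e =>
    induction a with
    | zero => simp
    | add u v hu hv => simp only [map_add, LinearMap.add_apply, hu, hv]
    | tmul s m =>
      induction b with
      | zero => simp
      | add u v hu hv => simp only [map_add, hu, hv]
      | tmul t n =>
        rw [LinearMap.baseChange_tmul, rhoK_tmul, rhoK_tmul, LinearMap.BilinForm.baseChange_tmul,
          LinearMap.BilinForm.baseChange_tmul, starEnd_right hψ]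
        congr 1
        ring

variable {R : Type} [CommRing R] [Algebra ℚ_[p] R]

/-- A unitary element of `R ⊗ End(N, Φ)` gives an element of `𝐉(R)`. -/
def unitaryPoint (y : R ⊗[ℚ_[p]] isocrystalEnd p k N)
    (h1 : y * (starEnd hψ).baseChange R y = 1) (h2 : (starEnd hψ).baseChange R y * y = 1) :
    groupJ p k ψ R :=
  ⟨⟨rho p k N R y, rho p k N R ((starEnd hψ).baseChange R y),
      by rw [← map_mul, h1, map_one], by rw [← map_mul, h2, map_one]⟩, by
    refine ⟨fun a ↦ ?_, ?_, 1, fun x z ↦ ?_⟩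
    · exact commute_rho p k _ (fun e n ↦ e.1.map_smul a n) y
    · exact commute_rho p k _ (fun e n ↦ ((mem_isocrystalEnd p k N).1 e.2 n).symm) y
    · change pairing p k ψ R (rho p k N R y x) (rho p k N R y z) = _
      rw [pairing_rho hψ, ← Module.End.mul_apply, ← map_mul, h2]
      simp⟩

end Star

/-! ### Rational points of `𝐉` as endomorphisms of the isocrystal -/

section ToEnd

variable {p : ℕ} [Fact p.Prime] {k : Type} [Field k] [CharP k p] [PerfectRing k p]
variable {N : Type} [AddCommGroup N] [Isocrystal p k N]
variable [Module ℚ_[p] N] [IsScalarTower ℚ_[p] K(p, k) N]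
variable {ψ : LinearMap.BilinForm K(p, k) N}

lemma one_tmul_toEnd (h : (J p k ψ).obj (CommAlgCat.of ℚ_[p] ℚ_[p])) (n : N) :
    (1 : ℚ_[p]) ⊗ₜ[ℚ_[p]] toEnd h n =
      (show groupJ p k ψ ℚ_[p] from h).1.1 ((1 : ℚ_[p]) ⊗ₜ[ℚ_[p]] n) :=
  (TensorProduct.lid ℚ_[p] N).injective (by simp [toEnd])

/-- The endomorphism of the isocrystal given by an element of `J`. -/
def toIsocrystalEnd (h : (J p k ψ).obj (CommAlgCat.of ℚ_[p] ℚ_[p])) : isocrystalEnd p k N :=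
  ⟨toEnd h, fun n ↦ by
    apply (TensorProduct.lid ℚ_[p] N).symm.injective
    rw [TensorProduct.lid_symm_apply, TensorProduct.lid_symm_apply, one_tmul_toEnd]
    have e := LinearMap.congr_fun (show groupJ p k ψ ℚ_[p] from h).2.comm_frob.eq
      ((1 : ℚ_[p]) ⊗ₜ[ℚ_[p]] n)
    rw [Module.End.mul_apply, Module.End.mul_apply, LinearMap.baseChange_tmul] at e
    change _ = (show groupJ p k ψ ℚ_[p] from h).1.1 (1 ⊗ₜ[ℚ_[p]] frobLin p k n)
    rw [e, ← one_tmul_toEnd]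
    rfl⟩

lemma val_eq_rho (h : (J p k ψ).obj (CommAlgCat.of ℚ_[p] ℚ_[p])) :
    ((show groupJ p k ψ ℚ_[p] from h).1 : Module.End ℚ_[p] (ℚ_[p] ⊗[ℚ_[p]] N)) =
      rho p k N ℚ_[p] (1 ⊗ₜ toIsocrystalEnd h) := by
  apply end_ext
  intro n
  rw [← one_tmul_toEnd, rho_tmul, one_mul]
  rfl

lemma map_val_eq_rho (h : (J p k ψ).obj (CommAlgCat.of ℚ_[p] ℚ_[p])) (R : CommAlgCat.{0} ℚ_[p])
    (f : CommAlgCat.of ℚ_[p] ℚ_[p] ⟶ R) :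
    ((show groupJ p k ψ R from (J p k ψ).map f h).1 : Module.End R (R ⊗[ℚ_[p]] N)) =
      rho p k N R (1 ⊗ₜ toIsocrystalEnd h) := by
  change endBaseChange f.hom (show groupJ p k ψ ℚ_[p] from h).1.1 = _
  rw [val_eq_rho, endBaseChange_rho]
  simp

/-- The endomorphism given by an element of `J` is a similitude. -/
lemma exists_similitude_factor (h : (J p k ψ).obj (CommAlgCat.of ℚ_[p] ℚ_[p])) :
    ∃ c : K(p, k), c ≠ 0 ∧ ∀ x y, ψ (toEnd h x) (toEnd h y) = c * ψ x y := by
  obtain ⟨c, hc⟩ := (show groupJ p k ψ ℚ_[p] from h).2.similitude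
  let e := Algebra.TensorProduct.lid ℚ_[p] K(p, k)
  refine ⟨e c, (c.isUnit.map e).ne_zero, fun x y ↦ ?_⟩
  have := congrArg e (hc (1 ⊗ₜ x) (1 ⊗ₜ y))
  rw [← one_tmul_toEnd, ← one_tmul_toEnd, pairing_tmul, pairing_tmul, map_mul] at this
  simpa [e] using this

end ToEnd

end PolarizedIsocrystal

namespace GroupFunctor

/-! ### Points of tori -/

section Tori

universe u

variable {F : Type} [Field F]

section Restrict

variable {K : Type} [Field K] [Algebra F K]

/-- Restriction of scalars of a `K`-algebra which is already an `F`-algebra compatibly. -/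
def restrictAlgIso (R : Type) [CommRing R] [Algebra F R] [Algebra K R] [IsScalarTower F K R] :
    (restrictAlg F K).obj (CommAlgCat.of K R) ≅ CommAlgCat.of F R :=
  @CommAlgCat.isoMk F _ R R _ _ (Algebra.compHom R (algebraMap F K)) _
    (@AlgEquiv.ofRingEquiv F R R _ _ _ (Algebra.compHom R (algebraMap F K)) _ (RingEquiv.refl R)
      fun a ↦ (IsScalarTower.algebraMap_apply F K R a).symm)

lemma restrictAlg_map_comp_iso {R S : Type} [CommRing R] [Algebra F R] [Algebra K R]
    [IsScalarTower F K R] [CommRing S] [Algebra F S] [Algebra K S] [IsScalarTower F K S]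
    (f : R →ₐ[K] S) :
    (restrictAlg F K).map (CommAlgCat.ofHom f) ≫ (restrictAlgIso S).hom =
      (restrictAlgIso R).hom ≫ CommAlgCat.ofHom (f.restrictScalars F) := rfl

end Restrict

variable {T : CommAlgCat.{0} F ⥤ GrpCat.{0}}

/-- Over an algebra containing the algebraic closure the torus is split, and tuples of units
commute. -/
lemma IsTorus.mul_comm (hT : IsTorus T) (R : Type) [CommRing R] [Algebra F R]
    [Algebra (AlgebraicClosure F) R] [IsScalarTower F (AlgebraicClosure F) R]
    (a b : T.obj (CommAlgCat.of F R)) : a * b = b * a := by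
  obtain ⟨-, n, ⟨α⟩⟩ := hT
  let i := restrictAlgIso (F := F) (K := AlgebraicClosure F) R
  let m : T.obj (CommAlgCat.of F R) ≅ (splitTorus (AlgebraicClosure F) n).obj (CommAlgCat.of _ R) :=
    T.mapIso i.symm ≪≫ α.app _
  have hm : Function.Injective m.hom := by
    intro x y hxy
    have := congrArg m.inv hxy
    simpa using this
  apply hm
  rw [map_mul, map_mul]
  funext j
  exact _root_.mul_comm (m.hom a j) (m.hom b j)

/-- After splitting, points are tuples of units and `e` acts entry by entry. This is what forbids
additive one-parameter families in a torus: a substitution in a polynomial ring over a domain fixes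
all units. -/
lemma IsTorus.map_eq_self (hT : IsTorus T) (R : Type) [CommRing R] [Algebra F R]
    [Algebra (AlgebraicClosure F) R] [IsScalarTower F (AlgebraicClosure F) R]
    (e : R →ₐ[AlgebraicClosure F] R) (he : ∀ u : Rˣ, e u = u) (g : T.obj (CommAlgCat.of F R)) :
    T.map (CommAlgCat.ofHom (e.restrictScalars F)) g = g := by
  obtain ⟨-, n, ⟨α⟩⟩ := hT
  let i := restrictAlgIso (F := F) (K := AlgebraicClosure F) R
  have hi : T.map i.hom (T.map i.inv g) = g := by
    rw [← ConcreteCategory.comp_apply, ← T.map_comp, i.inv_hom_id, T.map_id]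
    rfl
  set g' := T.map i.inv g with hg'
  have h1 : T.map ((restrictAlg F (AlgebraicClosure F)).map (CommAlgCat.ofHom e)) g' = g' := by
    have hinj : Function.Injective (α.hom.app (CommAlgCat.of _ R)) := by
      intro x y hxy
      have := congrArg (α.inv.app (CommAlgCat.of _ R)) hxy
      simpa using this
    apply hinj
    have := ConcreteCategory.congr_hom (α.hom.naturality (CommAlgCat.ofHom e)) g'
    refine this.trans ?_
    funext j
    apply Units.ext
    exact he _
  rw [← hi, ← ConcreteCategory.comp_apply, ← T.map_comp, ← restrictAlg_map_comp_iso, T.map_comp,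
    ConcreteCategory.comp_apply, h1]

end Tori

section Inclusion

universe u

variable {F : Type} [Field F] {G : CommAlgCat.{0} F ⥤ GrpCat.{u}}

/-- The inclusion of subgroup functors. -/
def SubgroupFunctor.inclusion {T T' : SubgroupFunctor G} (h : T ≤ T') :
    T.toFunctor ⟶ T'.toFunctor where
  app R := GrpCat.ofHom (Subgroup.inclusion (h R))
  naturality _ _ _ := rfl

end Inclusion

end GroupFunctor

namespace PolarizedIsocrystal

open GroupFunctor

lemma endBaseChange_injective {F : Type} [Field F] {N : Type} [AddCommGroup N] [Module F N]
    {R S : Type} [CommRing R] [Algebra F R] [CommRing S] [Algebra F S] (f : R →ₐ[F] S)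
    (hf : Function.Injective f) : Function.Injective (endBaseChange (N := N) f) := by
  intro g g' h
  apply end_ext
  intro n
  have hinj : Function.Injective (TensorProduct.map f.toLinearMap (LinearMap.id (R := F) (M := N))) :=
    Module.Flat.rTensor_preserves_injective_linearMap f.toLinearMap hf
  apply hinj
  rw [← endBaseChange_one_tmul, h, endBaseChange_one_tmul]

variable {p : ℕ} [Fact p.Prime] {k : Type} [Field k] [CharP k p] [PerfectRing k p]
variable {N : Type} [AddCommGroup N] [Isocrystal p k N]
variable [Module ℚ_[p] N] [IsScalarTower ℚ_[p] K(p, k) N]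
variable {ψ : LinearMap.BilinForm K(p, k) N}

lemma J_ext {R : CommAlgCat.{0} ℚ_[p]} {a b : (J p k ψ).obj R}
    (h : ((show groupJ p k ψ R from a).1 : Module.End R (R ⊗[ℚ_[p]] N)) =
      ((show groupJ p k ψ R from b).1 : Module.End R (R ⊗[ℚ_[p]] N))) : a = b :=
  Subtype.ext (Units.ext h)

lemma J_map_injective {R S : CommAlgCat.{0} ℚ_[p]} (f : R ⟶ S) (hf : Function.Injective f.hom) :
    Function.Injective ((J p k ψ).map f) := fun _ _ h ↦ J_ext
  (endBaseChange_injective f.hom hf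
    (congrArg (fun g : (J p k ψ).obj S ↦ (show groupJ p k ψ S from g).1.1) h))

/-- Commutativity of torus points is available only over algebras containing the algebraic closure.
By flatness `𝐉(R)` embeds into `𝐉` of the tensor product of `R` with that closure, so commutation
can be checked there. -/
lemma le_centralizer_of_isTorus (h : (J p k ψ).obj (CommAlgCat.of ℚ_[p] ℚ_[p]))
    (T : SubgroupFunctor (J p k ψ)) (hT : IsTorus T.toFunctor)
    (hmem : h ∈ T.obj (CommAlgCat.of ℚ_[p] ℚ_[p])) : T ≤ centralizer (J p k ψ) h := by
  intro R t ht
  change t ∈ Subgroup.centralizer _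
  rw [Subgroup.mem_centralizer_singleton_iff]
  let S := CommAlgCat.of ℚ_[p] (AlgebraicClosure ℚ_[p] ⊗[ℚ_[p]] R)
  let f : R ⟶ S := CommAlgCat.ofHom Algebra.TensorProduct.includeRight
  apply J_map_injective f (Algebra.TensorProduct.includeRight_injective
    (RingHom.injective (algebraMap ℚ_[p] (AlgebraicClosure ℚ_[p]))))
  rw [map_mul, map_mul]
  exact congrArg Subtype.val (hT.mul_comm (AlgebraicClosure ℚ_[p] ⊗[ℚ_[p]] R)
    (⟨_, T.map_mem f _ ht⟩ : T.obj S)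
    (⟨_, T.map_mem f _ (T.map_mem (CommAlgCat.ofHom (Algebra.ofId ℚ_[p] R)) h hmem)⟩ : T.obj S))

/-- The centralizer of an element which is regular and elliptic is anisotropic modulo center. -/
theorem isAnisotropicModCenter_centralizer (h : (J p k ψ).obj (CommAlgCat.of ℚ_[p] ℚ_[p]))
    (hreg : IsRegularElement h) (hell : IsEllipticElement h) :
    IsAnisotropicModCenter (centralizer (J p k ψ) h) := by
  obtain ⟨T, hT, hani, hmem⟩ := hell
  -- The elliptic torus lies in the centralizer, which is itself a torus by regularity, so
  -- maximality gives the reverse inclusion and cocharacters can be transported.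
  have hle := hT.2 _ hreg.1 (le_centralizer_of_isTorus h T hT.1 hmem)
  intro c R t
  exact hani (c ≫ SubgroupFunctor.inclusion hle) R t

/-! ### Unipotent points of the centralizer -/

section Unitary

variable [FiniteDimensional K(p, k) N] (hψ : IsPolarization p k ψ)
variable {R S : Type} [CommRing R] [Algebra ℚ_[p] R] [CommRing S] [Algebra ℚ_[p] S]

lemma starEnd_map (f : R →ₐ[ℚ_[p]] S) (x : R ⊗[ℚ_[p]] isocrystalEnd p k N) :
    (starEnd hψ).baseChange S (Algebra.TensorProduct.map f (AlgHom.id ℚ_[p] _) x) =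
      Algebra.TensorProduct.map f (AlgHom.id ℚ_[p] _) ((starEnd hψ).baseChange R x) := by
  induction x with
  | zero => simp
  | add u v hu hv => simp only [map_add, hu, hv]
  | tmul r a => simp

lemma unitaryPoint_mem_centralizer (h : (J p k ψ).obj (CommAlgCat.of ℚ_[p] ℚ_[p]))
    (y : R ⊗[ℚ_[p]] isocrystalEnd p k N)
    (h1 : y * (starEnd hψ).baseChange R y = 1) (h2 : (starEnd hψ).baseChange R y * y = 1)
    (hy : Commute y (1 ⊗ₜ toIsocrystalEnd h)) :
    (unitaryPoint hψ y h1 h2 : (J p k ψ).obj (CommAlgCat.of ℚ_[p] R)) ∈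
      (centralizer (J p k ψ) h).obj (CommAlgCat.of ℚ_[p] R) := by
  refine (Subgroup.mem_centralizer_singleton_iff (G := (J p k ψ).obj (CommAlgCat.of ℚ_[p] R))).2 ?_
  apply J_ext
  have e := map_val_eq_rho h (CommAlgCat.of ℚ_[p] R) (CommAlgCat.ofHom (Algebra.ofId ℚ_[p] R))
  have e2 := (hy.map (rho p k N R)).eq
  rw [← e] at e2
  exact e2

variable (R) in
lemma starEnd_baseChange_one : (starEnd hψ).baseChange R 1 = 1 := by
  rw [Algebra.TensorProduct.one_def, LinearMap.baseChange_tmul, starEnd_one]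

lemma one_add_unitary {x : R ⊗[ℚ_[p]] isocrystalEnd p k N} (hx : x * x = 0)
    (hs : (starEnd hψ).baseChange R x = -x) :
    (1 + x) * (starEnd hψ).baseChange R (1 + x) = 1 ∧
      (starEnd hψ).baseChange R (1 + x) * (1 + x) = 1 := by
  have hz : x + (starEnd hψ).baseChange R x = 0 := by
    rw [hs]
    exact add_neg_cancel x
  rw [map_add, starEnd_baseChange_one]
  generalize (starEnd hψ).baseChange R x = z at hz
  have h1 : x * z = 0 := by
    have := mul_add x x z
    rw [hz, mul_zero, hx, zero_add] at this
    exact this.symm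
  have h2 : z * x = 0 := by
    have := add_mul x z x
    rw [hz, zero_mul, hx, zero_add] at this
    exact this.symm
  constructor
  · rw [add_mul, mul_add, mul_add, h1, one_mul, one_mul, mul_one, add_zero, add_assoc, add_comm z,
      hz, add_zero]
  · rw [add_mul, mul_add, mul_add, h2, one_mul, one_mul, mul_one, add_zero, add_assoc, hz,
      add_zero]

end Unitary

/-- If `h` is regular, its centralizer contains no nilpotents of square zero in the Lie algebra. -/
theorem eq_zero_of_regular [FiniteDimensional K(p, k) N] (hψ : IsPolarization p k ψ)
    (h : (J p k ψ).obj (CommAlgCat.of ℚ_[p] ℚ_[p])) (hreg : IsRegularElement h)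
    (D : Type) [CommRing D] [IsDomain D] [Algebra ℚ_[p] D] [Algebra (AlgebraicClosure ℚ_[p]) D]
    [IsScalarTower ℚ_[p] (AlgebraicClosure ℚ_[p]) D]
    (x : D ⊗[ℚ_[p]] isocrystalEnd p k N) (hx : x * x = 0)
    (hs : (starEnd hψ).baseChange D x = -x) (hc : Commute x (1 ⊗ₜ toIsocrystalEnd h)) :
    x = 0 := by
  -- The substitution `X ↦ 0`. It fixes every unit because the units of a polynomial ring over a
  -- domain are constants.
  let e : Polynomial D →ₐ[AlgebraicClosure ℚ_[p]] Polynomial D :=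
    ((Algebra.ofId D (Polynomial D)).comp (Polynomial.aeval (0 : D))).restrictScalars _
  have he : ∀ u : (Polynomial D)ˣ, e u = u := by
    intro u
    obtain ⟨r, -, hr⟩ := Polynomial.isUnit_iff.1 u.isUnit
    rw [← hr]
    simp [e, Algebra.ofId_apply]
  let c : D →ₐ[ℚ_[p]] Polynomial D := (Algebra.ofId D (Polynomial D)).restrictScalars _
  let ev : Polynomial D →ₐ[ℚ_[p]] D := (Polynomial.aeval (1 : D)).restrictScalars _
  let x' := Algebra.TensorProduct.map c (AlgHom.id ℚ_[p] (isocrystalEnd p k N)) x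
  let y := (Polynomial.X : Polynomial D) • x'
  have hy : y * y = 0 := by
    simp only [y, smul_mul_smul_comm, x', ← map_mul, hx, map_zero, smul_zero]
  have hys : (starEnd hψ).baseChange (Polynomial D) y = -y := by
    simp only [y, map_smul, x', starEnd_map hψ, hs, map_neg, smul_neg]
  have hyc : Commute y (1 ⊗ₜ toIsocrystalEnd h) := by
    have := hc.map (Algebra.TensorProduct.map c (AlgHom.id ℚ_[p] (isocrystalEnd p k N)))
    rw [Algebra.TensorProduct.map_tmul, map_one] at this
    exact this.smul_left _
  obtain ⟨h1, h2⟩ := one_add_unitary hψ hy hys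
  have hmem := unitaryPoint_mem_centralizer hψ h (1 + y) h1 h2 ((Commute.one_left _).add_left hyc)
  -- The point `1 + X x` of the centralizer is fixed by `X ↦ 0`, hence `X x = 0`; evaluation at `X =
  -- 1` then recovers `x = 0`.
  have key := hreg.1.map_eq_self (Polynomial D) e he
    (⟨_, hmem⟩ : (centralizer (J p k ψ) h).obj (CommAlgCat.of ℚ_[p] (Polynomial D)))
  have key2 : endBaseChange (e.restrictScalars ℚ_[p]) (rho p k N (Polynomial D) (1 + y)) =
      rho p k N (Polynomial D) (1 + y) :=
    congrArg (fun g : (centralizer (J p k ψ) h).obj (CommAlgCat.of ℚ_[p] (Polynomial D)) ↦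
      (show groupJ p k ψ (Polynomial D) from g.1).1.1) key
  rw [endBaseChange_rho] at key2
  have key3 := rho_injective p k key2
  rw [map_add, map_one, add_right_inj] at key3
  have hyX : y = ((Polynomial.X : Polynomial D) ⊗ₜ 1) * x' := by
    change (Polynomial.X : Polynomial D) • x' = _
    rw [Algebra.smul_def]
    rfl
  have hey : Algebra.TensorProduct.map (e.restrictScalars ℚ_[p])
      (AlgHom.id ℚ_[p] (isocrystalEnd p k N)) y = 0 := by
    rw [hyX, map_mul, Algebra.TensorProduct.map_tmul]
    simp [e]
  have hy0 : y = 0 := by rw [← key3, hey]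
  have hev : Algebra.TensorProduct.map ev (AlgHom.id ℚ_[p] (isocrystalEnd p k N)) y = x := by
    rw [hyX, map_mul, Algebra.TensorProduct.map_tmul]
    have h3 : Algebra.TensorProduct.map ev (AlgHom.id ℚ_[p] (isocrystalEnd p k N)) x' = x := by
      have : ev.comp c = AlgHom.id ℚ_[p] D := by ext; simp [ev, c, Algebra.ofId_apply]
      change ((Algebra.TensorProduct.map ev (AlgHom.id ℚ_[p] (isocrystalEnd p k N))).comp
        (Algebra.TensorProduct.map c (AlgHom.id ℚ_[p] (isocrystalEnd p k N)))) x = x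
      rw [← Algebra.TensorProduct.map_comp, this]
      simp
    rw [h3]
    simp [ev, ← Algebra.TensorProduct.one_def]
  rw [← hev, hy0, map_zero]

end PolarizedIsocrystal

/-! ### Similitudes of symplectic spaces without nilpotents in the centralizer -/

namespace SymplecticSimilitude

variable {L V : Type*} [Field L] [AddCommGroup V] [Module L V] {B : LinearMap.BilinForm L V}

/-- The operator `z ↦ B(z, v) w + B(z, w) v` in the symplectic Lie algebra. -/
def symOp (B : LinearMap.BilinForm L V) (v w : V) : Module.End L V :=
  (B.flip v).smulRight w + (B.flip w).smulRight v

lemma symOp_apply (v w z : V) : symOp B v w z = B z v • w + B z w • v := rfl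

lemma symOp_skew (hB : B.IsAlt) (v w a b : V) : B (symOp B v w a) b = -B a (symOp B v w b) := by
  simp only [symOp_apply, map_add, map_smul, LinearMap.add_apply, LinearMap.smul_apply, smul_eq_mul]
  rw [← hB.neg_eq w b, ← hB.neg_eq v b]
  ring

lemma symOp_mul_self (hB : B.IsAlt) {v w : V} (hvw : B v w = 0) :
    symOp B v w * symOp B v w = 0 := by
  ext z
  have h1 : B w v = 0 := by rw [← hB.neg_eq, hvw, neg_zero]
  have h2 : B v v = 0 := hB v
  have h3 : B w w = 0 := hB w
  simp [Module.End.mul_apply, symOp_apply, hvw, h1, h2, h3]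

/-- If it vanished, `w = a v` for some scalar `a`, and the operator would be `z ↦ 2 a B(z, v) v`;
this is where characteristic different from 2 is needed. -/
lemma symOp_ne_zero [NeZero (2 : L)] (hB : B.Nondegenerate) {v w : V} (hv : v ≠ 0) (hw : w ≠ 0) :
    symOp B v w ≠ 0 := by
  intro h0
  obtain ⟨z, hz⟩ : ∃ z, B z v ≠ 0 := by
    by_contra! hcon
    exact hv (hB.2 v hcon)
  have h1 : B z v • w + B z w • v = 0 := LinearMap.congr_fun h0 z
  obtain ⟨a, rfl⟩ : ∃ a : L, w = a • v := ⟨(B z v)⁻¹ * -(B z w), by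
    rw [mul_smul, neg_smul, ← eq_neg_of_add_eq_zero_left h1, smul_smul, inv_mul_cancel₀ hz,
      one_smul]⟩
  rw [map_smul, smul_smul, smul_eq_mul, ← add_smul, mul_comm a, ← two_mul, smul_eq_zero] at h1
  rcases h1 with h1 | h1
  · rcases mul_eq_zero.1 h1 with h1 | h1
    · exact two_ne_zero h1
    · rcases mul_eq_zero.1 h1 with h1 | h1
      · exact hz h1
      · exact hw (by rw [h1, zero_smul])
  · exact hv h1

variable {u : Module.End L V} {c : L}

/-- Since `a b = c`, the similitude relation gives `B(u z, v) = b B(z, v)` and `B(u z, w) = a B(z,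
w)`, and the eigenvalues on `w` and `v` match these factors. -/
lemma symOp_commute (hu : ∀ x y, B (u x) (u y) = c * B x y) {v w : V} {a b : L}
    (hc : c ≠ 0) (hab : a * b = c) (hv : u v = a • v) (hw : u w = b • w) :
    Commute (symOp B v w) u := by
  have ha : a ≠ 0 := fun h ↦ hc (by rw [← hab, h, zero_mul])
  have hb : b ≠ 0 := fun h ↦ hc (by rw [← hab, h, mul_zero])
  have h1 : ∀ z, B (u z) v = b * B z v := fun z ↦ by
    have := hu z v
    rw [hv, map_smul, smul_eq_mul, ← hab, mul_assoc] at this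
    exact mul_left_cancel₀ ha this
  have h2 : ∀ z, B (u z) w = a * B z w := fun z ↦ by
    have := hu z w
    rw [hw, map_smul, smul_eq_mul, ← hab, mul_comm a, mul_assoc] at this
    exact mul_left_cancel₀ hb this
  ext z
  simp only [Module.End.mul_apply, symOp_apply, h1, h2, map_add, map_smul, hv, hw, smul_smul]
  congr 2 <;> ring

section

variable [NeZero (2 : L)] (hB : B.IsAlt) (hB' : B.Nondegenerate) (hc : c ≠ 0)
  (hu : ∀ x y, B (u x) (u y) = c * B x y)
  (hnil : ∀ x : Module.End L V, (∀ a b, B (x a) b = -B a (x b)) → x * x = 0 → Commute x u → x = 0)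

include hB hB' hc hu hnil

/-- Orthogonal `v` and `w` would make `symOp B v w` a nonzero skew operator of square zero commuting
with `u`. The case `v = w` is allowed, so `a * a = c` is impossible for an eigenvalue `a`. -/
lemma apply_ne_zero {a b : L} (hab : a * b = c) {v w : V} (hv : u v = a • v) (hw : u w = b • w)
    (hv0 : v ≠ 0) (hw0 : w ≠ 0) : B v w ≠ 0 := fun h ↦
  symOp_ne_zero hB' hv0 hw0 (hnil _ (symOp_skew hB v w) (symOp_mul_self hB h)
    (symOp_commute hu hc hab hv hw))

-- The vector `v` is orthogonal to the range of `u - c / a`. If `c / a` were not an eigenvalue, that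
-- range would be everything, contradicting nondegeneracy.
omit [NeZero (2 : L)] hB hnil in
lemma exists_dual_eigenvector [FiniteDimensional L V] {a : L} {v : V} (hv : u v = a • v)
    (hv0 : v ≠ 0) : a ≠ 0 ∧ ∃ w, w ≠ 0 ∧ u w = (c / a) • w := by
  obtain ⟨z, hz⟩ : ∃ z, B v z ≠ 0 := by
    by_contra! hcon
    exact hv0 (hB'.1 v hcon)
  have ha : a ≠ 0 := by
    rintro rfl
    have := hu v z
    rw [hv, zero_smul, map_zero, LinearMap.zero_apply] at this
    exact mul_ne_zero hc hz this.symm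
  refine ⟨ha, ?_⟩
  by_contra! hcon
  have hinj : Function.Injective (u - (c / a) • (1 : Module.End L V)) := by
    rw [injective_iff_map_eq_zero]
    intro w hw
    by_contra hw0
    refine hcon w hw0 ?_
    simpa [sub_eq_zero] using hw
  obtain ⟨t, rfl⟩ := LinearMap.surjective_of_injective hinj z
  apply hz
  have := hu v t
  rw [hv, map_smul, LinearMap.smul_apply, smul_eq_mul] at this
  simp only [LinearMap.sub_apply, LinearMap.smul_apply, Module.End.one_apply, map_sub, map_smul,
    smul_eq_mul]
  field_simp
  rw [mul_zero, mul_comm, this, sub_self]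

/-- The range of `u - a` is orthogonal to the eigenvectors for `c / a`, while a nonzero eigenvector
for `a` pairs nontrivially with them. So `u` has no Jordan block of size 2. -/
lemma eq_zero_of_mem_range [FiniteDimensional L V] {a : L} {v v' : V} (hv : u v = a • v)
    (hv' : u v' - a • v' = v) : v = 0 := by
  by_contra hv0
  obtain ⟨ha, w, hw0, hw⟩ := exists_dual_eigenvector hB' hc hu hv hv0
  refine apply_ne_zero hB hB' hc hu hnil (mul_div_cancel₀ c ha) hv hw hv0 hw0 ?_
  have := hu v' w
  rw [hw, map_smul, smul_eq_mul] at this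
  rw [← hv', map_sub, map_smul, LinearMap.sub_apply, LinearMap.smul_apply, smul_eq_mul]
  field_simp at this
  rw [this, sub_self]

/-- With `w` a dual eigenvector, `B(v, w) v' - B(v', w) v` is an eigenvector for `a` orthogonal to
`w`, hence zero. Eigenspaces are therefore lines. -/
lemma exists_smul_eq [FiniteDimensional L V] {a : L} {v v' : V} (hv : u v = a • v) (hv0 : v ≠ 0)
    (hv' : u v' = a • v') : ∃ r : L, v' = r • v := by
  obtain ⟨ha, w, hw0, hw⟩ := exists_dual_eigenvector hB' hc hu hv hv0
  have h1 := apply_ne_zero hB hB' hc hu hnil (mul_div_cancel₀ c ha) hv hw hv0 hw0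
  have h2 : B v w • v' - B v' w • v = 0 := by
    by_contra h0
    refine apply_ne_zero hB hB' hc hu hnil (mul_div_cancel₀ c ha) (v := B v w • v' - B v' w • v)
      ?_ hw h0 hw0 ?_
    · rw [map_sub, map_smul, map_smul, hv, hv', smul_sub, smul_comm a, smul_comm a]
    · simp [mul_comm]
  refine ⟨(B v w)⁻¹ * B v' w, ?_⟩
  rw [mul_smul, ← sub_eq_zero.1 h2, smul_smul, inv_mul_cancel₀ h1, one_smul]

lemma span_eigenvectors [FiniteDimensional L V] [IsAlgClosed L] :
    Submodule.span L {v | ∃ a : L, u v = a • v} = ⊤ := by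
  rw [eq_top_iff, ← Module.End.iSup_maxGenEigenspace_eq_top u, iSup_le_iff]
  intro a v hv
  obtain ⟨m, hm⟩ := (Module.End.mem_maxGenEigenspace u a v).1 hv
  -- Generalized eigenvectors span over an algebraically closed field; absence of Jordan blocks
  -- lowers the exponent to 1.
  suffices h : ∀ (m : ℕ) (v : V), ((u - a • (1 : Module.End L V)) ^ m) v = 0 → u v = a • v from
    Submodule.subset_span ⟨a, h m v hm⟩
  intro m
  induction m with
  | zero =>
    intro v hv
    rw [pow_zero, Module.End.one_apply] at hv
    rw [hv, map_zero, smul_zero]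
  | succ m ih =>
    intro v hv
    rw [pow_succ, Module.End.mul_apply] at hv
    have h1 := ih _ hv
    simp only [LinearMap.sub_apply, LinearMap.smul_apply, Module.End.one_apply] at h1
    exact sub_eq_zero.1 (eq_zero_of_mem_range hB hB' hc hu hnil h1 rfl)

lemma exists_smul_of_commute [FiniteDimensional L V] {f : Module.End L V} (hf : Commute f u)
    {v : V} {a : L} (hv : u v = a • v) : ∃ r : L, f v = r • v := by
  by_cases hv0 : v = 0
  · exact ⟨0, by rw [hv0, map_zero, smul_zero]⟩
  · refine exists_smul_eq hB hB' hc hu hnil hv hv0 ?_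
    have := LinearMap.congr_fun hf.eq v
    rw [Module.End.mul_apply, Module.End.mul_apply, hv, map_smul] at this
    exact this.symm

/-- The centralizer of `u` is commutative. -/
theorem commute_of_commute [FiniteDimensional L V] [IsAlgClosed L] {f g : Module.End L V}
    (hf : Commute f u) (hg : Commute g u) : Commute f g := by
  apply LinearMap.ext_on (span_eigenvectors hB hB' hc hu hnil)
  rintro v ⟨a, hv⟩
  obtain ⟨r, hr⟩ := exists_smul_of_commute hB hB' hc hu hnil hf hv
  obtain ⟨s, hs⟩ := exists_smul_of_commute hB hB' hc hu hnil hg hv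
  rw [Module.End.mul_apply, Module.End.mul_apply, hr, hs, map_smul, map_smul, hr, hs, smul_comm]

/-- The centralizer of `u` is reduced. -/
theorem eq_zero_of_commute [FiniteDimensional L V] [IsAlgClosed L] {f : Module.End L V}
    (hf : Commute f u) (hff : f * f = 0) : f = 0 := by
  apply LinearMap.ext_on (span_eigenvectors hB hB' hc hu hnil)
  rintro v ⟨a, hv⟩
  obtain ⟨r, hr⟩ := exists_smul_of_commute hB hB' hc hu hnil hf hv
  have := LinearMap.congr_fun hff v
  rw [Module.End.mul_apply, hr, map_smul, hr, smul_smul, LinearMap.zero_apply, smul_eq_zero] at this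
  rw [hr, LinearMap.zero_apply, smul_eq_zero]
  simpa using this

end

end SymplecticSimilitude

namespace PolarizedIsocrystal

/-! ### Base change of bilinear forms -/

section BilinForm

variable {K N : Type*} [Field K] [AddCommGroup N] [Module K N] [FiniteDimensional K N]
variable {ψ : LinearMap.BilinForm K N}

/-- The pairings with a basis of `N` are the coordinates of `x` in the dual basis, over any
coefficient ring. -/
lemma eq_zero_of_baseChange_left (hψ : ψ.Nondegenerate) (A : Type*) [CommRing A] [Algebra K A]
    (x : A ⊗[K] N) (hx : ∀ n, ψ.baseChange A x (1 ⊗ₜ n) = 0) : x = 0 := by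
  classical
  let b := Module.finBasis K N
  let b' := ψ.dualBasis hψ b
  let c := Algebra.TensorProduct.basis A b'
  apply c.repr.injective
  ext j
  have h := hx (b j)
  rw [← c.sum_repr x, map_sum, LinearMap.sum_apply] at h
  simpa [c, b', LinearMap.BilinForm.apply_dualBasis_left, Finset.sum_ite_eq, ite_smul] using h

omit [FiniteDimensional K N] in
lemma baseChange_skew (hψ : ψ.IsAlt) (A : Type*) [CommRing A] [Algebra K A] (x y : A ⊗[K] N) :
    ψ.baseChange A x y = -ψ.baseChange A y x := by
  induction x with
  | zero => simp
  | add a b ha hb => simp only [map_add, LinearMap.add_apply, ha, hb, neg_add]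
  | tmul r n =>
    induction y with
    | zero => simp
    | add a b ha hb => simp only [map_add, LinearMap.add_apply, ha, hb, neg_add]
    | tmul s m =>
      rw [LinearMap.BilinForm.baseChange_tmul, LinearMap.BilinForm.baseChange_tmul,
        ← hψ.neg_eq m n, mul_comm r s, neg_smul]

lemma baseChange_nondegenerate (hψ : ψ.Nondegenerate) (hψ' : ψ.IsAlt) (A : Type*) [CommRing A]
    [Algebra K A] : (ψ.baseChange A).Nondegenerate := by
  refine ⟨fun x hx ↦ eq_zero_of_baseChange_left hψ A x fun n ↦ hx _, fun x hx ↦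
    eq_zero_of_baseChange_left hψ A x fun n ↦ ?_⟩
  rw [baseChange_skew hψ', hx, neg_zero]

omit [FiniteDimensional K N] in
lemma baseChange_isAlt [CharZero K] (hψ : ψ.IsAlt) (A : Type*) [Field A] [Algebra K A] :
    (ψ.baseChange A).IsAlt := fun x ↦ by
  have : CharZero A := charZero_of_injective_algebraMap (algebraMap K A).injective
  exact self_eq_neg.1 (baseChange_skew hψ A x x)

omit [FiniteDimensional K N] in
lemma baseChange_similitude {u : Module.End K N} {c : K} (hu : ∀ x y, ψ (u x) (u y) = c * ψ x y)
    (A : Type*) [CommRing A] [Algebra K A] (x y : A ⊗[K] N) :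
    ψ.baseChange A (u.baseChange A x) (u.baseChange A y) = algebraMap K A c * ψ.baseChange A x y := by
  induction x with
  | zero => simp
  | add a b ha hb => simp only [map_add, LinearMap.add_apply, ha, hb, mul_add]
  | tmul r n =>
    induction y with
    | zero => simp
    | add a b ha hb => simp only [map_add, ha, hb, mul_add]
    | tmul s m => simp [hu, Algebra.smul_def, mul_assoc]

end BilinForm

/-! ### The centralizer of a regular element -/

section Regular

variable {p : ℕ} [Fact p.Prime] {k : Type} [Field k] [CharP k p] [PerfectRing k p] [IsAlgClosed k]
variable {N : Type} [AddCommGroup N] [Isocrystal p k N]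
variable [Module ℚ_[p] N] [IsScalarTower ℚ_[p] K(p, k) N] [FiniteDimensional K(p, k) N]
variable {ψ : LinearMap.BilinForm K(p, k) N}

instance : CharZero K(p, k) :=
  charZero_of_injective_algebraMap (algebraMap ℚ_[p] K(p, k)).injective

/-- Skew elements of `End(A ⊗ N)` come from skew elements of `A ⊗ End(N, Φ)`. -/
lemma exists_rhoK_eq (hslope : IsIsoclinic p k N 1 2) (hψ : IsPolarization p k ψ)
    (A : Type) [CommRing A] [Algebra ℚ_[p] A] [Algebra K(p, k) A] [IsScalarTower ℚ_[p] K(p, k) A]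
    (x : Module.End A (A ⊗[K(p, k)] N))
    (hx : ∀ a b, ψ.baseChange A (x a) b = -ψ.baseChange A a (x b)) (hxx : x * x = 0) :
    ∃ y : A ⊗[ℚ_[p]] isocrystalEnd p k N, rhoK p k N A y = x ∧ y * y = 0 ∧
      (starEnd hψ).baseChange A y = -y := by
  obtain ⟨hinj, hsurj⟩ := rhoK_bijective p k N A hslope
  obtain ⟨y, rfl⟩ := hsurj x
  refine ⟨y, rfl, hinj ?_, hinj ?_⟩
  · rw [map_mul, hxx, map_zero]
  · rw [map_neg]
    ext n
    have hnd := baseChange_nondegenerate hψ.nondegenerate hψ.isAlt A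
    change rhoK p k N A _ (1 ⊗ₜ n) = (-rhoK p k N A y) (1 ⊗ₜ n)
    refine sub_eq_zero.1 (hnd.2 _ fun a ↦ ?_)
    rw [map_sub, ← baseChange_rhoK hψ, hx, LinearMap.neg_apply, map_neg, sub_self]

variable (hslope : IsIsoclinic p k N 1 2) (hψ : IsPolarization p k ψ)
  (h : (J p k ψ).obj (CommAlgCat.of ℚ_[p] ℚ_[p])) (hreg : GroupFunctor.IsRegularElement h)

include hslope hψ hreg

lemma eq_zero_of_skew (L : Type) [Field L] [Algebra ℚ_[p] L] [Algebra K(p, k) L]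
    [IsScalarTower ℚ_[p] K(p, k) L] [IsAlgClosed L] (x : Module.End L (L ⊗[K(p, k)] N))
    (hx : ∀ a b, ψ.baseChange L (x a) b = -ψ.baseChange L a (x b)) (hxx : x * x = 0)
    (hxu : Commute x ((toEnd h).baseChange L)) : x = 0 := by
  obtain ⟨y, rfl, hyy, hys⟩ := exists_rhoK_eq hslope hψ L x hx hxx
  -- An embedding of the algebraic closure of `ℚ_p` into `L` is chosen, because tori are tested on
  -- algebras over that closure.
  let _ : Algebra (AlgebraicClosure ℚ_[p]) L :=
    (IsAlgClosed.lift : AlgebraicClosure ℚ_[p] →ₐ[ℚ_[p]] L).toAlgebra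
  have : IsScalarTower ℚ_[p] (AlgebraicClosure ℚ_[p]) L :=
    IsScalarTower.of_algHom (IsAlgClosed.lift : AlgebraicClosure ℚ_[p] →ₐ[ℚ_[p]] L)
  rw [eq_zero_of_regular hψ h hreg L y hyy hys ?_, map_zero]
  apply (rhoK_bijective p k N L hslope).1
  rw [map_mul, map_mul, rhoK_one_tmul]
  exact hxu

/-- The eigenvector argument needs an algebraically closed field `L`; both conclusions descend
because base change embeds `End_K(N)` into `End_L(L ⊗ N)`. -/
theorem commute_and_reduced_of_regular (L : Type) [Field L] [Algebra ℚ_[p] L] [Algebra K(p, k) L]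
    [IsScalarTower ℚ_[p] K(p, k) L] [IsAlgClosed L] :
    (∀ f g : Module.End K(p, k) N, Commute f (toEnd h) → Commute g (toEnd h) → Commute f g) ∧
    (∀ f : Module.End K(p, k) N, Commute f (toEnd h) → f * f = 0 → f = 0) := by
  obtain ⟨c, hc, hu⟩ := exists_similitude_factor h
  have : CharZero L := charZero_of_injective_algebraMap (algebraMap K(p, k) L).injective
  have hc' : algebraMap K(p, k) L c ≠ 0 := by simpa using hc
  have hinj : Function.Injective (Module.End.baseChangeHom K(p, k) L N) :=
    LinearMap.baseChangeHom_injective K(p, k) N L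
  have hB := baseChange_isAlt hψ.isAlt L
  have hB' := baseChange_nondegenerate hψ.nondegenerate hψ.isAlt L
  have hnil := eq_zero_of_skew hslope hψ h hreg L
  have hu' := baseChange_similitude hu L
  constructor
  · intro f g hf hg
    apply hinj
    rw [map_mul, map_mul]
    exact SymplecticSimilitude.commute_of_commute hB hB' hc' hu' hnil
      (hf.map (Module.End.baseChangeHom K(p, k) L N)) (hg.map (Module.End.baseChangeHom K(p, k) L N))
  · intro f hf hff
    apply hinj
    rw [map_zero]
    refine SymplecticSimilitude.eq_zero_of_commute hB hB' hc' hu' hnil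
      (hf.map (Module.End.baseChangeHom K(p, k) L N)) ?_
    rw [← map_mul, hff, map_zero]

end Regular

end PolarizedIsocrystal

namespace PolarizedIsocrystal

/-! ### Lagrangian projectors -/

section Projector

/-- The orthogonal of the range of `e` is the kernel of its adjoint `e' = 1 - e`, which is the range
of `e`. -/
lemma orthogonal_range_eq {A M : Type*} [CommRing A] [AddCommGroup M] [Module A M]
    {B : LinearMap.BilinForm A M} (hB : ∀ x, (∀ y, B y x = 0) → x = 0) {e e' : Module.End A M}
    (hee : e * e = e) (hadj : ∀ x y, B (e x) y = B x (e' y)) (hsum : e + e' = 1) :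
    B.orthogonal (LinearMap.range e) = LinearMap.range e := by
  have hs : ∀ m, e m + e' m = m := fun m ↦ LinearMap.congr_fun hsum m
  ext m
  rw [LinearMap.BilinForm.mem_orthogonal_iff]
  constructor
  · intro h
    have : e' m = 0 := hB _ fun y ↦ by rw [← hadj]; exact h _ ⟨y, rfl⟩
    exact ⟨m, by have := hs m; simp_all⟩
  · rintro ⟨m, rfl⟩ _ ⟨x, rfl⟩
    have h1 : e' (e m) = 0 := by
      have := hs (e m)
      rw [← Module.End.mul_apply, hee] at this
      simpa using this
    change B (e x) (e m) = 0
    rw [hadj, h1, map_zero]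

/-- Commuting idempotents with the same range are equal. -/
lemma idempotent_eq_of_range_eq {A M : Type*} [CommRing A] [AddCommGroup M] [Module A M]
    {e f : Module.End A M} (he : e * e = e) (hf : f * f = f) (hc : Commute e f)
    (h : LinearMap.range e = LinearMap.range f) : e = f := by
  have h1 : e * f = f := by
    ext m
    obtain ⟨x, hx⟩ : f m ∈ LinearMap.range e := h ▸ ⟨m, rfl⟩
    rw [Module.End.mul_apply, ← hx, ← Module.End.mul_apply, he]
  have h2 : f * e = e := by
    ext m
    obtain ⟨x, hx⟩ : e m ∈ LinearMap.range f := h ▸ ⟨m, rfl⟩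
    rw [Module.End.mul_apply, ← hx, ← Module.End.mul_apply, hf]
  rw [← h2, ← hc.eq, h1]

/-- Commuting idempotents with the same kernel are equal. -/
lemma idempotent_eq_of_ker_eq {A M : Type*} [CommRing A] [AddCommGroup M] [Module A M]
    {e f : Module.End A M} (he : e * e = e) (hf : f * f = f) (hc : Commute e f)
    (h : ∀ m, e m = 0 ↔ f m = 0) : e = f := by
  have h1 : e * f = e := by
    ext m
    have : f (m - f m) = 0 := by
      rw [map_sub, ← Module.End.mul_apply, hf, sub_self]
    rw [← h, map_sub, sub_eq_zero] at this
    exact this.symm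
  have h2 : f * e = f := by
    ext m
    have : e (m - e m) = 0 := by
      rw [map_sub, ← Module.End.mul_apply, he, sub_self]
    rw [h, map_sub, sub_eq_zero] at this
    exact this.symm
  rw [← h1, hc.eq, h2]

lemma projective_quotient_range {A M : Type*} [CommRing A] [AddCommGroup M] [Module A M]
    [Module.Projective A M] {e : Module.End A M} (he : e * e = e) :
    Module.Projective A (M ⧸ LinearMap.range e) := by
  refine Module.Projective.of_split ((LinearMap.range e).liftQ (1 - e) ?_)
    (LinearMap.range e).mkQ ?_
  · rintro _ ⟨m, rfl⟩
    change (1 - e) (e m) = 0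
    rw [LinearMap.sub_apply, Module.End.one_apply, ← Module.End.mul_apply, he, sub_self]
  · ext m
    simp

variable {K N : Type*} [Field K] [AddCommGroup N] [Module K N] [FiniteDimensional K N]
variable {ψ : LinearMap.BilinForm K N}

lemma baseChange_baseChange_nondegenerate (hψ : ψ.Nondegenerate) (hψ' : ψ.IsAlt)
    (A κ : Type*) [CommRing A] [Algebra K A] [CommRing κ] [Algebra A κ] [Algebra K κ]
    [IsScalarTower K A κ] : ((ψ.baseChange A).baseChange κ).Nondegenerate := by
  let c := AlgebraTensorModule.cancelBaseChange K A κ κ N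
  have h : ∀ x y, (ψ.baseChange A).baseChange κ x y = ψ.baseChange κ (c x) (c y) := by
    intro x y
    induction x with
    | zero => simp
    | add a b ha hb => simp only [map_add, LinearMap.add_apply, ha, hb]
    | tmul r m =>
      induction y with
      | zero => simp
      | add a b ha hb => simp only [map_add, ha, hb]
      | tmul s m' =>
        induction m with
        | zero => simp
        | add a b ha hb => simp only [map_add, tmul_add, LinearMap.add_apply, ha, hb]
        | tmul a n =>
          induction m' with
          | zero => simp
          | add a b ha hb => simp only [map_add, tmul_add, ha, hb]
          | tmul b n' =>
            simp only [LinearMap.BilinForm.baseChange_tmul, c,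
              AlgebraTensorModule.cancelBaseChange_tmul, Algebra.smul_def, map_mul,
              ← IsScalarTower.algebraMap_apply K A κ]
            ring
  have hnd := baseChange_nondegenerate hψ hψ' κ
  constructor
  · intro x hx
    apply c.injective
    rw [map_zero]
    refine hnd.1 _ fun y ↦ ?_
    rw [← c.apply_symm_apply y, ← h, hx]
  · intro x hx
    apply c.injective
    rw [map_zero]
    refine hnd.2 _ fun y ↦ ?_
    rw [← c.apply_symm_apply y, ← h, hx]

/-- Pass to the residue field at `P`: there the range of `e` is its own orthogonal in a
nondegenerate space of dimension `2 d`, so it and its quotient have dimension `d`. -/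
lemma rankAtStalk_quotient_range (hψ : ψ.Nondegenerate) (hψ' : ψ.IsAlt) {d : ℕ}
    (hd : finrank K N = 2 * d) {A : Type*} [CommRing A] [Algebra K A]
    {e e' : Module.End A (A ⊗[K] N)} (hee : e * e = e)
    (hadj : ∀ x y, ψ.baseChange A (e x) y = ψ.baseChange A x (e' y)) (hsum : e + e' = 1)
    (P : PrimeSpectrum A) :
    rankAtStalk (R := A) ((A ⊗[K] N) ⧸ LinearMap.range e) P = d := by
  have := projective_quotient_range hee
  have : Nontrivial A := PrimeSpectrum.nontrivial P
  rw [rankAtStalk_eq]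
  let κ := P.asIdeal.ResidueField
  let _ : Algebra K κ := Algebra.compHom κ (algebraMap K A)
  have : IsScalarTower K A κ := IsScalarTower.of_algebraMap_eq fun _ ↦ rfl
  change finrank κ (κ ⊗[A] ((A ⊗[K] N) ⧸ LinearMap.range e)) = d
  let q := (LinearMap.range e).mkQ.baseChange κ
  have hq : Function.Surjective q :=
    LinearMap.baseChange_surjective κ (Submodule.mkQ_surjective _)
  have hker : LinearMap.ker q = LinearMap.range (e.baseChange κ) := by
    have : Function.Exact e (LinearMap.range e).mkQ := by
      rw [LinearMap.exact_iff, Submodule.ker_mkQ]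
    have h2 := lTensor_exact κ this (Submodule.mkQ_surjective _)
    ext x
    exact h2 x
  have hV : finrank κ (κ ⊗[A] (A ⊗[K] N)) = 2 * d := by
    rw [finrank_baseChange, finrank_baseChange, hd]
  have h1 := LinearMap.finrank_range_add_finrank_ker q
  rw [LinearMap.range_eq_top.2 hq, finrank_top, hker, hV] at h1
  have hnd := baseChange_baseChange_nondegenerate hψ hψ' A κ
  have h2 := LinearMap.BilinForm.finrank_orthogonal hnd (LinearMap.range (e.baseChange κ))
  rw [orthogonal_range_eq (e' := e'.baseChange κ) hnd.2 (by rw [← LinearMap.baseChange_mul, hee])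
    ?_ ?_, hV] at h2
  · change _ + finrank κ _ = _ at h1
    omega
  · intro x y
    induction x with
    | zero => simp
    | add a b ha hb => simp only [map_add, LinearMap.add_apply, ha, hb]
    | tmul r m =>
      induction y with
      | zero => simp
      | add a b ha hb => simp only [map_add, ha, hb]
      | tmul s m' => simp [hadj]
  · rw [← LinearMap.baseChange_add, hsum, LinearMap.baseChange_one]

end Projector

/-! ### Averaging projectors over an unramified algebra -/

section Average

variable {K A B M : Type*} [Field K] [CommRing A] [Algebra K A] [CommRing B] [Algebra K B]
  [AddCommGroup M] [Module A M] [Module K M] [IsScalarTower K A M]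

/-- The average `∑ β(s_i) π β(t_i)` of an endomorphism `π` for `z = ∑ s_i ⊗ t_i`. -/
def average (β : B →ₐ[K] Module.End A M) (π : Module.End A M) :
    B ⊗[K] B →ₗ[K] Module.End A M :=
  TensorProduct.lift (LinearMap.mk₂ K (fun s t ↦ β s * π * β t)
    (fun _ _ _ ↦ by rw [map_add, add_mul, add_mul])
    (fun _ _ _ ↦ by rw [map_smul, smul_mul_assoc, smul_mul_assoc])
    (fun _ _ _ ↦ by rw [map_add, mul_add])
    (fun _ _ _ ↦ by rw [map_smul, mul_smul_comm]))

@[simp] lemma average_tmul (β : B →ₐ[K] Module.End A M) (π : Module.End A M) (s t : B) :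
    average β π (s ⊗ₜ t) = β s * π * β t := rfl

variable (β : B →ₐ[K] Module.End A M) (π : Module.End A M)

lemma mul_average (b : B) (z : B ⊗[K] B) : β b * average β π z = average β π ((b ⊗ₜ 1) * z) := by
  induction z with
  | zero => simp
  | add x y hx hy => rw [map_add, mul_add, hx, hy, mul_add, map_add]
  | tmul s t => simp [mul_assoc]

lemma average_mul (b : B) (z : B ⊗[K] B) : average β π z * β b = average β π ((1 ⊗ₜ b) * z) := by
  induction z with
  | zero => simp
  | add x y hx hy => rw [map_add, add_mul, hx, hy, mul_add, map_add]
  | tmul s t => simp [mul_assoc, mul_comm b]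

lemma average_mem {P : Submodule A M} (hP : ∀ b, ∀ m ∈ P, β b m ∈ P) (hπ : ∀ m, π m ∈ P)
    (z : B ⊗[K] B) (m : M) : average β π z m ∈ P := by
  induction z with
  | zero => simp
  | add x y hx hy => rw [map_add]; exact P.add_mem hx hy
  | tmul s t => exact hP _ _ (hπ _)

lemma average_apply_of_mem {P : Submodule A M} (hP : ∀ b, ∀ m ∈ P, β b m ∈ P)
    (hπ : ∀ m ∈ P, π m = m) (z : B ⊗[K] B) {m : M} (hm : m ∈ P) :
    average β π z m = β (Algebra.TensorProduct.lmul' K z) m := by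
  induction z with
  | zero => simp
  | add x y hx hy => rw [map_add, map_add, map_add, LinearMap.add_apply, hx, hy]; rfl
  | tmul s t =>
    rw [average_tmul, Module.End.mul_apply, Module.End.mul_apply, hπ _ (hP _ _ hm),
      Algebra.TensorProduct.lmul'_apply_tmul, map_mul, Module.End.mul_apply]

/-- A submodule with projective quotient stable under an unramified algebra is the range
of an equivariant projector. -/
theorem exists_equivariant_projector [Algebra.FormallyUnramified K B] [Algebra.EssFiniteType K B]
    (P : Submodule A M) (hP : ∀ b, ∀ m ∈ P, β b m ∈ P) [Module.Projective A (M ⧸ P)] :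
    ∃ e : Module.End A M, e * e = e ∧ LinearMap.range e = P ∧ ∀ b, Commute e (β b) := by
  obtain ⟨s, hs⟩ := Module.projective_lifting_property P.mkQ LinearMap.id P.mkQ_surjective
  let π : Module.End A M := 1 - s ∘ₗ P.mkQ
  have hπ : ∀ m, π m ∈ P := fun m ↦ by
    rw [← Submodule.ker_mkQ P, LinearMap.mem_ker]
    have := LinearMap.congr_fun hs (P.mkQ m)
    simp only [LinearMap.comp_apply, LinearMap.id_apply] at this
    simp only [π, LinearMap.sub_apply, map_sub, LinearMap.comp_apply, this, Module.End.one_apply,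
      sub_self]
  have hπ' : ∀ m ∈ P, π m = m := fun m hm ↦ by
    have : P.mkQ m = 0 := by rwa [← LinearMap.mem_ker, Submodule.ker_mkQ]
    simp [π, this]
  -- The separability element: its product is `1`, so averaging preserves the identity on `P`, and
  -- `(b ⊗ 1) z = (1 ⊗ b) z`, so the average commutes with `B`.
  let z := Algebra.FormallyUnramified.elem K B
  have h1 : ∀ m, average β π z m ∈ P := average_mem β π hP hπ z
  have h2 : ∀ m ∈ P, average β π z m = m := fun m hm ↦ by
    rw [average_apply_of_mem β π hP hπ' z hm, Algebra.FormallyUnramified.lmul_elem, map_one]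
    rfl
  refine ⟨average β π z, ?_, ?_, fun b ↦ ?_⟩
  · ext m
    exact h2 _ (h1 m)
  · apply le_antisymm
    · rintro _ ⟨m, rfl⟩
      exact h1 m
    · intro m hm
      exact ⟨m, h2 m hm⟩
  · rw [commute_iff_eq, mul_average, average_mul, Algebra.FormallyUnramified.one_tmul_mul_elem]

end Average

-- A finite reduced algebra is a product of finite field extensions, and these are separable over a
-- perfect field.
attribute [local instance] Ideal.Quotient.field in
lemma formallyEtale_of_isReduced (K B : Type) [Field K] [PerfectField K] [CommRing B] [Algebra K B]
    [Module.Finite K B] [IsReduced B] : Algebra.FormallyEtale K B := by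
  have : IsArtinianRing B := .of_finite K B
  have (I : MaximalSpectrum B) : Algebra.FormallyEtale K (B ⧸ I.asIdeal) :=
    Algebra.FormallyEtale.of_isSeparable K (B ⧸ I.asIdeal)
  exact Algebra.FormallyEtale.of_equiv (R := K) (A := ∀ I : MaximalSpectrum B, B ⧸ I.asIdeal)
    ((IsArtinianRing.equivPi B).restrictScalars K).symm

end PolarizedIsocrystal

namespace PolarizedIsocrystal

/-! ### The scheme of Lagrangian idempotents -/

section Idempotent

variable {K C : Type*} [Field K] [CommRing C] [Algebra K C] (ι : C →ₐ[K] C)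

/-- Idempotents `e` of `A ⊗ C` with `e + ι(e) = 1`. -/
def IsLagrangianIdempotent {A : Type*} [CommRing A] [Algebra K A] (e : A ⊗[K] C) : Prop :=
  e * e = e ∧ e + Algebra.TensorProduct.map (AlgHom.id A A) ι e = 1

variable {A A' : Type*} [CommRing A] [Algebra K A] [CommRing A'] [Algebra K A']

lemma map_map_involution (f : A →ₐ[K] A') (x : A ⊗[K] C) :
    Algebra.TensorProduct.map (AlgHom.id A' A') ι (Algebra.TensorProduct.map f (AlgHom.id K C) x) =
    Algebra.TensorProduct.map f (AlgHom.id K C) (Algebra.TensorProduct.map (AlgHom.id A A) ι x) := by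
  induction x with
  | zero => simp
  | add a b ha hb => simp only [map_add, ha, hb]
  | tmul a c => simp

variable {ι} in
lemma IsLagrangianIdempotent.map {e : A ⊗[K] C} (he : IsLagrangianIdempotent ι e)
    (f : A →ₐ[K] A') :
    IsLagrangianIdempotent ι (Algebra.TensorProduct.map f (AlgHom.id K C) e) := by
  refine ⟨?_, ?_⟩
  · rw [← map_mul, he.1]
  · rw [map_map_involution, ← map_add, he.2, map_one]

lemma basis_repr_map {n : Type*} (c : Basis n K C) (f : A →ₐ[K] A') (x : A ⊗[K] C) (i : n) :
    (Algebra.TensorProduct.basis A' c).repr (Algebra.TensorProduct.map f (AlgHom.id K C) x) i =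
      f ((Algebra.TensorProduct.basis A c).repr x i) := by
  induction x with
  | zero => simp
  | add a b ha hb => simp only [map_add, Finsupp.add_apply, ha, hb]
  | tmul a c => simp [Algebra.TensorProduct.basis_repr_tmul]

/-- Lagrangian idempotents are represented by an algebra of finite type. -/
theorem exists_universal_idempotent (K C : Type) [Field K] [CommRing C] [Algebra K C]
    [Module.Finite K C] (ι : C →ₐ[K] C) :
    ∃ (E : Type) (_ : CommRing E) (_ : Algebra K E) (w : E ⊗[K] C), Algebra.FiniteType K E ∧
      IsLagrangianIdempotent ι w ∧
      (∀ (A : Type) [CommRing A] [Algebra K A] (e : A ⊗[K] C), IsLagrangianIdempotent ι e →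
        ∃ φ : E →ₐ[K] A, Algebra.TensorProduct.map φ (AlgHom.id K C) w = e) ∧
      (∀ (A : Type) [CommRing A] [Algebra K A] (φ φ' : E →ₐ[K] A),
        Algebra.TensorProduct.map φ (AlgHom.id K C) w =
          Algebra.TensorProduct.map φ' (AlgHom.id K C) w → φ = φ') := by
  classical
  let c := Module.finBasis K C
  let n := Fin (finrank K C)
  let P := MvPolynomial n K
  let bP := Algebra.TensorProduct.basis P c
  let g : P ⊗[K] C := ∑ i : n, (MvPolynomial.X i : P) • bP i
  let x := g * g - g
  let y := g + Algebra.TensorProduct.map (AlgHom.id P P) ι g - 1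
  -- Here `g` is the generic element of `C`, with indeterminate coordinates. The ideal is generated
  -- by the coordinates of the two defining equations.
  let I : Ideal P := Ideal.span (Set.range (bP.repr x) ∪ Set.range (bP.repr y))
  let mk : P →ₐ[K] P ⧸ I := Ideal.Quotient.mkₐ K I
  have hzero : ∀ z : P ⊗[K] C, (∀ i, bP.repr z i ∈ I) →
      Algebra.TensorProduct.map mk (AlgHom.id K C) z = 0 := by
    intro z hz
    apply (Algebra.TensorProduct.basis (P ⧸ I) c).repr.injective
    ext i
    rw [basis_repr_map]
    simpa [mk] using Ideal.Quotient.eq_zero_iff_mem.2 (hz i)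
  have hx := hzero x fun i ↦ Ideal.subset_span (.inl ⟨i, rfl⟩)
  have hy := hzero y fun i ↦ Ideal.subset_span (.inr ⟨i, rfl⟩)
  have hg : ∀ (A : Type) [CommRing A] [Algebra K A] (f : P →ₐ[K] A) (i : n),
      (Algebra.TensorProduct.basis A c).repr (Algebra.TensorProduct.map f (AlgHom.id K C) g) i =
        f (MvPolynomial.X i) := by
    intro A _ _ f i
    rw [basis_repr_map]
    congr 1
    change bP.repr g i = _
    simp only [g, map_sum, map_smul, Basis.repr_self, Finsupp.coe_finsetSum, Finset.sum_apply,
      Finsupp.smul_apply, Finsupp.single_apply, smul_eq_mul, mul_ite, mul_one, mul_zero]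
    exact (Finset.sum_ite_eq' _ i _).trans (if_pos (Finset.mem_univ i))
  have hcomp : ∀ (A : Type) [CommRing A] [Algebra K A] (φ : (P ⧸ I) →ₐ[K] A) (z : P ⊗[K] C),
      Algebra.TensorProduct.map φ (AlgHom.id K C)
        (Algebra.TensorProduct.map mk (AlgHom.id K C) z) =
      Algebra.TensorProduct.map (φ.comp mk) (AlgHom.id K C) z := by
    intro A _ _ φ z
    induction z with
    | zero => simp
    | add a b ha hb => simp only [map_add, ha, hb]
    | tmul a c => simp
  refine ⟨P ⧸ I, inferInstance, inferInstance, Algebra.TensorProduct.map mk (AlgHom.id K C) g,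
    inferInstance, ⟨?_, ?_⟩, fun A _ _ e he ↦ ?_, fun A _ _ φ φ' h ↦ ?_⟩
  · rw [← sub_eq_zero, ← map_mul, ← map_sub]
    exact hx
  · rw [← sub_eq_zero, map_map_involution, ← map_add, ← map_one (Algebra.TensorProduct.map mk
      (AlgHom.id K C)), ← map_sub]
    exact hy
  · let bA := Algebra.TensorProduct.basis A c
    let f : P →ₐ[K] A := MvPolynomial.aeval fun i ↦ bA.repr e i
    have hf : Algebra.TensorProduct.map f (AlgHom.id K C) g = e := by
      apply bA.repr.injective
      ext i
      rw [hg]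
      exact MvPolynomial.aeval_X _ i
    have hI : ∀ a ∈ I, f a = 0 := by
      intro a ha
      change a ∈ RingHom.ker f
      refine Ideal.span_le.2 ?_ ha
      rintro _ (⟨i, rfl⟩ | ⟨i, rfl⟩)
      · change f _ = 0
        rw [← basis_repr_map c f, map_sub, map_mul, hf, he.1, sub_self]
        simp
      · change f _ = 0
        rw [← basis_repr_map c f, map_sub, map_add, ← map_map_involution, hf, he.2, map_one,
          sub_self]
        simp
    refine ⟨Ideal.Quotient.liftₐ I f hI, ?_⟩
    rw [hcomp]
    convert hf using 2
    exact congrArg (Algebra.TensorProduct.map · (AlgHom.id K C))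
      (Ideal.Quotient.liftₐ_comp I f hI)
  · apply Ideal.Quotient.algHom_ext
    apply MvPolynomial.algHom_ext
    intro i
    rw [hcomp, hcomp] at h
    rw [← hg A (φ.comp mk), h, hg A (φ'.comp mk)]

/-- Two points agreeing modulo a square-zero ideal give idempotents of the commutative ring `A ⊗ C`
whose difference has square zero, and such idempotents coincide. -/
lemma formallyUnramified_of_universal_idempotent {K C E : Type} [Field K] [CommRing C] [Algebra K C]
    [Module.Finite K C] (ι : C →ₐ[K] C) [CommRing E] [Algebra K E] {w : E ⊗[K] C}
    (hw : IsLagrangianIdempotent ι w)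
    (hinj : ∀ (A : Type) [CommRing A] [Algebra K A] (φ φ' : E →ₐ[K] A),
        Algebra.TensorProduct.map φ (AlgHom.id K C) w =
          Algebra.TensorProduct.map φ' (AlgHom.id K C) w → φ = φ') :
    Algebra.FormallyUnramified K E := by
  rw [Algebra.FormallyUnramified.iff_comp_injective]
  intro A _ _ I hI φ φ' h
  apply hinj
  let c := Module.finBasis K C
  let b := Algebra.TensorProduct.basis A c
  let x := Algebra.TensorProduct.map φ (AlgHom.id K C) w -
    Algebra.TensorProduct.map φ' (AlgHom.id K C) w
  have hx : ∀ i, b.repr x i ∈ I := by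
    intro i
    rw [map_sub, Finsupp.sub_apply, basis_repr_map, basis_repr_map, ← Ideal.Quotient.eq]
    exact AlgHom.congr_fun h _
  refine eq_of_isNilpotent_sub_of_isIdempotentElem (hw.map φ).1 (hw.map φ').1 ⟨2, ?_⟩
  change x ^ 2 = 0
  rw [pow_two, ← b.sum_repr x, Finset.sum_mul_sum]
  refine Finset.sum_eq_zero fun i _ ↦ Finset.sum_eq_zero fun j _ ↦ ?_
  have : b.repr x i * b.repr x j = 0 := by
    rw [← Ideal.mem_bot, ← hI, pow_two]
    exact Ideal.mul_mem_mul (hx i) (hx j)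
  rw [smul_mul_smul_comm, this, zero_smul]

end Idempotent

/-! ### The action of the centralizer -/

section Action

variable {K N C : Type} [Field K] [AddCommGroup N] [Module K N] [FiniteDimensional K N]
  [CommRing C] [Algebra K C] (j : C →ₐ[K] Module.End K N)

/-- The action of `A ⊗ C` on `A ⊗ N`. -/
def act (A : Type) [CommRing A] [Algebra K A] : A ⊗[K] C →ₐ[A] Module.End A (A ⊗[K] N) :=
  Algebra.TensorProduct.lift (Algebra.ofId A _) ((Module.End.baseChangeHom K A N).comp j)
    fun r _ ↦ Algebra.commute_algebraMap_left r _

variable {A A' : Type} [CommRing A] [Algebra K A] [CommRing A'] [Algebra K A']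

omit [FiniteDimensional K N] in
@[simp] lemma act_tmul (r s : A) (a : C) (n : N) :
    act j A (r ⊗ₜ a) (s ⊗ₜ n) = (r * s) ⊗ₜ j a n := by
  change (r • (j a).baseChange A) (s ⊗ₜ n) = _
  simp [TensorProduct.smul_tmul']

omit [FiniteDimensional K N] in
lemma act_map (f : A →ₐ[K] A') (e : A ⊗[K] C) (x : A ⊗[K] N) :
    act j A' (Algebra.TensorProduct.map f (AlgHom.id K C) e)
      (TensorProduct.map f.toLinearMap LinearMap.id x) =
    TensorProduct.map f.toLinearMap LinearMap.id (act j A e x) := by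
  induction x with
  | zero => simp
  | add a b ha hb => simp only [map_add, ha, hb]
  | tmul r n =>
    induction e with
    | zero => simp
    | add a b ha hb => simp only [map_add, LinearMap.add_apply, ha, hb]
    | tmul s c => simp

omit [FiniteDimensional K N] in
lemma range_act_map (f : A →ₐ[K] A') (e : A ⊗[K] C) :
    LinearMap.range (act j A' (Algebra.TensorProduct.map f (AlgHom.id K C) e)) =
      Submodule.span A' (TensorProduct.map f.toLinearMap (LinearMap.id (R := K) (M := N)) ''
          (LinearMap.range (act j A e) : Set (A ⊗[K] N))) := by
  apply le_antisymm
  · rintro _ ⟨x, rfl⟩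
    induction x with
    | zero => simp
    | add a b ha hb => rw [map_add]; exact add_mem ha hb
    | tmul r n =>
      have h1 : r ⊗ₜ[K] n = r • TensorProduct.map f.toLinearMap LinearMap.id ((1 : A) ⊗ₜ[K] n) := by
        simp [TensorProduct.smul_tmul']
      rw [h1, map_smul, act_map]
      exact Submodule.smul_mem _ _ (Submodule.subset_span ⟨_, ⟨_, rfl⟩, rfl⟩)
  · rw [Submodule.span_le]
    rintro _ ⟨_, ⟨x, rfl⟩, rfl⟩
    exact ⟨_, act_map j f e x⟩

omit [FiniteDimensional K N] in
lemma act_adjoint {ψ : LinearMap.BilinForm K N} {ι : C →ₐ[K] C}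
    (hι : ∀ c x y, ψ (j c x) y = ψ x (j (ι c) y)) (e : A ⊗[K] C) (x y : A ⊗[K] N) :
    ψ.baseChange A (act j A e x) y =
      ψ.baseChange A x (act j A (Algebra.TensorProduct.map (AlgHom.id A A) ι e) y) := by
  induction e with
  | zero => simp
  | add a b ha hb => simp only [map_add, LinearMap.add_apply, ha, hb]
  | tmul a c =>
    induction x with
    | zero => simp
    | add a b ha hb => simp only [map_add, LinearMap.add_apply, ha, hb]
    | tmul r m =>
      induction y with
      | zero => simp
      | add a b ha hb => simp only [map_add, ha, hb]
      | tmul s m' =>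
        simp [hι]
        ring_nf

instance : Module.FinitePresentation K N := Module.finitePresentation_of_finite K N

lemma act_eq (e : A ⊗[K] C) : act j A e =
    (Module.FinitePresentation.isBaseChange_map K N N A).equiv
      (j.toLinearMap.lTensor A e) := by
  induction e with
  | zero => simp
  | add a b ha hb => simp only [map_add, ha, hb]
  | tmul a c =>
    rw [LinearMap.lTensor_tmul, IsBaseChange.equiv_tmul]
    rfl

variable {j}

lemma act_injective (hj : Function.Injective j) : Function.Injective (act j A) := by
  intro x y h
  rw [act_eq, act_eq] at h
  exact Module.Flat.lTensor_preserves_injective_linearMap (M := A) j.toLinearMap hj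
    ((Module.FinitePresentation.isBaseChange_map K N N A).equiv.injective h)

/-- The commutant of `u` is the kernel of `f ↦ f u - u f`, and formation of kernels commutes with
the flat base change from `K` to `A`. -/
lemma exists_act_eq {u : Module.End K N} (hju : ∀ f, Commute f u ↔ ∃ c, j c = f)
    {f : Module.End A (A ⊗[K] N)} (hf : Commute f (u.baseChange A)) : ∃ e, act j A e = f := by
  let φ := (Module.FinitePresentation.isBaseChange_map K N N A).equiv
  obtain ⟨y, rfl⟩ := φ.surjective f
  let δ : Module.End K N →ₗ[K] Module.End K N := LinearMap.mulRight K u - LinearMap.mulLeft K u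
  have hex : Function.Exact j.toLinearMap δ := by
    intro f
    change f * u - u * f = 0 ↔ _
    rw [sub_eq_zero]
    exact hju f
  have hφ : φ (δ.lTensor A y) = φ y * u.baseChange A - u.baseChange A * φ y := by
    clear hf
    induction y with
    | zero =>
      rw [map_zero, map_zero, zero_mul, mul_zero]
      exact (sub_zero (G := A ⊗[K] N →ₗ[A] A ⊗[K] N) 0).symm
    | add a b ha hb => simp only [map_add, ha, hb, add_mul, mul_add]; abel
    | tmul a g =>
      rw [LinearMap.lTensor_tmul, IsBaseChange.equiv_tmul, IsBaseChange.equiv_tmul]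
      apply TensorProduct.AlgebraTensorModule.curry_injective
      ext n
      simp [δ, smul_sub]
  rw [hf.eq] at hφ
  replace hφ := φ.injective ((hφ.trans (sub_self (G := A ⊗[K] N →ₗ[A] A ⊗[K] N) _)).trans (map_zero φ).symm)
  obtain ⟨e, he⟩ := (Module.Flat.lTensor_exact A hex _).1 hφ
  exact ⟨e, by rw [act_eq, he]⟩

end Action

/-! ### Equivariant projectors -/

section Projector

open scoped IsMulCommutative

variable {K V : Type} [Field K] [CharZero K] [AddCommGroup V] [Module K V] [FiniteDimensional K V]
  {u : Module.End K V} {A M : Type*} [CommRing A] [Algebra K A] [AddCommGroup M] [Module A M]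
  [Module K M] [IsScalarTower K A M]

/-- Elements of `K[u]` commute with `u`, so `hred` makes `K[u]` reduced, hence étale in
characteristic zero. Any projector onto `P` can then be averaged over `K[u]`. -/
theorem exists_commuting_projector (hred : ∀ f, Commute f u → f * f = 0 → f = 0)
    (β : Module.End K V →ₐ[K] Module.End A M) (P : Submodule A M) [Module.Projective A (M ⧸ P)]
    (hP : ∀ m ∈ P, β u m ∈ P) :
    ∃ e : Module.End A M, e * e = e ∧ LinearMap.range e = P ∧ Commute e (β u) := by
  let B := Algebra.adjoin K {u}
  have hB : ∀ b : B, Commute b.1 u := fun b ↦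
    congrArg Subtype.val (mul_comm b ⟨u, Algebra.subset_adjoin rfl⟩)
  have : IsReduced B := by
    rw [isReduced_iff_pow_one_lt 2 one_lt_two]
    intro x hx
    rw [pow_two] at hx
    exact Subtype.ext (hred _ (hB x) (congrArg Subtype.val hx))
  have : Algebra.FormallyEtale K B := formallyEtale_of_isReduced K B
  have hst : ∀ b : B, ∀ m ∈ P, β b m ∈ P := by
    rintro ⟨b, hb⟩
    change ∀ m ∈ P, β b m ∈ P
    induction hb using Algebra.adjoin_induction with
    | mem x hx => rw [Set.mem_singleton_iff.1 hx]; exact hP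
    | algebraMap r =>
      intro m hm
      rw [AlgHom.commutes, Module.algebraMap_end_apply]
      exact P.smul_of_tower_mem r hm
    | add x y _ _ hx hy =>
      intro m hm
      rw [map_add]
      exact P.add_mem (hx m hm) (hy m hm)
    | mul x y _ _ hx hy =>
      intro m hm
      rw [map_mul]
      exact hx _ (hy m hm)
  obtain ⟨e, h1, h2, h3⟩ := exists_equivariant_projector (β.comp B.val) P hst
  exact ⟨e, h1, h2, h3 ⟨u, Algebra.subset_adjoin rfl⟩⟩

end Projector

/-! ### The fixed point scheme -/

section FixedPoints

variable {K N C : Type} [Field K] [CharZero K] [AddCommGroup N] [Module K N]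
  [FiniteDimensional K N] [CommRing C] [Algebra K C] {j : C →ₐ[K] Module.End K N}
  {ψ : LinearMap.BilinForm K N} {u : Module.End K N} {ι : C →ₐ[K] C} {d : ℕ}
  {A : Type} [CommRing A] [Algebra K A]

omit [CharZero K] in
lemma exists_fixedPoints_of_idempotent (hψ : ψ.Nondegenerate) (hψ' : ψ.IsAlt)
    (hd : finrank K N = 2 * d) (hju : ∀ f, Commute f u ↔ ∃ c, j c = f)
    (hι : ∀ c x y, ψ (j c x) y = ψ x (j (ι c) y)) (hu : Function.Surjective u)
    {e : A ⊗[K] C} (he : IsLagrangianIdempotent ι e) :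
    ∃ F : fixedPoints d ψ u A, F.1.toSubmodule = LinearMap.range (act j A e) := by
  have hee : act j A e * act j A e = act j A e := by rw [← map_mul, he.1]
  have hsum : act j A e + act j A (Algebra.TensorProduct.map (AlgHom.id A A) ι e) = 1 := by
    rw [← map_add, he.2, map_one]
  refine ⟨⟨⟨LinearMap.range (act j A e), inferInstance, projective_quotient_range hee,
    rankAtStalk_quotient_range hψ hψ' hd hee (act_adjoint j hι e) hsum⟩, ?_, ?_⟩, rfl⟩
  · exact orthogonal_range_eq (baseChange_nondegenerate hψ hψ' A).2 hee (act_adjoint j hι e) hsum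
  · change (LinearMap.range (act j A e)).map (u.baseChange A) = LinearMap.range (act j A e)
    have hs : LinearMap.range (u.baseChange A) = ⊤ :=
      LinearMap.range_eq_top.2 (LinearMap.baseChange_surjective A hu)
    obtain ⟨c, hc⟩ := (hju u).1 (Commute.refl u)
    have : u.baseChange A = act j A (1 ⊗ₜ c) := by
      apply TensorProduct.AlgebraTensorModule.curry_injective
      ext n
      simp [hc]
    -- As `u` lies in the commutative image of `A ⊗ C`, it commutes with the projector; being onto,
    -- it carries the range onto itself.
    rw [← LinearMap.range_comp, ← Module.End.mul_eq_comp, this, ← map_mul, mul_comm, map_mul,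
      ← this, Module.End.mul_eq_comp, LinearMap.range_comp, hs, Submodule.map_top]

/-- An equivariant projector onto the fixed Lagrangian comes from some `e` in `A ⊗ C`. The kernel of
its adjoint is the orthogonal of its range, which is the range itself, that is, the kernel of `1 -
e`; commuting idempotents with equal kernels agree. -/
lemma exists_idempotent_of_fixedPoints (hψ : ψ.Nondegenerate) (hψ' : ψ.IsAlt)
    (hj : Function.Injective j) (hju : ∀ f, Commute f u ↔ ∃ c, j c = f)
    (hι : ∀ c x y, ψ (j c x) y = ψ x (j (ι c) y))
    (hred : ∀ f, Commute f u → f * f = 0 → f = 0) (F : fixedPoints d ψ u A) :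
    ∃ e : A ⊗[K] C, IsLagrangianIdempotent ι e ∧
      F.1.toSubmodule = LinearMap.range (act j A e) := by
  obtain ⟨⟨π, hππ, hπF, hπu⟩⟩ : Nonempty {π : Module.End A (A ⊗[K] N) // π * π = π ∧
      LinearMap.range π = F.1.toSubmodule ∧ Commute π (u.baseChange A)} := by
    obtain ⟨π, h⟩ := exists_commuting_projector hred (Module.End.baseChangeHom K A N)
      F.1.toSubmodule fun m hm ↦ F.2.2 ▸ Submodule.mem_map_of_mem hm
    exact ⟨π, h⟩
  obtain ⟨e, rfl⟩ := exists_act_eq hju hπu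
  have hinj := act_injective (A := A) hj
  have hadj := act_adjoint (A := A) j hι e
  have hee : e * e = e := hinj (by rw [map_mul, hππ])
  let e' := Algebra.TensorProduct.map (AlgHom.id A A) ι e
  refine ⟨e, ⟨hee, ?_⟩, hπF.symm⟩
  suffices act j A e' = act j A (1 - e) by
    change e + e' = 1
    rw [hinj this, add_sub_cancel]
  have hsub : act j A (1 - e) = 1 - act j A e := by rw [map_sub, map_one]
  apply idempotent_eq_of_ker_eq
  · rw [← map_mul]
    congr 1
    exact (map_mul (Algebra.TensorProduct.map (AlgHom.id A A) ι) e e).symm.trans (by rw [hee])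
  · rw [← map_mul, (IsIdempotentElem.one_sub (a := e) hee).eq]
  · rw [commute_iff_eq, ← map_mul, ← map_mul, mul_comm]
  · intro m
    trans m ∈ (ψ.baseChange A).orthogonal F.1.toSubmodule
    · rw [LinearMap.BilinForm.mem_orthogonal_iff, ← hπF]
      constructor
      · rintro h _ ⟨x, rfl⟩
        rw [hadj, h, map_zero]
      · intro h
        refine (baseChange_nondegenerate hψ hψ' A).2 _ fun x ↦ ?_
        rw [← hadj]
        exact h _ ⟨x, rfl⟩
    · rw [F.2.1, hsub, LinearMap.sub_apply, sub_eq_zero, ← hπF]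
      constructor
      · rintro ⟨x, rfl⟩
        exact (LinearMap.congr_fun hππ x).symm
      · intro h
        exact ⟨m, h.symm⟩

/-- A Lagrangian fixed by `u` and its idempotent determine each other, since the idempotents commute
and have equal range only when equal. The representing algebra is unramified of finite type over a
field, hence finite and étale. -/
theorem exists_finite_etale_of_action (hψ : ψ.Nondegenerate) (hψ' : ψ.IsAlt)
    (hd : finrank K N = 2 * d) [Module.Finite K C] (hj : Function.Injective j)
    (hju : ∀ f, Commute f u ↔ ∃ c, j c = f)
    (hι : ∀ c x y, ψ (j c x) y = ψ x (j (ι c) y)) (hu : Function.Surjective u)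
    (hred : ∀ f, Commute f u → f * f = 0 → f = 0) :
    FixedPointsDiscreteMultiplicityOne d ψ u := by
  obtain ⟨E, _, _, w, hft, hw, hex, huniq⟩ := exists_universal_idempotent K C ι
  have : Algebra.FormallyUnramified K E := formallyUnramified_of_universal_idempotent ι hw huniq
  have : Algebra.FormallyEtale K E := .of_formallyUnramified_of_field K E
  refine ⟨E, _, _, Algebra.FormallyUnramified.finite_of_free K E,
    ⟨inferInstance, Algebra.FinitePresentation.of_finiteType.1 hft⟩, ?_⟩
  choose F hF using fun (A : CommAlgCat.{0} K) (φ : E →ₐ[K] A) ↦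
    exists_fixedPoints_of_idempotent hψ hψ' hd hju hι hu (hw.map φ)
  refine ⟨fun A ↦ Equiv.ofBijective (F A) ⟨fun φ φ' h ↦ huniq A φ φ' ?_, fun G ↦ ?_⟩,
    fun A B f φ ↦ ?_⟩
  · apply act_injective (A := A) hj
    refine idempotent_eq_of_range_eq ?_ ?_ ?_ ?_
    · rw [← map_mul, (hw.map φ).1]
    · rw [← map_mul, (hw.map φ').1]
    · rw [commute_iff_eq, ← map_mul, ← map_mul, mul_comm]
    · rw [← hF, ← hF, h]
  · obtain ⟨e, he, hG⟩ := exists_idempotent_of_fixedPoints hψ hψ' hj hju hι hred G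
    obtain ⟨φ, rfl⟩ := hex A e he
    exact ⟨φ, Subtype.ext (Module.Grassmannian.ext ((hF A φ).trans hG.symm))⟩
  · change (F B (f.comp φ)).1.toSubmodule = Submodule.span B (_ '' ((F A φ).1.toSubmodule : Set (A ⊗[K] N)))
    rw [hF, hF, ← range_act_map, ← AlgHom.comp_apply, ← Algebra.TensorProduct.map_comp,
      AlgHom.comp_id]

open scoped IsMulCommutative in
/-- If the centralizer of a similitude `u` is commutative and reduced, then the scheme of
Lagrangian subspaces fixed by `u` is finite étale. -/
theorem fixedPointsDiscreteMultiplicityOne (hψ : ψ.Nondegenerate) (hψ' : ψ.IsAlt)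
    (hd : finrank K N = 2 * d) {c : K} (hc : c ≠ 0) (hu : ∀ x y, ψ (u x) (u y) = c * ψ x y)
    (hcomm : ∀ f g, Commute f u → Commute g u → Commute f g)
    (hred : ∀ f, Commute f u → f * f = 0 → f = 0) :
    FixedPointsDiscreteMultiplicityOne d ψ u := by
  have hinj : Function.Injective u := by
    rw [injective_iff_map_eq_zero]
    intro x hx
    refine hψ.1 x fun y ↦ (mul_eq_zero.1 ?_).resolve_left hc
    rw [← hu, hx, map_zero, LinearMap.zero_apply]
  have hsurj : Function.Surjective u := LinearMap.injective_iff_surjective.1 hinj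
  let C := Subalgebra.centralizer K {u}
  have hC : ∀ f, f ∈ C ↔ Commute f u := fun f ↦ by
    rw [Subalgebra.mem_centralizer_iff]
    exact ⟨fun h ↦ (h u rfl).symm, fun h g hg ↦ by rw [Set.mem_singleton_iff.1 hg]; exact h.eq.symm⟩
  have : IsMulCommutative C := ⟨⟨fun a b ↦ Subtype.ext
    (hcomm a b ((hC _).1 a.2) ((hC _).1 b.2))⟩⟩
  let adj := ψ.leftAdjointOfNondegenerate hψ
  have hadj : ∀ f x y, ψ (adj f x) y = ψ x (f y) := fun f ↦
    ψ.isAdjointPairLeftAdjointOfNondegenerate hψ f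
  have hadj' : ∀ f x y, ψ (f x) y = ψ x (adj f y) := fun f x y ↦ by
    rw [← hψ'.neg_eq, ← hadj, hψ'.neg_eq]
  have huniq : ∀ f g : Module.End K N, (∀ x y, ψ x (f y) = ψ x (g y)) → f = g := fun f g h ↦ by
    ext y
    refine sub_eq_zero.1 (hψ.2 _ fun x ↦ ?_)
    rw [map_sub, h, sub_self]
  have hadju : ∀ f, Commute f u → Commute (adj f) u := fun f hf ↦ by
    refine (huniq _ _ fun x y ↦ ?_ : adj f * u = u * adj f)
    obtain ⟨x, rfl⟩ := hsurj x
    rw [Module.End.mul_apply, Module.End.mul_apply, ← hadj', hu, ← hadj',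
      ← Module.End.mul_apply, hf.eq, Module.End.mul_apply, hu]
  -- Taking adjoints preserves the commutant because `u` is a similitude, and it is multiplicative
  -- there, not merely antimultiplicative, because the commutant is commutative.
  let ι : C →ₐ[K] C :=
    { toFun := fun f ↦ ⟨adj f, (hC _).2 (hadju _ ((hC _).1 f.2))⟩
      map_one' := Subtype.ext (huniq _ _ fun x y ↦ (hadj' 1 x y).symm)
      map_zero' := Subtype.ext (huniq _ _ fun x y ↦ by
        rw [← hadj']
        simp)
      map_mul' := fun f g ↦ Subtype.ext (huniq _ _ fun x y ↦ by
        rw [mul_comm f g, ← hadj']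
        change ψ (g.1 (f.1 x)) y = ψ x (adj f.1 (adj g.1 y))
        rw [hadj', hadj'])
      map_add' := fun f g ↦ Subtype.ext (huniq _ _ fun x y ↦ by
        rw [← hadj']
        change ψ (f.1 x + g.1 x) y = ψ x (adj f.1 y + adj g.1 y)
        rw [map_add, map_add, LinearMap.add_apply, hadj', hadj'])
      commutes' := fun r ↦ Subtype.ext (huniq _ _ fun x y ↦ by
        rw [← hadj']
        change ψ (r • x) y = ψ x (r • y)
        rw [map_smul, map_smul, LinearMap.smul_apply]) }
  exact exists_finite_etale_of_action (C := C) (j := C.val) (ι := ι) hψ hψ' hd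
    Subtype.val_injective (fun f ↦ ⟨fun h ↦ ⟨⟨f, (hC f).2 h⟩, rfl⟩, fun ⟨c, h⟩ ↦ h ▸ (hC _).1 c.2⟩)
    (fun f x y ↦ hadj' f.1 x y) hsurj hred

end FixedPoints

end PolarizedIsocrystal

namespace PolarizedIsocrystal

/-! ### Base change of subspaces -/

section BaseChange

variable {K N L : Type} [Field K] [AddCommGroup N] [Module K N] [Field L] [Algebra K L]

lemma mem_baseChange_iff (P : Submodule K N) (x : L ⊗[K] N) :
    x ∈ P.baseChange L ↔ ∃ y, P.subtype.baseChange L y = x := Iff.rfl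

lemma baseChange_apply_mem {P Q : Submodule K N} {e : Module.End K N} (h : ∀ n ∈ P, e n ∈ Q)
    {x : L ⊗[K] N} (hx : x ∈ P.baseChange L) : e.baseChange L x ∈ Q.baseChange L := by
  obtain ⟨y, rfl⟩ := (mem_baseChange_iff P x).1 hx
  induction y with
  | zero => simp
  | add a b ha hb => rw [map_add, map_add]; exact add_mem (ha ⟨_, rfl⟩) (hb ⟨_, rfl⟩)
  | tmul a n => exact Submodule.tmul_mem_baseChange_of_mem a (h _ n.2)

lemma baseChange_apply_eq {P : Submodule K N} {e : Module.End K N} (h : ∀ n ∈ P, e n = n)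
    {x : L ⊗[K] N} (hx : x ∈ P.baseChange L) : e.baseChange L x = x := by
  obtain ⟨y, rfl⟩ := (mem_baseChange_iff P x).1 hx
  clear hx
  induction y with
  | zero => simp
  | add a b ha hb => rw [map_add, map_add, ha, hb]
  | tmul a n => simp [h]

lemma finrank_submodule_baseChange (P : Submodule K N) :
    finrank L (P.baseChange L) = finrank K P := by
  rw [← (Submodule.toBaseChange.toLinearEquiv L P).finrank_eq, finrank_baseChange]

lemma submodule_baseChange_sup (P Q : Submodule K N) :
    (P ⊔ Q).baseChange L = P.baseChange L ⊔ Q.baseChange L := by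
  apply le_antisymm
  · rw [Submodule.baseChange_eq_span, Submodule.span_le]
    rintro _ ⟨n, hn, rfl⟩
    obtain ⟨a, ha, b, hb, rfl⟩ := Submodule.mem_sup.1 hn
    rw [map_add]
    exact Submodule.add_mem_sup (Submodule.tmul_mem_baseChange_of_mem 1 ha)
      (Submodule.tmul_mem_baseChange_of_mem 1 hb)
  · exact sup_le (Submodule.baseChange_mono L le_sup_left) (Submodule.baseChange_mono L le_sup_right)

lemma submodule_baseChange_inf [FiniteDimensional K N] (P Q : Submodule K N) :
    (P ⊓ Q).baseChange L = P.baseChange L ⊓ Q.baseChange L := by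
  apply Submodule.eq_of_le_of_finrank_eq
  · exact le_inf (Submodule.baseChange_mono L inf_le_left) (Submodule.baseChange_mono L inf_le_right)
  · have h1 := Submodule.finrank_sup_add_finrank_inf_eq P Q
    have h2 := Submodule.finrank_sup_add_finrank_inf_eq (P.baseChange L) (Q.baseChange L)
    rw [← submodule_baseChange_sup] at h2
    simp only [finrank_submodule_baseChange] at h2 ⊢
    omega

/-- A self-adjoint projector bounds the dimension of isotropic subspaces of the base change of
its range. -/
lemma two_mul_finrank_le_of_projector [FiniteDimensional K N] [CharZero K]
    {ψ : LinearMap.BilinForm K N} (hψ : ψ.Nondegenerate) (hψ' : ψ.IsAlt) {e : Module.End K N}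
    {P : Submodule K N} (he : ∀ n, e n ∈ P) (heP : ∀ n ∈ P, e n = n)
    (hadj : ∀ x y, ψ (e x) y = ψ x (e y)) (W : Submodule L (L ⊗[K] N)) (hWP : W ≤ P.baseChange L)
    (hW : ∀ x ∈ W, ∀ y ∈ W, ψ.baseChange L x y = 0) : 2 * finrank L W ≤ finrank K P := by
  have hadj' : ∀ x y, ψ.baseChange L (e.baseChange L x) y = ψ.baseChange L x (e.baseChange L y) := by
    intro x y
    induction x with
    | zero => simp
    | add a b ha hb => simp only [map_add, LinearMap.add_apply, ha, hb]
    | tmul a m =>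
      induction y with
      | zero => simp
      | add a b ha hb => simp only [map_add, ha, hb]
      | tmul b m' => simp [hadj]
  have hfix : ∀ w ∈ W, e.baseChange L w = w := fun w hw ↦ baseChange_apply_eq heP (hWP hw)
  have h1 := LinearMap.BilinForm.finrank_orthogonal (baseChange_nondegenerate hψ hψ' L) W
  have h2 := LinearMap.finrank_range_add_finrank_ker (e.baseChange L)
  have h3 : finrank L (LinearMap.range (e.baseChange L)) ≤ finrank K P := by
    rw [← finrank_submodule_baseChange (L := L) P]
    apply Submodule.finrank_mono
    rintro _ ⟨x, rfl⟩
    exact baseChange_apply_mem (P := ⊤) (fun n _ ↦ he n) (by simp)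
  have h4 := Submodule.finrank_sup_add_finrank_inf_eq W (LinearMap.ker (e.baseChange L))
  have h5 : W ⊓ LinearMap.ker (e.baseChange L) = ⊥ := by
    rw [eq_bot_iff]
    rintro x ⟨hx, hx'⟩
    rw [Submodule.mem_bot, ← hfix x hx]
    exact hx'
  -- The kernel of a self-adjoint projector is orthogonal to its range, and `W` is isotropic. The
  -- sum being direct, `dim W + dim ker e ≤ dim N - dim W`, so `2 dim W` is at most the rank of `e`.
  have h6 : W ⊔ LinearMap.ker (e.baseChange L) ≤ (ψ.baseChange L).orthogonal W := by
    refine sup_le (fun x hx y hy ↦ hW y hy x hx) fun x hx y hy ↦ ?_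
    change ψ.baseChange L y x = 0
    rw [← hfix y hy, hadj', LinearMap.mem_ker.1 hx, map_zero]
  have h7 := Submodule.finrank_mono h6
  have h8 := Submodule.finrank_le W
  rw [h5, finrank_bot] at h4
  omega

/-- Suppose that `r` is modular and strictly monotone, that `s` is supermodular and that both are
preserved by `τ`. If `r < 2 s` somewhere, then `r < 2 s` at a fixed point of `τ`. -/
lemma exists_fixed_of_modular {X : Type*} [Lattice X] {S : Set X} {τ : X → X} {r s : X → ℤ} {D : ℤ}
    (hsup : ∀ P ∈ S, ∀ Q ∈ S, P ⊔ Q ∈ S) (hinf : ∀ P ∈ S, ∀ Q ∈ S, P ⊓ Q ∈ S)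
    (hτ : ∀ P ∈ S, τ P ∈ S) (hr0 : ∀ P, 0 ≤ r P) (hrD : ∀ P, r P ≤ D) (hsr : ∀ P, s P ≤ r P)
    (hrmod : ∀ P Q, r (P ⊔ Q) + r (P ⊓ Q) = r P + r Q)
    (hsmod : ∀ P Q, s P + s Q ≤ s (P ⊔ Q) + s (P ⊓ Q))
    (hrτ : ∀ P, r (τ P) = r P) (hsτ : ∀ P, s P ≤ s (τ P))
    (hstrict : ∀ P Q, P ≤ Q → r P = r Q → P = Q) (h : ∃ P ∈ S, r P < 2 * s P) :
    ∃ P ∈ S, τ P = P ∧ r P < 2 * s P := by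
  obtain ⟨Q, hQ, hQ'⟩ := h
  have hD : 0 ≤ D + 1 := by linarith [hr0 Q, hrD Q]
  -- As `0 ≤ r ≤ D`, the weight `v` orders pairs `(2 s - r, r)` lexicographically. A maximum of `v`
  -- is the largest among the most destabilizing elements.
  obtain ⟨v, hv⟩ : ∃ v : X → ℤ, ∀ P, v P = (2 * s P - r P) * (D + 1) + r P := ⟨_, fun _ ↦ rfl⟩
  have hvmod : ∀ P Q, v P + v Q ≤ v (P ⊔ Q) + v (P ⊓ Q) := fun P Q ↦ by
    have h2 := mul_le_mul_of_nonneg_right (hsmod P Q) hD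
    have h3 : r (P ⊓ Q) = r P + r Q - r (P ⊔ Q) := by linarith [hrmod P Q]
    rw [hv, hv, hv, hv, h3]
    linarith
  have hbd : ∀ z, (∃ P ∈ S, v P = z) → z ≤ D * (D + 1) + D := by
    rintro _ ⟨P, -, rfl⟩
    have h1 : 2 * s P - r P ≤ D := by linarith [hsr P, hrD P]
    have := mul_le_mul_of_nonneg_right h1 hD
    rw [hv]
    linarith [hrD P]
  obtain ⟨_, ⟨P, hPS, rfl⟩, hmax⟩ := Int.exists_greatest_of_bdd
    (P := fun z ↦ ∃ P ∈ S, v P = z) ⟨_, hbd⟩ ⟨v Q, Q, hQ, rfl⟩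
  have hmax' : ∀ Q ∈ S, v Q ≤ v P := fun Q hQ ↦ hmax _ ⟨Q, hQ, rfl⟩
  have hpos : r P < 2 * s P := by
    have h1 : 1 ≤ 2 * s Q - r Q := by linarith
    have h2 := mul_le_mul_of_nonneg_right h1 hD
    have h3 := hmax' Q hQ
    by_contra! hcon
    have h4 := mul_le_mul_of_nonneg_right (sub_nonpos.2 hcon) hD
    rw [hv, hv] at h3
    linarith [hrD P, hr0 Q]
  have hvτ : v P ≤ v (τ P) := by
    have := mul_le_mul_of_nonneg_right (hsτ P) hD
    rw [hv, hv, hrτ]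
    linarith
  have hveq : v (P ⊔ τ P) = v P := by
    apply le_antisymm (hmax' _ (hsup _ hPS _ (hτ _ hPS)))
    linarith [hvmod P (τ P), hmax' _ (hinf _ hPS _ (hτ _ hPS))]
  -- Equal weights make the ranks congruent modulo `D + 1`, and both lie in `[0, D]`. So `P ⊔ τ P =
  -- P`, and equality of ranks turns `τ P ≤ P` into equality.
  have hrsup : r (P ⊔ τ P) = r P := by
    rw [hv, hv] at hveq
    have h1 : (D + 1) ∣ r (P ⊔ τ P) - r P :=
      ⟨(2 * s P - r P) - (2 * s (P ⊔ τ P) - r (P ⊔ τ P)), by linarith⟩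
    have h2 := Int.eq_zero_of_abs_lt_dvd h1 (by
      rw [abs_lt]
      constructor <;> linarith [hrD P, hr0 P, hrD (P ⊔ τ P), hr0 (P ⊔ τ P)])
    linarith
  have heq : P = P ⊔ τ P := hstrict _ _ le_sup_left hrsup.symm
  exact ⟨P, hPS, hstrict _ _ (sup_eq_left.1 heq.symm) (hrτ P), hpos⟩

/-- If some member of a lattice of subspaces destabilizes `F`, then so does a member which is
stable under a given automorphism preserving the lattice and `F`. -/
theorem exists_stable_destabilizing [FiniteDimensional K N] {S : Set (Submodule K N)}
    (hsup : ∀ P ∈ S, ∀ Q ∈ S, P ⊔ Q ∈ S) (hinf : ∀ P ∈ S, ∀ Q ∈ S, P ⊓ Q ∈ S)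
    {u : Module.End K N} (hu : Function.Injective u) (hmap : ∀ P ∈ S, P.map u ∈ S)
    {F : Submodule L (L ⊗[K] N)} (hF : ∀ x ∈ F, u.baseChange L x ∈ F)
    (h : ∃ P ∈ S, finrank K P < 2 * finrank L ↥(P.baseChange L ⊓ F)) :
    ∃ P ∈ S, P.map u = P ∧ finrank K P < 2 * finrank L ↥(P.baseChange L ⊓ F) := by
  have key := exists_fixed_of_modular (S := S) (τ := fun P ↦ P.map u)
    (r := fun P ↦ (finrank K P : ℤ)) (s := fun P ↦ (finrank L ↥(P.baseChange L ⊓ F) : ℤ))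
    (D := finrank K N) hsup hinf hmap (fun P ↦ Int.natCast_nonneg _)
    (fun P ↦ Int.ofNat_le.2 (Submodule.finrank_le P)) (fun P ↦ Int.ofNat_le.2 ?_) (fun P Q ↦ ?_)
    (fun P Q ↦ ?_) (fun P ↦ ?_) (fun P ↦ Int.ofNat_le.2 ?_)
    (fun P Q hPQ hr ↦ Submodule.eq_of_le_of_finrank_eq hPQ (Int.ofNat_inj.1 hr))
    (h.imp fun P hP ↦ ⟨hP.1, by exact_mod_cast hP.2⟩)
  · obtain ⟨P, h1, h2, h3⟩ := key
    exact ⟨P, h1, h2, by exact_mod_cast h3⟩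
  · rw [← finrank_submodule_baseChange (L := L) P]
    exact Submodule.finrank_mono inf_le_left
  · exact_mod_cast Submodule.finrank_sup_add_finrank_inf_eq P Q
  · have h1 := Submodule.finrank_sup_add_finrank_inf_eq (P.baseChange L ⊓ F) (Q.baseChange L ⊓ F)
    rw [← inf_inf_distrib_right, ← submodule_baseChange_inf] at h1
    have h2 : (P.baseChange L ⊓ F) ⊔ (Q.baseChange L ⊓ F) ≤ (P ⊔ Q).baseChange L ⊓ F := by
      rw [submodule_baseChange_sup]
      exact sup_le (inf_le_inf_right _ le_sup_left) (inf_le_inf_right _ le_sup_right)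
    have h3 := Submodule.finrank_mono h2
    omega
  · rw [← (Submodule.equivMapOfInjective u hu P).finrank_eq]
  · have hinj : Function.Injective (u.baseChange L) :=
      Module.Flat.lTensor_preserves_injective_linearMap (M := L) u hu
    rw [(Submodule.equivMapOfInjective (u.baseChange L) hinj (P.baseChange L ⊓ F)).finrank_eq]
    apply Submodule.finrank_mono
    rintro _ ⟨x, ⟨hx, hxF⟩, rfl⟩
    exact ⟨baseChange_apply_mem (fun n hn ↦ Submodule.mem_map_of_mem hn) hx, hF x hxF⟩

end BaseChange

end PolarizedIsocrystal

namespace PolarizedIsocrystal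

open GroupFunctor

variable {p : ℕ} [Fact p.Prime] {k : Type} [Field k] [CharP k p] [PerfectRing k p]
variable {N : Type} [AddCommGroup N] [Isocrystal p k N]
variable [Module ℚ_[p] N] [IsScalarTower ℚ_[p] K(p, k) N] [FiniteDimensional K(p, k) N]
variable {ψ : LinearMap.BilinForm K(p, k) N}

/-! ### Cocharacters of the centralizer -/

section Cocharacter

variable (hψ : IsPolarization p k ψ) (h : (J p k ψ).obj (CommAlgCat.of ℚ_[p] ℚ_[p]))

/-- The element acting by `t` and `t⁻¹` on the ranges of `f` and `g` and trivially on the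
complement. -/
def cocharElem (f g : isocrystalEnd p k N) {R : Type} [CommRing R] [Algebra ℚ_[p] R] (t : Rˣ) :
    R ⊗[ℚ_[p]] isocrystalEnd p k N :=
  (t : R) ⊗ₜ f + ((t⁻¹ : Rˣ) : R) ⊗ₜ g + 1 ⊗ₜ (1 - f - g)

variable {f g : isocrystalEnd p k N}

omit [FiniteDimensional K(p, k) N] in
lemma cocharElem_mul (hff : f * f = f) (hgg : g * g = g) (hfg : f * g = 0) (hgf : g * f = 0)
    {R : Type} [CommRing R] [Algebra ℚ_[p] R] (t s : Rˣ) :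
    cocharElem f g t * cocharElem f g s = cocharElem f g (t * s) := by
  have h1 : f * (1 - f - g) = 0 := by rw [mul_sub, mul_sub, mul_one, hff, hfg, sub_self, sub_zero]
  have h2 : g * (1 - f - g) = 0 := by rw [mul_sub, mul_sub, mul_one, hgg, hgf, sub_zero, sub_self]
  have h3 : (1 - f - g) * f = 0 := by rw [sub_mul, sub_mul, one_mul, hff, hgf, sub_self, sub_zero]
  have h4 : (1 - f - g) * g = 0 := by rw [sub_mul, sub_mul, one_mul, hgg, hfg, sub_zero, sub_self]
  have h5 : (1 - f - g) * (1 - f - g) = 1 - f - g := by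
    rw [sub_mul _ g, sub_mul 1 f, one_mul, h1, h2, sub_zero, sub_zero]
  simp only [cocharElem]
  generalize 1 - f - g = l at *
  simp only [add_mul, mul_add, Algebra.TensorProduct.tmul_mul_tmul, hff, hgg, hfg, hgf, h1, h2, h3,
    h4, h5, tmul_zero, add_zero, zero_add, mul_one, mul_inv_rev, Units.val_mul]
  rw [mul_comm ((s⁻¹ : Rˣ) : R)]

omit [FiniteDimensional K(p, k) N] in
lemma cocharElem_one {R : Type} [CommRing R] [Algebra ℚ_[p] R] :
    cocharElem f g (1 : Rˣ) = 1 := by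
  rw [cocharElem, inv_one, Units.val_one, ← tmul_add, ← tmul_add, Algebra.TensorProduct.one_def]
  congr 1
  abel

/-- The involution swaps `f` and `g`, hence `t` and `t⁻¹`; combined with multiplicativity this makes
the element unitary. -/
lemma starEnd_cocharElem (hs : starEnd hψ f = g) {R : Type} [CommRing R] [Algebra ℚ_[p] R]
    (t : Rˣ) : (starEnd hψ).baseChange R (cocharElem f g t) = cocharElem f g t⁻¹ := by
  have hs' : starEnd hψ g = f := by rw [← hs, starEnd_starEnd]
  simp only [cocharElem, map_add, LinearMap.baseChange_tmul, map_sub, hs, hs', starEnd_one, inv_inv]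
  rw [sub_right_comm, add_comm ((t : R) ⊗ₜ[ℚ_[p]] g)]

omit [FiniteDimensional K(p, k) N] in
lemma map_cocharElem {R S : Type} [CommRing R] [Algebra ℚ_[p] R] [CommRing S] [Algebra ℚ_[p] S]
    (φ : R →ₐ[ℚ_[p]] S) (t : Rˣ) :
    Algebra.TensorProduct.map φ (AlgHom.id ℚ_[p] _) (cocharElem f g t) =
      cocharElem f g (Units.map (φ : R →* S) t) := by
  simp only [cocharElem, map_add, Algebra.TensorProduct.map_tmul, AlgHom.coe_id, id_eq, map_one,
    ← map_inv]
  rfl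

/-- The cocharacter `t ↦ t f + t⁻¹ f* + (1 - f - f*)` of the centralizer of `h`. -/
def cocharacter (hff : f * f = f) (hgg : g * g = g) (hfg : f * g = 0) (hgf : g * f = 0)
    (hs : starEnd hψ f = g) (hf : Commute f (toIsocrystalEnd h))
    (hg : Commute g (toIsocrystalEnd h)) :
    splitTorus ℚ_[p] 1 ⟶ (centralizer (J p k ψ) h).toFunctor where
  app R := GrpCat.ofHom
    { toFun := fun t ↦ ⟨unitaryPoint hψ (cocharElem f g (t 0))
          (by rw [starEnd_cocharElem hψ hs, cocharElem_mul hff hgg hfg hgf, mul_inv_cancel,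
            cocharElem_one])
          (by rw [starEnd_cocharElem hψ hs, cocharElem_mul hff hgg hfg hgf, inv_mul_cancel,
            cocharElem_one]),
        unitaryPoint_mem_centralizer hψ h _ _ _ (by
          have key : ∀ (r : R) (a : isocrystalEnd p k N), Commute a (toIsocrystalEnd h) →
              Commute (r ⊗ₜ[ℚ_[p]] a) ((1 : R) ⊗ₜ toIsocrystalEnd h) := fun r a ha ↦ by
            rw [commute_iff_eq, Algebra.TensorProduct.tmul_mul_tmul,
              Algebra.TensorProduct.tmul_mul_tmul, ha.eq, one_mul, mul_one]
          exact ((key _ _ hf).add_left (key _ _ hg)).add_left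
            (key _ _ (((Commute.one_left _).sub_left hf).sub_left hg)))⟩
      map_one' := Subtype.ext (J_ext ((congrArg (rho p k N R) cocharElem_one).trans (map_one _)))
      map_mul' := fun t s ↦ Subtype.ext (J_ext (by
        change rho p k N R (cocharElem f g (t 0 * s 0)) = rho p k N R _ * rho p k N R _
        rw [← cocharElem_mul hff hgg hfg hgf, map_mul])) }
  naturality R S φ := by
    ext t
    apply Subtype.ext
    apply J_ext
    change rho p k N S (cocharElem f g (Units.map (φ.hom : R →* S) (t 0))) =
      endBaseChange φ.hom (rho p k N R (cocharElem f g (t 0)))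
    rw [endBaseChange_rho, map_cocharElem]

variable [IsAlgClosed k]

open SymplecticSimilitude in
/-- The centralizer of an element which is regular and elliptic has no noncentral cocharacter. -/
theorem eq_zero_of_isElliptic (hslope : IsIsoclinic p k N 1 2) (hreg : IsRegularElement h)
    (hell : IsEllipticElement h) (hff : f * f = f) (hgg : g * g = g) (hfg : f * g = 0)
    (hgf : g * f = 0) (hs : starEnd hψ f = g) (hf : Commute f (toIsocrystalEnd h))
    (hg : Commute g (toIsocrystalEnd h)) : f = 0 := by
  ext n
  by_contra hne
  let m := f.1 n
  have hfm : f.1 m = m := congrArg (fun a : isocrystalEnd p k N ↦ a.1 n) hff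
  have hgm : g.1 m = 0 := congrArg (fun a : isocrystalEnd p k N ↦ a.1 n) hgf
  have hs' : starEnd hψ g = f := by rw [← hs, starEnd_starEnd]
  -- Any rational `t` with `t ≠ t⁻¹` detects that the cocharacter is not central.
  let two : (ℚ_[p])ˣ := Units.mk0 2 two_ne_zero
  have hcen := isAnisotropicModCenter_centralizer h hreg hell
    (cocharacter hψ h hff hgg hfg hgf hs hf hg) (CommAlgCat.of ℚ_[p] ℚ_[p]) (fun _ ↦ two)
  let A := K(p, k)
  -- With `m` a nonzero vector in the range of `f`, this yields a unipotent point `1 + y` of `𝐉`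
  -- over `K`. A central cocharacter would have to commute with it.
  let x : Module.End A (A ⊗[K(p, k)] N) := (symOp ψ m m).baseChange A
  have hxs : ∀ a b, ψ.baseChange A (x a) b = -ψ.baseChange A a (x b) := by
    intro a b
    rw [eq_neg_iff_add_eq_zero]
    induction a with
    | zero => simp
    | add a a' ha hb =>
      rw [map_add, map_add, map_add, LinearMap.add_apply, LinearMap.add_apply, add_add_add_comm,
        ha, hb, add_zero]
    | tmul r y =>
      induction b with
      | zero => simp
      | add b b' ha hb => rw [map_add, map_add, map_add, add_add_add_comm, ha, hb, add_zero]
      | tmul s z =>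
        simp only [x, LinearMap.baseChange_tmul, LinearMap.BilinForm.baseChange_tmul,
          symOp_skew hψ.isAlt]
        rw [neg_smul, neg_add_cancel]
  have hxx : x * x = 0 := by
    rw [← LinearMap.baseChange_mul, symOp_mul_self hψ.isAlt (hψ.isAlt m), LinearMap.baseChange_zero]
  obtain ⟨y, hyx, hyy, hys⟩ := exists_rhoK_eq hslope hψ A x hxs hxx
  obtain ⟨h1, h2⟩ := one_add_unitary hψ hyy hys
  have key := hcen (CommAlgCat.of ℚ_[p] A) (CommAlgCat.ofHom (Algebra.ofId ℚ_[p] A))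
    (unitaryPoint hψ (1 + y) h1 h2)
  obtain ⟨τ, hτ⟩ : ∃ τ, τ = Units.map ((Algebra.ofId ℚ_[p] A : ℚ_[p] →ₐ[ℚ_[p]] A) : ℚ_[p] →* A) two :=
    ⟨_, rfl⟩
  have hτ2 : (τ : A) = 2 := by rw [hτ]; exact map_ofNat (Algebra.ofId ℚ_[p] A) 2
  let T := cocharElem f g τ
  have key2 : T * (1 + y) = (1 + y) * T := by
    apply rho_injective p k
    have h3 : endBaseChange (Algebra.ofId ℚ_[p] A) (rho p k N ℚ_[p] (cocharElem f g two)) =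
        rho p k N A T := by
      rw [endBaseChange_rho, map_cocharElem, ← hτ]
    rw [map_mul, map_mul, ← h3]
    exact congrArg (fun z : (J p k ψ).obj (CommAlgCat.of ℚ_[p] A) ↦
      (show groupJ p k ψ A from z).1.1) key
  rw [mul_add, add_mul, mul_one, one_mul, add_right_inj] at key2
  have key3 := congrArg (rhoK p k N A) key2
  rw [map_mul, map_mul, hyx] at key3
  obtain ⟨z, hz⟩ : ∃ z, ψ z m ≠ 0 := by
    by_contra! hcon
    exact hne (hψ.nondegenerate.2 m hcon)
  have key4 := congrArg (TensorProduct.lid K(p, k) N) (LinearMap.congr_fun key3 (1 ⊗ₜ z))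
  have hgz : ψ (f.1 z) m = 0 := by rw [starEnd_right hψ, hs, hgm, map_zero]
  have hfz : ψ (g.1 z) m = ψ z m := by rw [starEnd_right hψ, hs', hfm]
  have hkm : (1 - f - g).1 m = 0 := by
    change m - f.1 m - g.1 m = 0
    rw [hfm, hgm, sub_self, sub_zero]
  have hkz : ψ ((1 - f - g).1 z) m = 0 := by
    change ψ (z - f.1 z - g.1 z) m = 0
    rw [map_sub, map_sub, LinearMap.sub_apply, LinearMap.sub_apply, hgz, hfz, sub_zero, sub_self]
  -- Evaluate at a `z` not orthogonal to `m`. On one side `m` is scaled by `τ`; on the other only `g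
  -- z` pairs with `m`, giving `τ⁻¹`. Hence `τ = τ⁻¹` with `τ = 2`.
  simp only [Module.End.mul_apply, x, LinearMap.baseChange_tmul, T, cocharElem, map_add,
    LinearMap.add_apply, rhoK_tmul, mul_one, TensorProduct.lid_tmul, symOp_apply, map_smul, hfm, hgm,
    hkm, hgz, hfz, hkz, smul_zero, zero_smul, add_zero, zero_add] at key4
  have hm : ψ z m • m + ψ z m • m ≠ 0 := by
    rw [← two_smul K(p, k), ← smul_assoc]
    exact smul_ne_zero (mul_ne_zero two_ne_zero hz) hne
  have h5 : (τ : A) = ((τ⁻¹ : Aˣ) : A) := smul_left_injective K(p, k) hm key4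
  have h6 : (2 : A) * 2 = 1 := by
    have := Units.mul_inv τ
    rwa [← h5, hτ2] at this
  norm_num at h6

end Cocharacter

end PolarizedIsocrystal

namespace PolarizedIsocrystal

open GroupFunctor

variable {p : ℕ} [Fact p.Prime] {k : Type} [Field k] [CharP k p] [PerfectRing k p]
variable {N : Type} [AddCommGroup N] [Isocrystal p k N]
variable [Module ℚ_[p] N] [IsScalarTower ℚ_[p] K(p, k) N] [FiniteDimensional K(p, k) N]
variable {ψ : LinearMap.BilinForm K(p, k) N}

/-! ### Weak admissibility of the fixed points -/

-- An injective semilinear map over a field automorphism preserves dimension, so `Φ P ≤ P` is an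
-- equality.
omit [Module ℚ_[p] N] [IsScalarTower ℚ_[p] K(p, k) N] in
lemma exists_Phi_eq_of_stable {P : Submodule K(p, k) N} (hP : ∀ x ∈ P, Phi p k x ∈ P) {n : N}
    (hn : n ∈ P) : ∃ m ∈ P, Phi p k m = n := by
  let F := (Isocrystal.frob (p := p) (k := k) (V := N)).toLinearMap
  have hle : P.map F ≤ P := by
    rintro _ ⟨x, hx, rfl⟩
    exact hP x hx
  let E := Submodule.equivMapOfInjective F (Phi_bijective p k N).1 P
  have hrank : Module.rank K(p, k) P = Module.rank K(p, k) (P.map F) :=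
    rank_eq_of_equiv_equiv (φ(p, k)) E.toAddEquiv (FractionRing.frobenius p k).bijective fun r m ↦ E.map_smulₛₗ r m
  have heq : P.map F = P := Submodule.eq_of_le_of_finrank_eq hle
    (congrArg Cardinal.toNat hrank).symm
  rw [← heq] at hn
  exact hn

/-- The Frobenius conjugate of a `u`-equivariant projector onto `P` again commutes with `u` and has
range `Φ P = P`. The commutant being commutative, the two idempotents commute, so they are equal and
the projector commutes with `Φ`. -/
lemma exists_isocrystalEnd_projector (u : isocrystalEnd p k N)
    (hcomm : ∀ f g, Commute f u.1 → Commute g u.1 → Commute f g)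
    (hred : ∀ f, Commute f u.1 → f * f = 0 → f = 0) {P : Submodule K(p, k) N}
    (hP : ∀ x ∈ P, Phi p k x ∈ P) (hPu : ∀ x ∈ P, u.1 x ∈ P) :
    ∃ e : isocrystalEnd p k N, e * e = e ∧ LinearMap.range e.1 = P ∧ Commute e u := by
  obtain ⟨e, hee, heP, heu⟩ := exists_commuting_projector hred (AlgHom.id K(p, k) _) P hPu
  have heu' : Commute e u.1 := heu
  have h1 : frobConj p k N e * frobConj p k N e = frobConj p k N e := by
    ext n
    simp only [Module.End.mul_apply, frobConj_apply, PhiInv_Phi]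
    rw [← Module.End.mul_apply, hee]
  have h2 : Commute (frobConj p k N e) u.1 := by
    ext n
    obtain ⟨n, rfl⟩ := (Phi_bijective p k N).2 n
    simp only [Module.End.mul_apply, frobConj_apply, PhiInv_Phi,
      ← (mem_isocrystalEnd p k N).1 u.2]
    exact congrArg (Phi p k) (LinearMap.congr_fun heu'.eq n)
  have h3 : LinearMap.range (frobConj p k N e) = P := by
    ext n
    constructor
    · rintro ⟨m, rfl⟩
      exact hP _ (heP ▸ ⟨_, rfl⟩)
    · intro hn
      obtain ⟨m, hm, rfl⟩ := exists_Phi_eq_of_stable hP hn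
      rw [← heP] at hm
      obtain ⟨x, rfl⟩ := hm
      exact ⟨Phi p k x, by rw [frobConj_apply, PhiInv_Phi]⟩
  have h4 : frobConj p k N e = e :=
    idempotent_eq_of_range_eq h1 hee (hcomm _ _ h2 heu') (h3.trans heP.symm)
  exact ⟨⟨e, (mem_isocrystalEnd p k N).2 ((frobConj_eq_self_iff p k N e).1 h4)⟩, Subtype.ext hee, heP,
    Subtype.ext heu'.eq⟩

variable [IsAlgClosed k]

/-- Idempotents commuting with a regular elliptic element are self-adjoint. -/
lemma starEnd_eq_self_of_isElliptic (hslope : IsIsoclinic p k N 1 2) (hψ : IsPolarization p k ψ)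
    (h : (J p k ψ).obj (CommAlgCat.of ℚ_[p] ℚ_[p])) (hreg : IsRegularElement h)
    (hell : IsEllipticElement h) {c : K(p, k)} (hc : c ≠ 0)
    (hu : ∀ x y, ψ (toEnd h x) (toEnd h y) = c * ψ x y)
    (hcomm : ∀ f g, Commute f (toEnd h) → Commute g (toEnd h) → Commute f g)
    {e : isocrystalEnd p k N} (hee : e * e = e) (heu : Commute e (toIsocrystalEnd h)) :
    starEnd hψ e = e := by
  let e' := starEnd hψ e
  let u := toIsocrystalEnd h
  have hu' : ∀ x y, ψ (u.1 x) (u.1 y) = c * ψ x y := hu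
  have hee' : e' * e' = e' := by rw [← starEnd_mul, hee]
  have hinj : Function.Injective u.1 := by
    rw [injective_iff_map_eq_zero]
    intro x hx
    refine hψ.nondegenerate.1 x fun y ↦ (mul_eq_zero.1 ?_).resolve_left hc
    rw [← hu', hx, map_zero, LinearMap.zero_apply]
  have hsurj : Function.Surjective u.1 := LinearMap.injective_iff_surjective.1 hinj
  have heu' : Commute e' u := by
    ext y
    refine sub_eq_zero.1 (hψ.nondegenerate.2 _ fun x ↦ ?_)
    obtain ⟨x, rfl⟩ := hsurj x
    have h1 : ∀ x, e.1 (u.1 x) = u.1 (e.1 x) := fun x ↦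
      congrArg (fun a : isocrystalEnd p k N ↦ a.1 x) heu.eq
    change ψ (u.1 x) (e'.1 (u.1 y) - u.1 (e'.1 y)) = 0
    rw [map_sub, ← starEnd_right hψ, h1, hu', hu', ← starEnd_right hψ, sub_self]
  have hcom : e * e' = e' * e := Subtype.ext
    (hcomm e.1 e'.1 (congrArg Subtype.val heu.eq) (congrArg Subtype.val heu'.eq)).eq
  have hs' : starEnd hψ e' = e := starEnd_starEnd hψ e
  have hstar : starEnd hψ (e * (1 - e')) = e' * (1 - e) := by
    rw [starEnd_mul, map_sub, starEnd_one, hs', sub_mul, mul_sub, one_mul, mul_one, hcom]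
  have h0 : ∀ a : isocrystalEnd p k N, a * a = a → a * (1 - a) = 0 := fun a ha ↦ by
    rw [mul_sub, mul_one, ha, sub_self]
  have hc1 : Commute e e' := hcom
  have hc2 : Commute (1 - e') e' := (Commute.one_left _).sub_left (Commute.refl _)
  have hc3 : Commute (1 - e) e := (Commute.one_left _).sub_left (Commute.refl _)
  have hc4 : Commute (1 - e') e := (Commute.one_left _).sub_left hc1.symm
  have hc5 : Commute (1 - e) e' := (Commute.one_left _).sub_left hc1
  have hi : IsIdempotentElem (1 - e) := IsIdempotentElem.one_sub hee
  have hi' : IsIdempotentElem (1 - e') := IsIdempotentElem.one_sub hee'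
  have hcu : Commute (1 - e) u := (Commute.one_left _).sub_left heu
  have hcu' : Commute (1 - e') u := (Commute.one_left _).sub_left heu'
  -- The idempotents `e (1 - e')` and `e' (1 - e)` are orthogonal and exchanged by the involution,
  -- so ellipticity kills the first. This gives `e = e e'`, the adjoint relation gives `e' = e' e`,
  -- and commutation makes the two equal.
  have hf := eq_zero_of_isElliptic hψ h (f := e * (1 - e')) (g := e' * (1 - e)) hslope hreg hell
    (by rw [hc4.mul_mul_mul_comm, hee, hi'.eq])
    (by rw [hc5.mul_mul_mul_comm, hee', hi.eq])
    (by rw [mul_assoc, ← mul_assoc (1 - e'), hc2.eq, h0 e' hee', zero_mul, mul_zero])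
    (by rw [mul_assoc, ← mul_assoc (1 - e), hc3.eq, h0 e hee, zero_mul, mul_zero])
    hstar (heu.mul_left hcu') (heu'.mul_left hcu)
  have h1 : e = e * e' := by
    rw [mul_sub, mul_one, sub_eq_zero] at hf
    exact hf
  have h2 : e' = e' * e := by
    rw [hf, map_zero, mul_sub, mul_one, eq_comm, sub_eq_zero] at hstar
    exact hstar
  rw [← hcom, ← h1] at h2
  exact h2

/-- A violation of weak admissibility can be moved to a subspace stable under both `Φ` and `h`. Its
equivariant projector is self-adjoint by ellipticity, which forces `2 dim (P_L ∩ Fil) ≤ dim P` as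
`Fil` is isotropic. -/
theorem isWeaklyAdmissible_of_isElliptic (hslope : IsIsoclinic p k N 1 2)
    (hψ : IsPolarization p k ψ) (h : (J p k ψ).obj (CommAlgCat.of ℚ_[p] ℚ_[p]))
    (hreg : IsRegularElement h) (hell : IsEllipticElement h)
    (hcomm : ∀ f g, Commute f (toEnd h) → Commute g (toEnd h) → Commute f g)
    (hred : ∀ f, Commute f (toEnd h) → f * f = 0 → f = 0) {d : ℕ} (L : Type) [Field L]
    [Algebra K(p, k) L] {Fil : G(d, (L ⊗[K(p, k)] N); L)}
    (hFil : Fil ∈ fixedPoints d ψ (toEnd h) L) : IsWeaklyAdmissible p k L Fil.toSubmodule := by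
  by_contra hcon
  simp only [IsWeaklyAdmissible, not_forall, not_le] at hcon
  obtain ⟨P₀, hP₀, hlt⟩ := hcon
  obtain ⟨c, hc, hu⟩ := exists_similitude_factor h
  have hinj : Function.Injective (toEnd h) := by
    rw [injective_iff_map_eq_zero]
    intro x hx
    refine hψ.nondegenerate.1 x fun y ↦ (mul_eq_zero.1 ?_).resolve_left hc
    rw [← hu, hx, map_zero, LinearMap.zero_apply]
  have hΦ : ∀ n, Phi p k (toEnd h n) = toEnd h (Phi p k n) :=
    (mem_isocrystalEnd p k N).1 (toIsocrystalEnd h).2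
  obtain ⟨P, hP, hPu, hlt'⟩ := exists_stable_destabilizing (L := L)
    (S := {P : Submodule K(p, k) N | ∀ x ∈ P, Phi p k x ∈ P}) (u := toEnd h) (F := Fil.toSubmodule)
    (fun P hP Q hQ x hx ↦ by
      obtain ⟨a, ha, b, hb, rfl⟩ := Submodule.mem_sup.1 hx
      rw [Phi_add]
      exact Submodule.add_mem_sup (hP a ha) (hQ b hb))
    (fun P hP Q hQ x hx ↦ ⟨hP x hx.1, hQ x hx.2⟩) hinj
    (by
      rintro P hP _ ⟨x, hx, rfl⟩
      exact ⟨_, hP x hx, (hΦ x).symm⟩)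
    (fun x hx ↦ hFil.2 ▸ Submodule.mem_map_of_mem hx)
    ⟨P₀, hP₀, by
      rw [one_div, inv_mul_lt_iff₀ two_pos] at hlt
      exact_mod_cast hlt⟩
  obtain ⟨e, hee, heP, heu⟩ := exists_isocrystalEnd_projector (toIsocrystalEnd h) hcomm hred hP
    (fun x hx ↦ hPu ▸ Submodule.mem_map_of_mem hx)
  have hse := starEnd_eq_self_of_isElliptic hslope hψ h hreg hell hc hu hcomm hee heu
  refine absurd (two_mul_finrank_le_of_projector hψ.nondegenerate hψ.isAlt (e := e.1) (P := P)
    (fun n ↦ heP ▸ ⟨n, rfl⟩) (fun n hn ↦ ?_) (fun x y ↦ ?_) (P.baseChange L ⊓ Fil.toSubmodule)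
    inf_le_left fun x hx y hy ↦ ?_) (not_le.2 hlt')
  · rw [← heP] at hn
    obtain ⟨m, rfl⟩ := hn
    exact congrArg (fun a : isocrystalEnd p k N ↦ a.1 m) hee
  · rw [starEnd_right hψ, hse]
  · have hy' := hy.2
    rw [← hFil.1] at hy'
    exact hy' x hx.2

end PolarizedIsocrystal
end

open PolarizedIsocrystal GroupFunctor in
theorem mainTheorem11 (p : ℕ) [Fact p.Prime] (d : ℕ) (hd : 1 ≤ d)
    (N : Type) [AddCommGroup N] [Isocrystal p (AlgebraicClosure (ZMod p)) N]
    [Module ℚ_[p] N] [IsScalarTower ℚ_[p] K(p, AlgebraicClosure (ZMod p)) N]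
    [FiniteDimensional K(p, AlgebraicClosure (ZMod p)) N]
    (hdim : Module.finrank K(p, AlgebraicClosure (ZMod p)) N = 2 * d)
    (hslope : IsIsoclinic p (AlgebraicClosure (ZMod p)) N 1 2)
    (ψ : LinearMap.BilinForm K(p, AlgebraicClosure (ZMod p)) N)
    (hψ : IsPolarization p (AlgebraicClosure (ZMod p)) ψ)
    (h : (J p (AlgebraicClosure (ZMod p)) ψ).obj (CommAlgCat.of ℚ_[p] ℚ_[p]))
    (hreg : IsRegularElement h) :
    FixedPointsDiscreteMultiplicityOne d ψ (toEnd h) ∧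
      (IsEllipticElement h →
        ∀ (L : Type) [Field L] [Algebra K(p, AlgebraicClosure (ZMod p)) L]
          [FiniteDimensional K(p, AlgebraicClosure (ZMod p)) L],
          ∀ Fil ∈ fixedPoints d ψ (toEnd h) L,
            IsWeaklyAdmissible p (AlgebraicClosure (ZMod p)) L Fil.toSubmodule) := by
  -- The auxiliary algebraically closed field is the algebraic closure of `K`; the conclusions
  -- concern endomorphisms of `N` itself.
  obtain ⟨hcomm, hred⟩ := commute_and_reduced_of_regular hslope hψ h hreg
    (AlgebraicClosure K(p, AlgebraicClosure (ZMod p)))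
  obtain ⟨c, hc, hu⟩ := exists_similitude_factor h
  exact ⟨fixedPointsDiscreteMultiplicityOne hψ.nondegenerate hψ.isAlt hdim hc hu hcomm hred,
    fun hell L _ _ _ Fil hFil ↦
      isWeaklyAdmissible_of_isElliptic hslope hψ h hreg hell hcomm hred L hFil⟩
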